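/- Let $\varepsilon>0$ and a prime $p>2$ be fixed, and let $\Phi:\mathbb{R}\to\mathbb{R}_{\ge 0}$ be a fixed Schwartz class function with Fourier transform $\hat\Phi(y)=\int_{\mathbb{R}}\Phi(x)e^{-2\pi i xy}\,dx$. Set $q:=p^n$. For integers $\alpha_1,\alpha_2,\alpha_3$ coprime to $p$ put $$s_p(\alpha_1,\alpha_2,\alpha_3):=2+\left(\frac{-\alpha_1\alpha_2}{p}\right)+\left(\frac{-\alpha_1\alpha_3}{p}\right)+\left(\frac{-\alpha_2\alpha_3}{p}\right),\qquad C_p(\alpha_1,\alpha_2,\alpha_3):=\frac{(p-s_p(\alpha_1,\alpha_2,\alpha_3))(p-1)}{p^2},$$ where $\left(\frac{\cdot}{p}\right)$ is the Legendre symbol. For every $n$ let $\alpha_1,\alpha_2,\alpha_3$ be integers coprime to $p$, which are allowed to vary with $n$, such that $p>s_p(\alpha_1,\alpha_2,\alpha_3)$, and let $N=N(n)$ be a real number with $N\ge q^{11/18+\varepsilon}$. Then the sum below converges absolutely for every $n$, and as $n\to\infty$, $$\sum_{\substack{(x_1,x_2,x_3)\in\mathbb{Z}^3\\ (x_1x_2x_3,p)=1\\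 \alpha_1x_1^2+\alpha_2x_2^2+\alpha_3x_3^2\equiv 0\bmod q}}\Phi\left(\frac{x_1}{N}\right)\Phi\left(\frac{x_2}{N}\right)\Phi\left(\frac{x_3}{N}\right)\sim\hat\Phi(0)^3\cdot C_p(\alpha_1,\alpha_2,\alpha_3)\cdot\frac{N^3}{q},$$ where $f\sim g$ means $f-g=o(g)$. -/

import Mathlib

open scoped FourierTransform SchwartzMap

/-- `s_p(a₁,a₂,a₃) = 2 + (-a₁a₂/p) + (-a₁a₃/p) + (-a₂a₃/p)`, with Legendre symbols modulo `p`. -/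
def sSym (p : ℕ) [Fact p.Prime] (a₁ a₂ a₃ : ℤ) : ℤ :=
  2 + legendreSym p (-(a₁ * a₂)) + legendreSym p (-(a₁ * a₃)) + legendreSym p (-(a₂ * a₃))

/-- `C_p(a₁,a₂,a₃) = (p - s_p(a₁,a₂,a₃)) (p - 1) / p²`. -/
noncomputable def cConst (p : ℕ) [Fact p.Prime] (a₁ a₂ a₃ : ℤ) : ℝ :=
  ((p : ℝ) - (sSym p a₁ a₂ a₃ : ℝ)) * ((p : ℝ) - 1) / (p : ℝ) ^ 2

/-- The integer triples with `(x₁x₂x₃, p) = 1` and `a₁x₁² + a₂x₂² + a₃x₃² ≡ 0 mod q`. -/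
def solSet (p q : ℕ) (a₁ a₂ a₃ : ℤ) : Set (ℤ × ℤ × ℤ) :=
  {x | IsCoprime (x.1 * x.2.1 * x.2.2) (p : ℤ) ∧
    a₁ * x.1 ^ 2 + a₂ * x.2.1 ^ 2 + a₃ * x.2.2 ^ 2 ≡ 0 [ZMOD (q : ℤ)]}

/-- The weight `Φ(x₁/N) Φ(x₂/N) Φ(x₃/N)` of an integer triple. -/
noncomputable def tripleWeight (Φ : 𝓢(ℝ, ℝ)) (N : ℝ) (x : ℤ × ℤ × ℤ) : ℝ :=
  Φ ((x.1 : ℝ) / N) * Φ ((x.2.1 : ℝ) / N) * Φ ((x.2.2 : ℝ) / N)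

/-- The Fourier transform `y ↦ ∫ Φ(x) exp(-2πixy) dx` of a real-valued Schwartz function. -/
noncomputable def phiHat (Φ : 𝓢(ℝ, ℝ)) : ℝ → ℂ :=
  𝓕 (fun x : ℝ => (Φ x : ℂ))

/-! Poisson summation in each residue class on the cone modulo `q = p^n` turns the sum into
`(N/q)^3` times the sum over `l ∈ ℤ³` of the product weight of the Fourier transform at `l * N/q`
times the exponential sum `coneSum` (`tsum_eq_tsum_coneSum`). The frequency `l = 0` counts the unit
points of the cone, `C_p q²` in number (`card_unitZeros_eq`), and gives the main term. As `C_p` is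
bounded below uniformly in the coefficients, it remains to show that the other frequencies
contribute `o(q²)` before the factor `(N/q)^3` (`exists_error_bound`). Rapid decay disposes of
frequencies beyond `K = q^(ε/2) / (N/q) ≤ q^(7/18 - ε/2)`.

For `l = p^k l'` with `p` not dividing `l'`, detecting the cone by additive characters writes
`coneSum` as an average over multipliers `t` of products of three quadratic Gauss sums. Only `t` of
valuation `k` survive, which bounds the sum by `p^((3n+k)/2)` (`norm_coneSum_le`). Scaling `t` by
squares of units near 1 fixes the Gauss sums but rotates their common phase, so the sum vanishes
unless `l'` has unit coordinates and `p^(n-1-k)` divides the adjugate form at `l'`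
(`unitCoords_and_dvd_of_coneSum_ne_zero`).

What is left is to count short zeros of a diagonal ternary form modulo `p^M`. Write `p^M = r^36`.
For a box of size `K ≤ r^14` the count is `O(K r^3 log K)` (`card_zeros_le`). Zeros in one
projective class modulo `p^j > 2K` have Gram determinant so divisible that they are coplanar, and
there are `O(K)` classes. On a plane with primitive normal `l` the zeros fall into two `p`-adic
discs, and an area argument bounds their number in terms of `1/‖l‖` (`card_plane_le`). A plane with
many zeros must have a short normal which is itself a zero of the adjugate form modulo a large power
of `p`, and such normals are sparse (`sum_inv_supAbs_le`).

Altogether the nonzero frequencies up to `K` cost at most `q^(2 - 11/648)` up to constants and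
logarithms. -/

/-! ### Integer vectors, cross products and primitive vectors -/

def dot3 (u v : ℤ × ℤ × ℤ) : ℤ := u.1 * v.1 + u.2.1 * v.2.1 + u.2.2 * v.2.2

def cross3 (u v : ℤ × ℤ × ℤ) : ℤ × ℤ × ℤ :=
  (u.2.1 * v.2.2 - u.2.2 * v.2.1, u.2.2 * v.1 - u.1 * v.2.2, u.1 * v.2.1 - u.2.1 * v.1)

/-- The diagonal quadratic form with coefficients `b`. -/
def diagForm (b v : ℤ × ℤ × ℤ) : ℤ := b.1 * v.1 ^ 2 + b.2.1 * v.2.1 ^ 2 + b.2.2 * v.2.2 ^ 2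

/-- The symmetric bilinear form attached to `diagForm b`. -/
def diagBilin (b u v : ℤ × ℤ × ℤ) : ℤ :=
  b.1 * (u.1 * v.1) + b.2.1 * (u.2.1 * v.2.1) + b.2.2 * (u.2.2 * v.2.2)

/-- The coefficients of the adjugate form. -/
def adjCoeff (b : ℤ × ℤ × ℤ) : ℤ × ℤ × ℤ := (b.2.1 * b.2.2, b.1 * b.2.2, b.1 * b.2.1)

def supAbs (v : ℤ × ℤ × ℤ) : ℕ := max v.1.natAbs (max v.2.1.natAbs v.2.2.natAbs)

/-- Every coordinate is prime to `p`. -/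
def UnitCoords (p : ℕ) (v : ℤ × ℤ × ℤ) : Prop :=
  ¬ (p : ℤ) ∣ v.1 ∧ ¬ (p : ℤ) ∣ v.2.1 ∧ ¬ (p : ℤ) ∣ v.2.2

/-- The coordinates have no common factor. -/
def Primitive3 (v : ℤ × ℤ × ℤ) : Prop := ∃ u, dot3 u v = 1

theorem supAbs_le_iff {v : ℤ × ℤ × ℤ} {K : ℕ} :
    supAbs v ≤ K ↔ |v.1| ≤ K ∧ |v.2.1| ≤ K ∧ |v.2.2| ≤ K := by
  simp only [supAbs, max_le_iff, Int.abs_eq_natAbs, Nat.cast_le]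

theorem supAbs_pos_of_primitive {v : ℤ × ℤ × ℤ} (h : Primitive3 v) : 0 < supAbs v := by
  obtain ⟨u, hu⟩ := h
  by_contra h0
  have h0 : supAbs v ≤ 0 := by omega
  rw [supAbs_le_iff] at h0
  simp only [Nat.cast_zero, abs_nonpos_iff] at h0
  simp [dot3, h0] at hu

/-- Expand `u × (l × v) = (u·v) l - (u·l) v`. -/
theorem eq_smul_of_cross_eq_zero {u l v : ℤ × ℤ × ℤ} (hu : dot3 u l = 1)
    (h : cross3 l v = 0) : v = (dot3 u v * l.1, dot3 u v * l.2.1, dot3 u v * l.2.2) := by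
  obtain ⟨l1, l2, l3⟩ := l
  obtain ⟨u1, u2, u3⟩ := u
  obtain ⟨v1, v2, v3⟩ := v
  simp only [cross3, dot3, Prod.mk_eq_zero] at *
  obtain ⟨h1, h2, h3⟩ := h
  ext <;> simp only
  · linear_combination (-v1) * hu - u2 * h3 + u3 * h2
  · linear_combination (-v2) * hu + u1 * h3 - u3 * h1
  · linear_combination (-v3) * hu - u1 * h2 + u2 * h1

/-- `l × (a × b) = (l·b) a - (l·a) b` vanishes. The scalar `dot3 u (cross3 a b)` is the area form of
the lattice plane orthogonal to `l`, and it measures below how close two zeros are `p`-adically. -/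
theorem cross3_eq_smul {u l a b : ℤ × ℤ × ℤ} (hu : dot3 u l = 1) (ha : dot3 a l = 0)
    (hb : dot3 b l = 0) :
    cross3 a b = (dot3 u (cross3 a b) * l.1, dot3 u (cross3 a b) * l.2.1,
      dot3 u (cross3 a b) * l.2.2) := by
  apply eq_smul_of_cross_eq_zero hu
  obtain ⟨l1, l2, l3⟩ := l
  obtain ⟨a1, a2, a3⟩ := a
  obtain ⟨b1, b2, b3⟩ := b
  simp only [cross3, dot3, Prod.mk_eq_zero] at *
  refine ⟨?_, ?_, ?_⟩
  · linear_combination a1 * hb - b1 * ha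
  · linear_combination a2 * hb - b2 * ha
  · linear_combination a3 * hb - b3 * ha

theorem supAbs_cross3_le {a b : ℤ × ℤ × ℤ} {K : ℕ} (ha : supAbs a ≤ K) (hb : supAbs b ≤ K) :
    supAbs (cross3 a b) ≤ 2 * K ^ 2 := by
  rw [supAbs_le_iff] at *
  obtain ⟨a1, a2, a3⟩ := a
  obtain ⟨b1, b2, b3⟩ := b
  simp only [cross3] at *
  have key : ∀ x y z w : ℤ, |x| ≤ K → |y| ≤ K → |z| ≤ K → |w| ≤ K →
      |x * y - z * w| ≤ ((2 * K ^ 2 : ℕ) : ℤ) := by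
    intro x y z w hx hy hz hw
    have h1 : |x * y| ≤ K * K := by rw [abs_mul]; gcongr
    have h2 : |z * w| ≤ K * K := by rw [abs_mul]; gcongr
    have := abs_sub (x * y) (z * w)
    push_cast
    nlinarith
  exact ⟨key _ _ _ _ ha.2.1 hb.2.2 ha.2.2 hb.2.1, key _ _ _ _ ha.2.2 hb.1 ha.1 hb.2.2,
    key _ _ _ _ ha.1 hb.2.1 ha.2.1 hb.1⟩

theorem supAbs_smul (c : ℤ) (v : ℤ × ℤ × ℤ) :
    supAbs (c * v.1, c * v.2.1, c * v.2.2) = c.natAbs * supAbs v := by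
  simp only [supAbs, Int.natAbs_mul, Nat.mul_max_mul_left]

/-! ### Zeros of a quadratic form on a lattice plane -/

/-- Primitive vectors of a plane whose pairwise cross products are divisible by `P`. -/
theorem card_le_of_cross_dvd {l u : ℤ × ℤ × ℤ} (hu : dot3 u l = 1) {P : ℕ} (hP : 0 < P)
    {K : ℕ} {Z : Finset (ℤ × ℤ × ℤ)} (hperp : ∀ x ∈ Z, dot3 x l = 0)
    (hprim : ∀ x ∈ Z, Primitive3 x) (hbox : ∀ x ∈ Z, supAbs x ≤ K)
    (hclose : ∀ x ∈ Z, ∀ y ∈ Z, (P : ℤ) ∣ dot3 u (cross3 x y)) :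
    Z.card ≤ 5 * (2 * (2 * K ^ 2 / (supAbs l * P)) + 1) := by
  rcases Z.eq_empty_or_nonempty with rfl | hne
  · simp
  have hl : 0 < supAbs l := supAbs_pos_of_primitive ⟨u, hu⟩
  -- A vector of maximal norm serves as reference: translations along `x0` between two points of `Z`
  -- are then at most `2` in absolute value.
  obtain ⟨x0, hx0, hmax⟩ := Finset.exists_max_image Z supAbs hne
  set T := 2 * K ^ 2 / (supAbs l * P) with hT
  have hcard : (Finset.Icc (-(T : ℤ)) T).card = 2 * T + 1 := by
    rw [Int.card_Icc]; omega
  rw [← hcard]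
  -- Sort by the area against `x0`, divided by `P`. Since `cross3 x0 x` is that area times `l` and
  -- has norm at most `2K²`, at most `2T + 1` values occur.
  refine Finset.card_le_mul_card_image_of_maps_to
    (f := fun x => dot3 u (cross3 x0 x) / (P : ℤ)) ?_ 5 ?_
  · intro x hx
    obtain ⟨c, hc⟩ := hclose x0 hx0 x hx
    have h1 := supAbs_cross3_le (hbox x0 hx0) (hbox x hx)
    rw [cross3_eq_smul hu (hperp x0 hx0) (hperp x hx), supAbs_smul, hc, Int.natAbs_mul,
      Int.natAbs_natCast] at h1
    have h2 : c.natAbs ≤ T := by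
      rw [hT, Nat.le_div_iff_mul_le (by positivity)]
      calc c.natAbs * (supAbs l * P) = P * c.natAbs * supAbs l := by ring
        _ ≤ _ := h1
    simp only [hc, Int.mul_ediv_cancel_left _ (show (P : ℤ) ≠ 0 by positivity), Finset.mem_Icc]
    omega
  · intro b _
    rcases (Z.filter fun x => dot3 u (cross3 x0 x) / (P : ℤ) = b).eq_empty_or_nonempty with h | h
    · rw [h]; simp
    obtain ⟨x1, hx1⟩ := h
    simp only [Finset.mem_filter] at hx1
    obtain ⟨u0, hu0⟩ := hprim x0 hx0
    have h0 : 0 < supAbs x0 := supAbs_pos_of_primitive ⟨u0, hu0⟩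
    -- Equal areas mean that `x - x1` is parallel to the primitive `x0`, hence an integer multiple
    -- of it; as its norm is at most `2 * supAbs x0`, there are five multiples.
    have key : ∀ x ∈ Z, dot3 u (cross3 x0 x) / (P : ℤ) = b →
        ∃ s ∈ Finset.Icc (-2 : ℤ) 2,
          x = (x1.1 + s * x0.1, x1.2.1 + s * x0.2.1, x1.2.2 + s * x0.2.2) := by
      intro x hx hxb
      have e1 : dot3 u (cross3 x0 x) = dot3 u (cross3 x0 x1) := by
        have h1 := Int.ediv_mul_cancel (hclose x0 hx0 x hx)
        have h2 := Int.ediv_mul_cancel (hclose x0 hx0 x1 hx1.1)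
        rw [← h1, ← h2, hxb, hx1.2]
      have e2 : cross3 x0 x = cross3 x0 x1 := by
        rw [cross3_eq_smul hu (hperp x0 hx0) (hperp x hx), e1,
          ← cross3_eq_smul hu (hperp x0 hx0) (hperp x1 hx1.1)]
      set d : ℤ × ℤ × ℤ := (x.1 - x1.1, x.2.1 - x1.2.1, x.2.2 - x1.2.2) with hd
      have e3 : cross3 x0 d = 0 := by
        simp only [cross3, Prod.mk.injEq] at e2
        simp only [cross3, hd, Prod.mk_eq_zero]
        refine ⟨?_, ?_, ?_⟩
        · linear_combination e2.1
        · linear_combination e2.2.1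
        · linear_combination e2.2.2
      have e4 := eq_smul_of_cross_eq_zero hu0 e3
      refine ⟨dot3 u0 d, ?_, ?_⟩
      · have h1 : supAbs d ≤ 2 * supAbs x0 := by
          have a1 := supAbs_le_iff.1 (hmax x hx)
          have a2 := supAbs_le_iff.1 (hmax x1 hx1.1)
          rw [supAbs_le_iff]
          simp only [hd]
          push_cast
          refine ⟨?_, ?_, ?_⟩
          · have := abs_sub x.1 x1.1; linarith [a1.1, a2.1]
          · have := abs_sub x.2.1 x1.2.1; linarith [a1.2.1, a2.2.1]
          · have := abs_sub x.2.2 x1.2.2; linarith [a1.2.2, a2.2.2]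
        rw [e4, supAbs_smul] at h1
        have := Nat.le_of_mul_le_mul_right h1 h0
        rw [Finset.mem_Icc]; omega
      · have f1 := congrArg (fun v => v.1) e4
        have f2 := congrArg (fun v => v.2.1) e4
        have f3 := congrArg (fun v => v.2.2) e4
        simp only [hd] at f1 f2 f3
        simp only [hd]
        ext <;> simp only <;> linarith
    calc _ ≤ ((Finset.Icc (-2 : ℤ) 2).image
          fun s => ((x1.1 + s * x0.1, x1.2.1 + s * x0.2.1, x1.2.2 + s * x0.2.2) :
            ℤ × ℤ × ℤ)).card := by
          apply Finset.card_le_card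
          intro x hx
          simp only [Finset.mem_filter] at hx
          obtain ⟨s, hs, e⟩ := key x hx.1 hx.2
          exact Finset.mem_image.2 ⟨s, hs, e.symm⟩
      _ ≤ (Finset.Icc (-2 : ℤ) 2).card := Finset.card_image_le
      _ = 5 := by simp

theorem Prime.pow_dvd_or_pow_dvd_of_mul {p : ℤ} (hp : Prime p) {a b : ℕ} {x y : ℤ}
    (h : p ^ (a + b + 1) ∣ x * y) : p ^ (a + 1) ∣ x ∨ p ^ (b + 1) ∣ y := by
  by_contra! hc
  obtain ⟨h1, h2⟩ := hc
  rw [pow_dvd_iff_le_emultiplicity] at *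
  rw [emultiplicity_mul hp] at h
  rw [not_le] at h1 h2
  have f1 : emultiplicity p x ≠ ⊤ := ne_top_of_lt h1
  have f2 : emultiplicity p y ≠ ⊤ := ne_top_of_lt h2
  obtain ⟨m, hm⟩ := ENat.ne_top_iff_exists.1 f1
  obtain ⟨n, hn⟩ := ENat.ne_top_iff_exists.1 f2
  rw [← hm] at h h1
  rw [← hn] at h h2
  norm_cast at h h1 h2
  omega

/-- If `st` is divisible by `p ^ M`, then one factor is divisible by `p ^ g`. -/
theorem Prime.pow_dvd_or_of_sep {p : ℤ} (hp : Prime p) {M g : ℕ} {s t : ℤ}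
    (h : p ^ M ∣ s * t)
    (hg : 2 * g ≤ M + 1 ∨ (g ≤ M ∧ ¬ (p ^ (M - g) ∣ s ∧ p ^ (M - g) ∣ t))) :
    p ^ g ∣ s ∨ p ^ g ∣ t := by
  rcases Nat.eq_zero_or_pos g with rfl | hg0
  · simp
  obtain ⟨a, rfl⟩ : ∃ a, g = a + 1 := ⟨g - 1, by omega⟩
  rcases hg with hg | ⟨hgM, hg⟩
  · exact hp.pow_dvd_or_pow_dvd_of_mul ((pow_dvd_pow p (by omega)).trans h)
  · obtain ⟨e, rfl⟩ : ∃ e, M = a + 1 + e := ⟨M - (a + 1), by omega⟩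
    rw [Nat.add_sub_cancel_left] at hg
    rcases Nat.eq_zero_or_pos e with rfl | he
    · simp at hg
    obtain ⟨f, rfl⟩ : ∃ f, e = f + 1 := ⟨e - 1, by omega⟩
    -- Here `g = a + 1` and `M - g = f + 1`. If neither factor were divisible by `p^g`, the two ways
    -- of distributing the exponent would make both divisible by `p^(M-g)`.
    have h1 : p ^ (f + 1) ∣ s ∨ p ^ (a + 1) ∣ t :=
      hp.pow_dvd_or_pow_dvd_of_mul ((pow_dvd_pow p (by omega)).trans h)
    have h2 : p ^ (a + 1) ∣ s ∨ p ^ (f + 1) ∣ t :=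
      hp.pow_dvd_or_pow_dvd_of_mul ((pow_dvd_pow p (by omega)).trans h)
    tauto

/-- Zeros modulo `p ^ M` of a binary quadratic form with leading coefficient prime to `p`
fall into at most two `p`-adic discs. -/
theorem binary_close_of_not_close {p : ℤ} (hp : Prime p) (hp2 : ¬ p ∣ 2) {M g : ℕ} {a b c : ℤ}
    (ha : ¬ p ∣ a)
    (hg : 2 * g ≤ M + 1 ∨ (g ≤ M ∧ M ≤ 2 * g ∧ ¬ p ^ (2 * (M - g)) ∣ b ^ 2 - a * c))
    {x y : Fin 3 → ℤ} (hy : ∀ i, ¬ p ∣ y i)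
    (h : ∀ i, p ^ M ∣ a * x i ^ 2 + 2 * b * (x i * y i) + c * y i ^ 2)
    (h01 : ¬ p ^ g ∣ x 0 * y 1 - x 1 * y 0) (h02 : ¬ p ^ g ∣ x 0 * y 2 - x 2 * y 0) :
    p ^ g ∣ x 1 * y 2 - x 2 * y 1 := by
  -- Completing the square: `z² ≡ (b² - a c) y²` modulo `p^M`, so ratios `z/y` of two zeros agree up
  -- to sign, to the precision the discriminant allows.
  set z : Fin 3 → ℤ := fun i => a * x i + b * y i with hz
  have hz2 : ∀ i, p ^ M ∣ z i ^ 2 - (b ^ 2 - a * c) * y i ^ 2 := by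
    intro i
    have e : z i ^ 2 - (b ^ 2 - a * c) * y i ^ 2 =
      a * (a * x i ^ 2 + 2 * b * (x i * y i) + c * y i ^ 2) := by simp only [hz]; ring
    rw [e]
    exact (h i).mul_left _
  have hsub : ∀ i j, z i * y j - z j * y i = a * (x i * y j - x j * y i) := by
    intro i j; simp only [hz]; ring
  have hca : IsCoprime (p ^ g) a := (hp.coprime_iff_not_dvd.2 ha).pow_left
  have hcy : ∀ i, ∀ m : ℕ, IsCoprime (p ^ m) (y i) :=
    fun i m => (hp.coprime_iff_not_dvd.2 (hy i)).pow_left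
  have hor : ∀ i j, p ^ g ∣ x i * y j - x j * y i ∨ p ^ g ∣ z i * y j + z j * y i := by
    intro i j
    have hM : p ^ M ∣ (z i * y j - z j * y i) * (z i * y j + z j * y i) := by
      have e : (z i * y j - z j * y i) * (z i * y j + z j * y i) =
        (z i ^ 2 - (b ^ 2 - a * c) * y i ^ 2) * y j ^ 2 -
          (z j ^ 2 - (b ^ 2 - a * c) * y j ^ 2) * y i ^ 2 := by ring
      rw [e]
      exact dvd_sub ((hz2 i).mul_right _) ((hz2 j).mul_right _)
    have := hp.pow_dvd_or_of_sep (g := g) hM ?_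
    · rcases this with h1 | h1
      · rw [hsub] at h1
        exact Or.inl (hca.dvd_of_dvd_mul_left h1)
      · exact Or.inr h1
    · rcases hg with hg | ⟨hg1, hg2, hg3⟩
      · exact Or.inl hg
      · refine Or.inr ⟨hg1, fun ⟨h1, h2⟩ => hg3 ?_⟩
        -- If both factors were divisible by `p^(M-g)`, so would be `z i`, and then `p^(2(M-g))`
        -- would divide the discriminant; `M ≤ 2g` keeps this exponent within `M`.
        have h3 : p ^ (M - g) ∣ 2 * z i * y j := by
          have e : 2 * z i * y j = (z i * y j - z j * y i) + (z i * y j + z j * y i) := by ring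
          rw [e]; exact dvd_add h1 h2
        have h4 := (hcy j _).dvd_of_dvd_mul_right h3
        have h5 : p ^ (M - g) ∣ z i :=
          ((hp.coprime_iff_not_dvd.2 hp2).pow_left).dvd_of_dvd_mul_left h4
        have h6 : p ^ (2 * (M - g)) ∣ z i ^ 2 := by
          rw [mul_comm, pow_mul]; exact pow_dvd_pow_of_dvd h5 2
        have h7 : p ^ (2 * (M - g)) ∣ (b ^ 2 - a * c) * y i ^ 2 := by
          have := dvd_sub h6 ((pow_dvd_pow p (by omega : 2 * (M - g) ≤ M)).trans (hz2 i))
          simpa using this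
        exact ((hcy i _).pow_right).dvd_of_dvd_mul_right h7
  -- Points 1 and 2 both carry the sign opposite to point 0, hence the same sign as each other.
  have h1 := (hor 0 1).resolve_left h01
  have h2 := (hor 0 2).resolve_left h02
  apply hca.dvd_of_dvd_mul_left
  rw [← hsub]
  apply (hcy 0 g).dvd_of_dvd_mul_left
  have e : y 0 * (z 1 * y 2 - z 2 * y 1) =
    (z 0 * y 1 + z 1 * y 0) * y 2 - (z 0 * y 2 + z 2 * y 0) * y 1 := by ring
  rw [e]
  exact dvd_sub (h1.mul_right _) (h2.mul_right _)

/-- Exchanging the variables swaps `a` and `c` and negates the cross products, so one unit outer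
coefficient suffices. The conclusion says that among three zeros two are close. -/
theorem binary_trichotomy {p : ℤ} (hp : Prime p) (hp2 : ¬ p ∣ 2) {M g : ℕ} {a b c : ℤ}
    (hac : ¬ p ∣ a ∨ ¬ p ∣ c)
    (hg : 2 * g ≤ M + 1 ∨ (g ≤ M ∧ M ≤ 2 * g ∧ ¬ p ^ (2 * (M - g)) ∣ b ^ 2 - a * c))
    {x y : Fin 3 → ℤ} (hx : ∀ i, ¬ p ∣ x i) (hy : ∀ i, ¬ p ∣ y i)
    (h : ∀ i, p ^ M ∣ a * x i ^ 2 + 2 * b * (x i * y i) + c * y i ^ 2)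
    (h01 : ¬ p ^ g ∣ x 0 * y 1 - x 1 * y 0) (h02 : ¬ p ^ g ∣ x 0 * y 2 - x 2 * y 0) :
    p ^ g ∣ x 1 * y 2 - x 2 * y 1 := by
  rcases hac with ha | hc
  · exact binary_close_of_not_close hp hp2 ha hg hy h h01 h02
  · have e : ∀ i j, x i * y j - x j * y i = -(y i * x j - y j * x i) := by intros; ring
    rw [e, dvd_neg] at h01 h02 ⊢
    refine binary_close_of_not_close hp hp2 (M := M) (a := c) (b := b) (c := a) hc ?_ hx ?_ h01 h02
    · rwa [mul_comm c a]
    · intro i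
      convert h i using 1; ring

/-- The zeros of a nondegenerate diagonal ternary form on a plane with a normal vector whose last
coordinate is prime to `p`. -/
theorem plane_trichotomy {p : ℤ} (hp : Prime p) (hp2 : ¬ p ∣ 2) {M g : ℕ} (hM : 0 < M)
    {b1 b2 b3 l1 l2 l3 : ℤ} (hb1 : ¬ p ∣ b1) (hb2 : ¬ p ∣ b2) (hb3 : ¬ p ∣ b3) (hl3 : ¬ p ∣ l3)
    (hg : 2 * g ≤ M + 1 ∨ (g ≤ M ∧ M ≤ 2 * g ∧
      ¬ p ^ (2 * (M - g)) ∣ b2 * b3 * l1 ^ 2 + b1 * b3 * l2 ^ 2 + b1 * b2 * l3 ^ 2))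
    {x y w : Fin 3 → ℤ} (hx : ∀ i, ¬ p ∣ x i) (hy : ∀ i, ¬ p ∣ y i)
    (hperp : ∀ i, x i * l1 + y i * l2 + w i * l3 = 0)
    (h : ∀ i, p ^ M ∣ b1 * x i ^ 2 + b2 * y i ^ 2 + b3 * w i ^ 2)
    (h01 : ¬ p ^ g ∣ x 0 * y 1 - x 1 * y 0) (h02 : ¬ p ^ g ∣ x 0 * y 2 - x 2 * y 0) :
    p ^ g ∣ x 1 * y 2 - x 2 * y 1 := by
  -- Eliminate `w` by `l3 * w = -(l1 * x + l2 * y)` after multiplying the form by `l3²`; the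
  -- discriminant becomes `-l3²` times the adjugate form at the normal.
  have hform : ∀ i, p ^ M ∣ (b1 * l3 ^ 2 + b3 * l1 ^ 2) * x i ^ 2 +
      2 * (b3 * l1 * l2) * (x i * y i) + (b2 * l3 ^ 2 + b3 * l2 ^ 2) * y i ^ 2 := by
    intro i
    have e : (b1 * l3 ^ 2 + b3 * l1 ^ 2) * x i ^ 2 +
      2 * (b3 * l1 * l2) * (x i * y i) + (b2 * l3 ^ 2 + b3 * l2 ^ 2) * y i ^ 2 =
      l3 ^ 2 * (b1 * x i ^ 2 + b2 * y i ^ 2 + b3 * w i ^ 2) := by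
      linear_combination (b3 * (x i * l1 + y i * l2 - w i * l3)) * hperp i
    rw [e]
    exact (h i).mul_left _
  have hdisc : (b3 * l1 * l2) ^ 2 - (b1 * l3 ^ 2 + b3 * l1 ^ 2) * (b2 * l3 ^ 2 + b3 * l2 ^ 2) =
    -(l3 ^ 2 * (b2 * b3 * l1 ^ 2 + b1 * b3 * l2 ^ 2 + b1 * b2 * l3 ^ 2)) := by ring
  refine binary_trichotomy hp hp2 (a := b1 * l3 ^ 2 + b3 * l1 ^ 2) (b := b3 * l1 * l2)
    (c := b2 * l3 ^ 2 + b3 * l2 ^ 2) ?_ ?_ hx hy hform h01 h02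
  -- If `p` divided both outer coefficients it would divide the middle one, as `x 0` and `y 0` are
  -- units. Then `p` divides `l1` or `l2`, and one outer coefficient is `b1 * l3²` or `b2 * l3²`
  -- modulo `p`, a unit.
  · by_contra! hc
    obtain ⟨hA, hC⟩ := hc
    have hB : p ∣ b3 * l1 * l2 := by
      have h0 := (dvd_pow_self p hM.ne').trans (hform 0)
      have h1 : p ∣ 2 * (b3 * l1 * l2) * (x 0 * y 0) := by
        have e : 2 * (b3 * l1 * l2) * (x 0 * y 0) =
          ((b1 * l3 ^ 2 + b3 * l1 ^ 2) * x 0 ^ 2 + 2 * (b3 * l1 * l2) * (x 0 * y 0) +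
            (b2 * l3 ^ 2 + b3 * l2 ^ 2) * y 0 ^ 2) - (b1 * l3 ^ 2 + b3 * l1 ^ 2) * x 0 ^ 2 -
            (b2 * l3 ^ 2 + b3 * l2 ^ 2) * y 0 ^ 2 := by ring
        rw [e]
        exact dvd_sub (dvd_sub h0 (hA.mul_right _)) (hC.mul_right _)
      rcases hp.dvd_or_dvd h1 with h2 | h2
      · exact (hp.dvd_or_dvd h2).resolve_left hp2
      · rcases hp.dvd_or_dvd h2 with h3 | h3
        · exact absurd h3 (hx 0)
        · exact absurd h3 (hy 0)
    have hl : p ∣ l1 ∨ p ∣ l2 := by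
      rcases hp.dvd_or_dvd hB with h2 | h2
      · exact Or.inl ((hp.dvd_or_dvd h2).resolve_left hb3)
      · exact Or.inr h2
    have fin : ∀ u v l : ℤ, ¬ p ∣ u → p ∣ l → ¬ p ∣ u * l3 ^ 2 + v * l ^ 2 := by
      intro u v l hu hl hd
      have h1 : p ∣ u * l3 ^ 2 := by
        have := dvd_sub hd ((hl.mul_right l).mul_left v)
        have e : u * l3 ^ 2 + v * l ^ 2 - v * (l * l) = u * l3 ^ 2 := by ring
        rwa [e] at this
      rcases hp.dvd_or_dvd h1 with h2 | h2
      · exact hu h2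
      · exact hl3 (hp.dvd_of_dvd_pow h2)
    rcases hl with hl | hl
    · exact fin _ _ _ hb1 hl hA
    · exact fin _ _ _ hb2 hl hC
  · rw [hdisc, dvd_neg]
    rcases hg with hg | ⟨hg1, hg2, hg3⟩
    · exact Or.inl hg
    · refine Or.inr ⟨hg1, hg2, fun hd => hg3 ?_⟩
      exact (((hp.coprime_iff_not_dvd.2 hl3).pow_left).pow_right).dvd_of_dvd_mul_left hd

theorem primitive3_exists_not_dvd {p : ℤ} (hp : Prime p) {u l : ℤ × ℤ × ℤ} (hu : dot3 u l = 1) :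
    ¬ p ∣ l.1 ∨ ¬ p ∣ l.2.1 ∨ ¬ p ∣ l.2.2 := by
  by_contra! h
  apply hp.not_dvd_one
  rw [← hu]
  exact dvd_add (dvd_add (h.1.mul_left _) (h.2.1.mul_left _)) (h.2.2.mul_left _)

/-- Some coordinate of `l` is prime to `p`. A cyclic permutation makes it the last one, and the
matching coordinate of the cross product is the area times that unit. -/
theorem plane_points_trichotomy {p : ℕ} (hp : Prime (p : ℤ)) (hp2 : ¬ (p : ℤ) ∣ 2) {M g : ℕ}
    (hM : 0 < M) {b l u : ℤ × ℤ × ℤ} (hb : UnitCoords p b) (hu : dot3 u l = 1)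
    (hg : 2 * g ≤ M + 1 ∨ (g ≤ M ∧ M ≤ 2 * g ∧
      ¬ (p : ℤ) ^ (2 * (M - g)) ∣ diagForm (adjCoeff b) l))
    {x : Fin 3 → ℤ × ℤ × ℤ} (hx : ∀ i, UnitCoords p (x i)) (hperp : ∀ i, dot3 (x i) l = 0)
    (h : ∀ i, (p : ℤ) ^ M ∣ diagForm b (x i))
    (h01 : ¬ (p : ℤ) ^ g ∣ dot3 u (cross3 (x 0) (x 1)))
    (h02 : ¬ (p : ℤ) ^ g ∣ dot3 u (cross3 (x 0) (x 2))) :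
    (p : ℤ) ^ g ∣ dot3 u (cross3 (x 1) (x 2)) := by
  have hc : ∀ i j, cross3 (x i) (x j) = _ := fun i j => cross3_eq_smul hu (hperp i) (hperp j)
  have hcop : ∀ {m : ℤ}, ¬ (p : ℤ) ∣ m → IsCoprime ((p : ℤ) ^ g) m :=
    fun hm => (hp.coprime_iff_not_dvd.2 hm).pow_left
  rcases primitive3_exists_not_dvd hp hu with hl | hl | hl
  · have e : ∀ i j, dot3 u (cross3 (x i) (x j)) * l.1 =
        (x i).2.1 * (x j).2.2 - (x j).2.1 * (x i).2.2 := by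
      intro i j
      have := congrArg (fun v => v.1) (hc i j)
      simp only [cross3] at this ⊢
      linarith
    have key : ∀ i j, (p : ℤ) ^ g ∣ dot3 u (cross3 (x i) (x j)) ↔
        (p : ℤ) ^ g ∣ (x i).2.1 * (x j).2.2 - (x j).2.1 * (x i).2.2 := by
      intro i j
      rw [← e]
      exact ⟨fun h => h.mul_right _, (hcop hl).dvd_of_dvd_mul_right⟩
    rw [key] at h01 h02 ⊢
    refine plane_trichotomy hp hp2 hM hb.2.1 hb.2.2 hb.1 hl (l1 := l.2.1) (l2 := l.2.2) ?_
      (x := fun i => (x i).2.1) (y := fun i => (x i).2.2) (w := fun i => (x i).1)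
      (fun i => (hx i).2.1) (fun i => (hx i).2.2) ?_ ?_ h01 h02
    · convert hg using 5
      simp only [diagForm, adjCoeff]; ring
    · intro i
      have := hperp i
      simp only [dot3] at this
      linarith
    · intro i
      convert h i using 1
      simp only [diagForm]; ring
  · have e : ∀ i j, dot3 u (cross3 (x i) (x j)) * l.2.1 =
        (x i).2.2 * (x j).1 - (x j).2.2 * (x i).1 := by
      intro i j
      have := congrArg (fun v => v.2.1) (hc i j)
      simp only [cross3] at this ⊢
      linarith
    have key : ∀ i j, (p : ℤ) ^ g ∣ dot3 u (cross3 (x i) (x j)) ↔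
        (p : ℤ) ^ g ∣ (x i).2.2 * (x j).1 - (x j).2.2 * (x i).1 := by
      intro i j
      rw [← e]
      exact ⟨fun h => h.mul_right _, (hcop hl).dvd_of_dvd_mul_right⟩
    rw [key] at h01 h02 ⊢
    refine plane_trichotomy hp hp2 hM hb.2.2 hb.1 hb.2.1 hl (l1 := l.2.2) (l2 := l.1) ?_
      (x := fun i => (x i).2.2) (y := fun i => (x i).1) (w := fun i => (x i).2.1)
      (fun i => (hx i).2.2) (fun i => (hx i).1) ?_ ?_ h01 h02
    · convert hg using 5
      simp only [diagForm, adjCoeff]; ring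
    · intro i
      have := hperp i
      simp only [dot3] at this
      linarith
    · intro i
      convert h i using 1
      simp only [diagForm]; ring
  · have e : ∀ i j, dot3 u (cross3 (x i) (x j)) * l.2.2 =
        (x i).1 * (x j).2.1 - (x j).1 * (x i).2.1 := by
      intro i j
      have := congrArg (fun v => v.2.2) (hc i j)
      simp only [cross3] at this ⊢
      linarith
    have key : ∀ i j, (p : ℤ) ^ g ∣ dot3 u (cross3 (x i) (x j)) ↔
        (p : ℤ) ^ g ∣ (x i).1 * (x j).2.1 - (x j).1 * (x i).2.1 := by
      intro i j
      rw [← e]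
      exact ⟨fun h => h.mul_right _, (hcop hl).dvd_of_dvd_mul_right⟩
    rw [key] at h01 h02 ⊢
    refine plane_trichotomy hp hp2 hM hb.1 hb.2.1 hb.2.2 hl (l1 := l.1) (l2 := l.2.1) ?_
      (x := fun i => (x i).1) (y := fun i => (x i).2.1) (w := fun i => (x i).2.2)
      (fun i => (hx i).1) (fun i => (hx i).2.1) ?_ ?_ h01 h02
    · exact hg
    · intro i
      have := hperp i
      simp only [dot3] at this
      linarith
    · exact h

/-- Three vectors of a plane satisfy `A(y,z) x - A(x,z) y + A(x,y) z = 0` for the area form `A`;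
read off the first coordinate, where `x` has a unit. -/
theorem cross_dvd_trans {p : ℕ} (hp : Prime (p : ℤ)) {g : ℕ} {l u : ℤ × ℤ × ℤ}
    (hu : dot3 u l = 1) {x y z : ℤ × ℤ × ℤ} (hx : ¬ (p : ℤ) ∣ x.1)
    (hpx : dot3 x l = 0) (hpy : dot3 y l = 0) (hpz : dot3 z l = 0)
    (h1 : (p : ℤ) ^ g ∣ dot3 u (cross3 x y)) (h2 : (p : ℤ) ^ g ∣ dot3 u (cross3 x z)) :
    (p : ℤ) ^ g ∣ dot3 u (cross3 y z) := by
  have hcop : IsCoprime ((p : ℤ) ^ g) x.1 := (hp.coprime_iff_not_dvd.2 hx).pow_left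
  apply hcop.dvd_of_dvd_mul_left
  have e : x.1 * dot3 u (cross3 y z) = dot3 u (cross3 x z) * y.1 - dot3 u (cross3 x y) * z.1 := by
    have hdet : dot3 x (cross3 y z) = 0 := by
      rw [cross3_eq_smul hu hpy hpz]
      simp only [dot3] at hpx ⊢
      linear_combination (u.1 * (cross3 y z).1 + u.2.1 * (cross3 y z).2.1 +
        u.2.2 * (cross3 y z).2.2) * hpx
    simp only [dot3, cross3] at hdet ⊢
    linear_combination u.1 * hdet
  rw [e]
  exact dvd_sub (h2.mul_right _) (h1.mul_right _)

/-- Primitive zeros of `diagForm b` modulo `p ^ M` in a box that lie on a plane with primitive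
normal vector `l`. -/
theorem card_plane_le {p : ℕ} (hp : Prime (p : ℤ)) (hp2 : ¬ (p : ℤ) ∣ 2) {M g : ℕ}
    (hM : 0 < M) {b l : ℤ × ℤ × ℤ} (hb : UnitCoords p b) (hl : Primitive3 l)
    (hg : 2 * g ≤ M + 1 ∨ (g ≤ M ∧ M ≤ 2 * g ∧
      ¬ (p : ℤ) ^ (2 * (M - g)) ∣ diagForm (adjCoeff b) l))
    {K : ℕ} {Y : Finset (ℤ × ℤ × ℤ)} (hunit : ∀ x ∈ Y, UnitCoords p x)
    (hperp : ∀ x ∈ Y, dot3 x l = 0) (hprim : ∀ x ∈ Y, Primitive3 x)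
    (hbox : ∀ x ∈ Y, supAbs x ≤ K) (h : ∀ x ∈ Y, (p : ℤ) ^ M ∣ diagForm b x) :
    Y.card ≤ 10 * (2 * (2 * K ^ 2 / (supAbs l * p ^ g)) + 1) := by
  classical
  rcases Y.eq_empty_or_nonempty with rfl | ⟨x0, hx0⟩
  · simp
  obtain ⟨u, hu⟩ := hl
  have hp0 : 0 < p := by
    rcases Nat.eq_zero_or_pos p with rfl | h0
    · exact absurd hp (by simp)
    · exact h0
  -- Points close to `x0` are mutually close by `cross_dvd_trans`; those not close to it are
  -- mutually close by the trichotomy. Two discs with a factor five each give the ten.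
  have h1 := card_le_of_cross_dvd hu (P := p ^ g) (by positivity) (K := K)
    (Z := Y.filter fun x => (p : ℤ) ^ g ∣ dot3 u (cross3 x0 x))
    (fun x hx => hperp x (Finset.mem_filter.1 hx).1)
    (fun x hx => hprim x (Finset.mem_filter.1 hx).1)
    (fun x hx => hbox x (Finset.mem_filter.1 hx).1) (by
      intro x hx y hy
      rw [Finset.mem_filter] at hx hy
      push_cast
      exact cross_dvd_trans hp hu (hunit x0 hx0).1 (hperp x0 hx0) (hperp x hx.1) (hperp y hy.1)
        hx.2 hy.2)
  have h2 := card_le_of_cross_dvd hu (P := p ^ g) (by positivity) (K := K)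
    (Z := Y.filter fun x => ¬ (p : ℤ) ^ g ∣ dot3 u (cross3 x0 x))
    (fun x hx => hperp x (Finset.mem_filter.1 hx).1)
    (fun x hx => hprim x (Finset.mem_filter.1 hx).1)
    (fun x hx => hbox x (Finset.mem_filter.1 hx).1) (by
      intro x hx y hy
      rw [Finset.mem_filter] at hx hy
      push_cast
      have hmem : ∀ i : Fin 3, (![x0, x, y] : Fin 3 → ℤ × ℤ × ℤ) i ∈ Y := by
        intro i
        fin_cases i
        · exact hx0
        · exact hx.1
        · exact hy.1
      exact plane_points_trichotomy hp hp2 hM hb hu hg (x := ![x0, x, y])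
        (fun i => hunit _ (hmem i)) (fun i => hperp _ (hmem i)) (fun i => h _ (hmem i)) hx.2 hy.2)
  rw [← Finset.card_filter_add_card_filter_not (fun x => (p : ℤ) ^ g ∣ dot3 u (cross3 x0 x))]
  omega

/-! ### Coplanarity of the zeros in a projective residue class -/

/-- Zeros of a ternary diagonal form in one residue class are coplanar. -/
theorem det_dvd_of_bilin_dvd {p : ℤ} (hp : Prime p) {j : ℕ} {b x y z : ℤ × ℤ × ℤ}
    (hb : ¬ p ∣ b.1 ∧ ¬ p ∣ b.2.1 ∧ ¬ p ∣ b.2.2)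
    (hx : p ^ (2 * j) ∣ diagForm b x) (hy : p ^ (2 * j) ∣ diagForm b y)
    (hz : p ^ (2 * j) ∣ diagForm b z) (hxy : p ^ (2 * j) ∣ diagBilin b x y)
    (hxz : p ^ (2 * j) ∣ diagBilin b x z) (hyz : p ^ (2 * j) ∣ diagBilin b y z) :
    p ^ (3 * j) ∣ dot3 (cross3 x y) z := by
  -- The Gram determinant of `x, y, z`: every term on the right is a product of three values
  -- divisible by `p^(2j)`.
  have e : b.1 * b.2.1 * b.2.2 * dot3 (cross3 x y) z ^ 2 =
      diagForm b x * diagForm b y * diagForm b z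
      + 2 * (diagBilin b x y * diagBilin b x z * diagBilin b y z)
      - diagForm b x * (diagBilin b y z * diagBilin b y z)
      - diagForm b y * (diagBilin b x z * diagBilin b x z)
      - diagForm b z * (diagBilin b x y * diagBilin b x y) := by
    simp only [diagForm, diagBilin, dot3, cross3]; ring
  have e6 : p ^ (6 * j) = p ^ (2 * j) * p ^ (2 * j) * p ^ (2 * j) := by ring
  have e6' : p ^ (6 * j) = p ^ (2 * j) * (p ^ (2 * j) * p ^ (2 * j)) := by ring
  have h6 : p ^ (6 * j) ∣ b.1 * b.2.1 * b.2.2 * dot3 (cross3 x y) z ^ 2 := by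
    rw [e]
    refine dvd_sub (dvd_sub (dvd_sub (dvd_add ?_ (Dvd.dvd.mul_left ?_ _)) ?_) ?_) ?_
    · rw [e6]; exact mul_dvd_mul (mul_dvd_mul hx hy) hz
    · rw [e6]; exact mul_dvd_mul (mul_dvd_mul hxy hxz) hyz
    · rw [e6']; exact mul_dvd_mul hx (mul_dvd_mul hyz hyz)
    · rw [e6']; exact mul_dvd_mul hy (mul_dvd_mul hxz hxz)
    · rw [e6']; exact mul_dvd_mul hz (mul_dvd_mul hxy hxy)
  have hcop : IsCoprime (p ^ (6 * j)) (b.1 * b.2.1 * b.2.2) :=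
    (((hp.coprime_iff_not_dvd.2 hb.1).mul_right (hp.coprime_iff_not_dvd.2 hb.2.1)).mul_right
      (hp.coprime_iff_not_dvd.2 hb.2.2)).pow_left
  have h7 := hcop.dvd_of_dvd_mul_left h6
  rw [show 6 * j = (3 * j) * 2 by ring, pow_mul] at h7
  exact (Int.pow_dvd_pow_iff (by norm_num)).1 h7

/-- Polarize: `Q(y - c x) = Q(y) - 2c B(x,y) + c² Q(x)`. The congruence modulo `p^j` makes the left
side divisible by `p^(2j)`, which doubles the precision. -/
theorem bilin_dvd_of_congr {p : ℤ} (hp : Prime p) (hp2 : ¬ p ∣ 2) {j : ℕ} {b x y : ℤ × ℤ × ℤ}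
    {c : ℤ} (hc : ¬ p ∣ c) (hx : p ^ (2 * j) ∣ diagForm b x) (hy : p ^ (2 * j) ∣ diagForm b y)
    (h1 : p ^ j ∣ y.1 - c * x.1) (h2 : p ^ j ∣ y.2.1 - c * x.2.1)
    (h3 : p ^ j ∣ y.2.2 - c * x.2.2) : p ^ (2 * j) ∣ diagBilin b x y := by
  have e : 2 * c * diagBilin b x y = diagForm b y + c ^ 2 * diagForm b x -
      (b.1 * (y.1 - c * x.1) ^ 2 + b.2.1 * (y.2.1 - c * x.2.1) ^ 2 +
        b.2.2 * (y.2.2 - c * x.2.2) ^ 2) := by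
    simp only [diagForm, diagBilin]; ring
  have sq : ∀ {m : ℤ}, p ^ j ∣ m → p ^ (2 * j) ∣ m ^ 2 := by
    intro m hm
    rw [mul_comm, pow_mul]; exact pow_dvd_pow_of_dvd hm 2
  have h : p ^ (2 * j) ∣ 2 * c * diagBilin b x y := by
    rw [e]
    exact dvd_sub (dvd_add hy (hx.mul_left _)) (dvd_add (dvd_add ((sq h1).mul_left _)
      ((sq h2).mul_left _)) ((sq h3).mul_left _))
  have hcop : IsCoprime (p ^ (2 * j)) (2 * c) :=
    ((hp.coprime_iff_not_dvd.2 hp2).mul_right (hp.coprime_iff_not_dvd.2 hc)).pow_left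
  exact hcop.dvd_of_dvd_mul_left h

theorem abs_det_le {x y z : ℤ × ℤ × ℤ} {K : ℕ} (hx : supAbs x ≤ K) (hy : supAbs y ≤ K)
    (hz : supAbs z ≤ K) : |dot3 (cross3 x y) z| ≤ 6 * (K : ℤ) ^ 3 := by
  have h := supAbs_le_iff.1 (supAbs_cross3_le hx hy)
  rw [supAbs_le_iff] at hz
  push_cast at h
  have key : ∀ a c : ℤ, |a| ≤ 2 * (K : ℤ) ^ 2 → |c| ≤ K → |a * c| ≤ 2 * (K : ℤ) ^ 2 * K := by
    intro a c ha hc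
    rw [abs_mul]; gcongr
  have a1 := key _ _ h.1 hz.1
  have a2 := key _ _ h.2.1 hz.2.1
  have a3 := key _ _ h.2.2 hz.2.2
  simp only [dot3]
  have b1 := abs_add_le ((cross3 x y).1 * z.1 + (cross3 x y).2.1 * z.2.1)
    ((cross3 x y).2.2 * z.2.2)
  have b2 := abs_add_le ((cross3 x y).1 * z.1) ((cross3 x y).2.1 * z.2.1)
  nlinarith

theorem exists_primitive3_smul {w : ℤ × ℤ × ℤ} (hw : w ≠ 0) :
    ∃ (d : ℕ) (l : ℤ × ℤ × ℤ), 0 < d ∧ Primitive3 l ∧ w = (d * l.1, d * l.2.1, d * l.2.2) := by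
  obtain ⟨a, b, c⟩ := w
  set g := Int.gcd b c with hg
  set d := Int.gcd a g with hd
  have hd0 : d ≠ 0 := by
    intro h
    rw [hd, Int.gcd_eq_zero_iff] at h
    obtain ⟨h1, h2⟩ := h
    have h2' : Int.gcd b c = 0 := by exact_mod_cast h2
    rw [Int.gcd_eq_zero_iff] at h2'
    exact hw (by rw [h1, h2'.1, h2'.2]; rfl)
  obtain ⟨a', ha⟩ : (d : ℤ) ∣ a := Int.gcd_dvd_left _ _
  have hdg : (d : ℤ) ∣ g := Int.gcd_dvd_right _ _
  obtain ⟨b', hb⟩ : (d : ℤ) ∣ b := hdg.trans (Int.gcd_dvd_left _ _)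
  obtain ⟨c', hc⟩ : (d : ℤ) ∣ c := hdg.trans (Int.gcd_dvd_right _ _)
  refine ⟨d, (a', b', c'), Nat.pos_of_ne_zero hd0, ?_, by rw [ha, hb, hc]⟩
  refine ⟨(Int.gcdA a g, Int.gcdB a g * Int.gcdA b c, Int.gcdB a g * Int.gcdB b c), ?_⟩
  have h1 : (d : ℤ) = a * Int.gcdA a g + g * Int.gcdB a g := Int.gcd_eq_gcd_ab a g
  have h2 : (g : ℤ) = b * Int.gcdA b c + c * Int.gcdB b c := Int.gcd_eq_gcd_ab b c
  have hd' : (d : ℤ) ≠ 0 := by exact_mod_cast hd0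
  apply mul_left_cancel₀ hd'
  simp only [dot3]
  generalize Int.gcdA a g = A at h1
  generalize Int.gcdB a g = B at h1
  generalize Int.gcdA b c = C at h2
  generalize Int.gcdB b c = D at h2
  rw [mul_one]
  linear_combination (-A) * ha - B * C * hb - B * D * hc - h1 - B * h2

/-- The primitive zeros in one projective residue class are few or coplanar. -/
theorem card_le_two_or_coplanar {p : ℕ} (hp : Prime (p : ℤ)) {j K : ℕ} (hj : 2 * K < p ^ j)
    {b : ℤ × ℤ × ℤ} (hb : UnitCoords p b) {F : Finset (ℤ × ℤ × ℤ)}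
    (hprim : ∀ x ∈ F, Primitive3 x) (hbox : ∀ x ∈ F, supAbs x ≤ K)
    (h : ∀ x ∈ F, (p : ℤ) ^ (2 * j) ∣ diagForm b x)
    (hB : ∀ x ∈ F, ∀ y ∈ F, (p : ℤ) ^ (2 * j) ∣ diagBilin b x y) :
    F.card ≤ 2 ∨ ∃ l, Primitive3 l ∧ ∀ x ∈ F, dot3 x l = 0 := by
  rcases F.eq_empty_or_nonempty with rfl | ⟨x0, hx0⟩
  · simp
  by_cases hpar : ∀ x ∈ F, cross3 x0 x = 0
  · left
    obtain ⟨u, hu⟩ := hprim x0 hx0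
    -- Parallel primitive vectors differ only by sign.
    have hsub : F ⊆ {x0, (-x0.1, -x0.2.1, -x0.2.2)} := by
      intro x hx
      have e := eq_smul_of_cross_eq_zero hu (hpar x hx)
      obtain ⟨v, hv⟩ := hprim x hx
      set s := dot3 u x
      have hs : IsUnit s := by
        apply IsUnit.of_mul_eq_one (dot3 v x0)
        rw [← hv, e]
        simp only [dot3]; ring
      rcases Int.isUnit_iff.1 hs with h1 | h1
      · rw [e, h1]; simp
      · rw [e, h1]; simp
    exact (Finset.card_le_card hsub).trans Finset.card_le_two
  · right
    push Not at hpar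
    obtain ⟨x1, hx1, hne⟩ := hpar
    obtain ⟨d, l, hd, hl, hw⟩ := exists_primitive3_smul hne
    refine ⟨l, hl, fun z hz => ?_⟩
    have hdet : dot3 (cross3 x0 x1) z = 0 := by
      have h1 := det_dvd_of_bilin_dvd hp hb (h _ hx0) (h _ hx1) (h _ hz) (hB _ hx0 _ hx1)
        (hB _ hx0 _ hz) (hB _ hx1 _ hz)
      -- The determinant is a multiple of `p^(3j) ≥ (2K + 1)³`, but its absolute value is at most
      -- `6K³`.
      apply Int.eq_zero_of_abs_lt_dvd h1
      refine (abs_det_le (hbox _ hx0) (hbox _ hx1) (hbox _ hz)).trans_lt ?_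
      have hj' : 2 * (K : ℤ) + 1 ≤ (p : ℤ) ^ j := by exact_mod_cast hj
      have h2 : (2 * (K : ℤ) + 1) ^ 3 ≤ ((p : ℤ) ^ j) ^ 3 := by gcongr
      rw [← pow_mul, mul_comm j 3] at h2
      have hK : (0 : ℤ) ≤ K := by positivity
      nlinarith [pow_nonneg hK 3, pow_nonneg hK 2]
    rw [hw] at hdet
    have hd' : (d : ℤ) ≠ 0 := by positivity
    apply mul_left_cancel₀ hd'
    simp only [dot3] at hdet ⊢
    linarith

/-! ### Counting projective residue classes of zeros -/

/-- The projective residue class modulo `m`, in the affine chart of the first coordinate. -/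
def projClass (m : ℕ) (x : ℤ × ℤ × ℤ) : ZMod m × ZMod m :=
  ((x.2.1 : ZMod m) * (x.1 : ZMod m)⁻¹, (x.2.2 : ZMod m) * (x.1 : ZMod m)⁻¹)

theorem isUnit_intCast_zmod_pow {p : ℕ} (hp : Prime (p : ℤ)) {j : ℕ} {a : ℤ}
    (ha : ¬ (p : ℤ) ∣ a) : IsUnit (a : ZMod (p ^ j)) := by
  rw [ZMod.coe_int_isUnit_iff_isCoprime]
  push_cast
  exact (hp.coprime_iff_not_dvd.2 ha).pow_left

theorem exists_scalar_of_projClass_eq {p : ℕ} (hp : Prime (p : ℤ)) {j : ℕ} (hj : 0 < j)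
    {x y : ℤ × ℤ × ℤ} (hx : UnitCoords p x) (hy : UnitCoords p y)
    (h : projClass (p ^ j) x = projClass (p ^ j) y) :
    ∃ c : ℤ, ¬ (p : ℤ) ∣ c ∧ (p : ℤ) ^ j ∣ y.1 - c * x.1 ∧ (p : ℤ) ^ j ∣ y.2.1 - c * x.2.1 ∧
      (p : ℤ) ^ j ∣ y.2.2 - c * x.2.2 := by
  have ux := isUnit_intCast_zmod_pow hp (j := j) hx.1
  have uy := isUnit_intCast_zmod_pow hp (j := j) hy.1
  obtain ⟨c, hc⟩ := ZMod.intCast_surjective ((y.1 : ZMod (p ^ j)) * (x.1 : ZMod (p ^ j))⁻¹)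
  have ix := ZMod.mul_inv_of_unit _ ux
  have iy := ZMod.mul_inv_of_unit _ uy
  simp only [projClass, Prod.mk.injEq] at h
  have conv : ∀ m : ℤ, (p : ℤ) ^ j ∣ m ↔ (m : ZMod (p ^ j)) = 0 := by
    intro m
    rw [ZMod.intCast_zmod_eq_zero_iff_dvd]; push_cast; rfl
  have k1 : (p : ℤ) ^ j ∣ y.1 - c * x.1 := by
    rw [conv]; push_cast; rw [hc]
    linear_combination (-(y.1 : ZMod (p ^ j))) * ix
  refine ⟨c, ?_, k1, ?_, ?_⟩
  · intro hd
    apply hy.1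
    have := dvd_add ((dvd_pow_self (p : ℤ) hj.ne').trans k1) (hd.mul_right x.1)
    simpa using this
  · rw [conv]; push_cast; rw [hc]
    linear_combination (-(y.2.1 : ZMod (p ^ j))) * iy - (y.1 : ZMod (p ^ j)) * h.1
  · rw [conv]; push_cast; rw [hc]
    linear_combination (-(y.2.2 : ZMod (p ^ j))) * iy - (y.1 : ZMod (p ^ j)) * h.2

/-- Since `2s` is a unit, `p` cannot divide both `t - s` and `t + s`, so one factor of `t² - s² = 0`
is a unit. -/
theorem zmod_pow_eq_or_eq_neg_of_sq_eq {p : ℕ} (hp : Prime (p : ℤ)) (hp2 : ¬ (p : ℤ) ∣ 2) {j : ℕ}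
    (hj : 0 < j) {s t : ZMod (p ^ j)} (hs : IsUnit s) (h : s ^ 2 = t ^ 2) : t = s ∨ t = -s := by
  obtain ⟨a, rfl⟩ := ZMod.intCast_surjective s
  obtain ⟨c, rfl⟩ := ZMod.intCast_surjective t
  have conv : ∀ m : ℤ, (p : ℤ) ^ j ∣ m ↔ (m : ZMod (p ^ j)) = 0 := by
    intro m
    rw [ZMod.intCast_zmod_eq_zero_iff_dvd]; push_cast; rfl
  have ha : ¬ (p : ℤ) ∣ a := by
    rw [ZMod.coe_int_isUnit_iff_isCoprime] at hs
    push_cast at hs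
    exact hp.coprime_iff_not_dvd.1 ((IsCoprime.pow_left_iff hj).1 hs)
  have h1 : (p : ℤ) ^ j ∣ (c - a) * (c + a) := by
    rw [conv]; push_cast; linear_combination -h
  by_cases hd : (p : ℤ) ∣ c - a
  · left
    have hd2 : ¬ (p : ℤ) ∣ c + a := by
      intro h2
      have : (p : ℤ) ∣ 2 * a := by
        have e : 2 * a = (c + a) - (c - a) := by ring
        rw [e]; exact dvd_sub h2 hd
      rcases hp.dvd_or_dvd this with h3 | h3
      · exact hp2 h3
      · exact ha h3
    have h3 := ((hp.coprime_iff_not_dvd.2 hd2).pow_left (m := j)).dvd_of_dvd_mul_right h1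
    rw [conv] at h3; push_cast at h3
    linear_combination h3
  · right
    have h3 := ((hp.coprime_iff_not_dvd.2 hd).pow_left (m := j)).dvd_of_dvd_mul_left h1
    rw [conv] at h3; push_cast at h3
    linear_combination h3

/-- One chart coordinate takes at most `p^j` values; the other is a unit whose square is then
determined, leaving two choices. -/
theorem card_image_projClass_le {p : ℕ} (hp : Prime (p : ℤ)) (hp2 : ¬ (p : ℤ) ∣ 2) {j : ℕ}
    (hj : 0 < j) {b : ℤ × ℤ × ℤ} (hb : UnitCoords p b) {X : Finset (ℤ × ℤ × ℤ)}
    (hX : ∀ x ∈ X, UnitCoords p x) (h : ∀ x ∈ X, (p : ℤ) ^ j ∣ diagForm b x) :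
    (X.image (projClass (p ^ j))).card ≤ 2 * p ^ j := by
  classical
  have hp0 : p ≠ 0 := by rintro rfl; exact absurd hp (by simp)
  have : NeZero (p ^ j) := ⟨pow_ne_zero _ hp0⟩
  have hc : (Finset.univ : Finset (ZMod (p ^ j))).card = p ^ j := by
    rw [Finset.card_univ, ZMod.card]
  have conv : ∀ m : ℤ, (p : ℤ) ^ j ∣ m ↔ (m : ZMod (p ^ j)) = 0 := by
    intro m
    rw [ZMod.intCast_zmod_eq_zero_iff_dvd]; push_cast; rfl
  have key : ∀ x ∈ X, IsUnit (projClass (p ^ j) x).2 ∧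
      (b.2.2 : ZMod (p ^ j)) * (projClass (p ^ j) x).2 ^ 2 =
        -(b.1 + b.2.1 * (projClass (p ^ j) x).1 ^ 2) := by
    intro x hx
    have ux := isUnit_intCast_zmod_pow hp (j := j) (hX x hx).1
    have ix := ZMod.mul_inv_of_unit _ ux
    refine ⟨(isUnit_intCast_zmod_pow hp (hX x hx).2.2).mul
      (IsUnit.of_mul_eq_one _ ((mul_comm _ _).trans ix)), ?_⟩
    have h0 := (conv _).1 (h x hx)
    simp only [diagForm] at h0
    push_cast at h0
    simp only [projClass]
    generalize (x.1 : ZMod (p ^ j))⁻¹ = i at *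
    linear_combination i ^ 2 * h0 - (b.1 : ZMod (p ^ j)) * ((x.1 : ZMod (p ^ j)) * i + 1) * ix
  refine (Finset.card_le_mul_card_image_of_maps_to (f := Prod.fst)
    (t := (Finset.univ : Finset (ZMod (p ^ j)))) (fun x _ => Finset.mem_univ x.1) 2 ?_).trans_eq
    (by rw [hc])
  intro t _
  rcases ((X.image (projClass (p ^ j))).filter fun x => x.1 = t).eq_empty_or_nonempty with h0 | h0
  · rw [h0]; simp
  obtain ⟨c0, hc0⟩ := h0
  rw [Finset.mem_filter, Finset.mem_image] at hc0
  obtain ⟨⟨x0, hx0, rfl⟩, ht⟩ := hc0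
  set s := (projClass (p ^ j) x0).2 with hs
  have hsub : (X.image (projClass (p ^ j))).filter (fun x => x.1 = t) ⊆ {(t, s), (t, -s)} := by
    intro c hc
    rw [Finset.mem_filter, Finset.mem_image] at hc
    obtain ⟨⟨x, hx, rfl⟩, hxt⟩ := hc
    have k0 := key x0 hx0
    have k1 := key x hx
    rw [ht] at k0
    rw [hxt] at k1
    have ub := isUnit_intCast_zmod_pow hp (j := j) hb.2.2
    have e : s ^ 2 = (projClass (p ^ j) x).2 ^ 2 := ub.mul_left_cancel (k0.2.trans k1.2.symm)
    rw [Finset.mem_insert, Finset.mem_singleton]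
    rcases zmod_pow_eq_or_eq_neg_of_sq_eq hp hp2 hj k0.1 e with h1 | h1
    · left; exact Prod.ext hxt h1
    · right; exact Prod.ext hxt h1
  exact (Finset.card_le_card hsub).trans Finset.card_le_two

/-! ### Counting short zeros modulo a prime power -/

/-- The integer vectors of sup norm at most `K`. -/
noncomputable def box3 (K : ℕ) : Finset (ℤ × ℤ × ℤ) :=
  Finset.Icc (-(K : ℤ)) K ×ˢ Finset.Icc (-(K : ℤ)) K ×ˢ Finset.Icc (-(K : ℤ)) K

theorem mem_box3 {K : ℕ} {x : ℤ × ℤ × ℤ} : x ∈ box3 K ↔ supAbs x ≤ K := by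
  simp only [box3, Finset.mem_product, Finset.mem_Icc, supAbs_le_iff, abs_le]

theorem card_box3 (K : ℕ) : (box3 K).card = (2 * K + 1) ^ 3 := by
  have : (Finset.Icc (-(K : ℤ)) K).card = 2 * K + 1 := by
    rw [Int.card_Icc]; omega
  rw [box3, Finset.card_product, Finset.card_product, this]; ring

/-- Charge each pair to its larger coordinate `a`: at most `2|a| + 1 ≤ 3 max(|a|, 1)` partners share
the weight `1/max(|a|, 1)`, so each `a` costs at most 3. -/
theorem sum_inv_max_le (L : ℕ) :
    ∑ x ∈ Finset.Icc (-(L : ℤ)) L ×ˢ Finset.Icc (-(L : ℤ)) L,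
      1 / ((max x.1.natAbs (max x.2.natAbs 1) : ℕ) : ℝ) ≤ 6 * (2 * L + 1) := by
  set I := Finset.Icc (-(L : ℤ)) L with hI
  have hIcard : (I.card : ℝ) = 2 * L + 1 := by
    rw [hI, Int.card_Icc]
    have : ((L : ℤ) + 1 - -(L : ℤ)).toNat = 2 * L + 1 := by omega
    rw [this]; push_cast; ring
  let h : ℤ → ℤ → ℝ := fun a c =>
    if c.natAbs ≤ a.natAbs then 1 / ((max a.natAbs 1 : ℕ) : ℝ) else 0
  have hnn : ∀ a c, 0 ≤ h a c := by
    intro a c; simp only [h]; split_ifs <;> positivity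
  have h1 : ∀ x : ℤ × ℤ, 1 / ((max x.1.natAbs (max x.2.natAbs 1) : ℕ) : ℝ) ≤
      h x.1 x.2 + h x.2 x.1 := by
    rintro ⟨a, c⟩
    simp only
    rcases le_total c.natAbs a.natAbs with hle | hle
    · have e : max a.natAbs (max c.natAbs 1) = max a.natAbs 1 := by omega
      have : h a c = 1 / ((max a.natAbs 1 : ℕ) : ℝ) := by simp only [h]; rw [if_pos hle]
      rw [e, ← this]
      linarith [hnn c a]
    · have e : max a.natAbs (max c.natAbs 1) = max c.natAbs 1 := by omega
      have : h c a = 1 / ((max c.natAbs 1 : ℕ) : ℝ) := by simp only [h]; rw [if_pos hle]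
      rw [e, ← this]
      linarith [hnn a c]
  have h2 : ∀ a : ℤ, ∑ c ∈ I, h a c ≤ 3 := by
    intro a
    simp only [h]
    rw [← Finset.sum_filter, Finset.sum_const, nsmul_eq_mul, mul_one_div]
    have hc : (I.filter fun c => c.natAbs ≤ a.natAbs).card ≤ 2 * a.natAbs + 1 := by
      calc _ ≤ (Finset.Icc (-(a.natAbs : ℤ)) a.natAbs).card := by
            apply Finset.card_le_card
            intro c hc
            rw [Finset.mem_filter] at hc
            rw [Finset.mem_Icc]
            omega
        _ = _ := by rw [Int.card_Icc]; omega
    rw [div_le_iff₀ (by positivity)]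
    have : 2 * a.natAbs + 1 ≤ 3 * max a.natAbs 1 := by omega
    exact_mod_cast hc.trans this
  calc _ ≤ ∑ x ∈ I ×ˢ I, (h x.1 x.2 + h x.2 x.1) := Finset.sum_le_sum fun x _ => h1 x
    _ = ∑ a ∈ I, ∑ c ∈ I, h a c + ∑ a ∈ I, ∑ c ∈ I, h a c := by
      rw [Finset.sum_add_distrib, Finset.sum_product, Finset.sum_product_right]
    _ ≤ ∑ _a ∈ I, 3 + ∑ _a ∈ I, 3 := by
      gcongr with a _ a _
      · exact h2 a
      · exact h2 a
    _ = 6 * (2 * L + 1) := by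
      rw [Finset.sum_const, nsmul_eq_mul, hIcard]; ring

/-- The short primitive zeros of a diagonal form modulo a large prime power are sparse. -/
theorem sum_inv_supAbs_le {p : ℕ} (hp : Prime (p : ℤ)) {e L : ℕ}
    (hL : 2 * L < p ^ e) {c : ℤ × ℤ × ℤ} (hc : ¬ (p : ℤ) ∣ c.2.2) {S : Finset (ℤ × ℤ × ℤ)}
    (hprim : ∀ x ∈ S, Primitive3 x) (hbox : ∀ x ∈ S, supAbs x ≤ L)
    (h : ∀ x ∈ S, (p : ℤ) ^ (2 * e) ∣ diagForm c x) :
    ∑ x ∈ S, 1 / (supAbs x : ℝ) ≤ 12 * (2 * L + 1) := by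
  classical
  set I := Finset.Icc (-(L : ℤ)) L with hI
  have hmaps : ∀ x ∈ S, ((x.1, x.2.1) : ℤ × ℤ) ∈ I ×ˢ I := by
    intro x hx
    have := supAbs_le_iff.1 (hbox x hx)
    rw [Finset.mem_product, hI, Finset.mem_Icc, Finset.mem_Icc]
    exact ⟨abs_le.1 this.1, abs_le.1 this.2.1⟩
  rw [← Finset.sum_fiberwise_of_maps_to hmaps]
  have hfib : ∀ y ∈ I ×ˢ I, ∑ x ∈ S with (x.1, x.2.1) = y, 1 / (supAbs x : ℝ) ≤
      2 * (1 / ((max y.1.natAbs (max y.2.natAbs 1) : ℕ) : ℝ)) := by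
    intro y _
    have hcard : (S.filter fun x => (x.1, x.2.1) = y).card ≤ 2 := by
      rcases (S.filter fun x => (x.1, x.2.1) = y).eq_empty_or_nonempty with h0 | ⟨x0, hx0⟩
      · rw [h0]; simp
      rw [Finset.mem_filter] at hx0
      obtain ⟨hx0, rfl⟩ := hx0
      have hsub : (S.filter fun x => (x.1, x.2.1) = (x0.1, x0.2.1)) ⊆
          {x0, (x0.1, x0.2.1, -x0.2.2)} := by
        intro x hx
        rw [Finset.mem_filter, Prod.mk.injEq] at hx
        obtain ⟨hx, h1, h2⟩ := hx
        have hd : (p : ℤ) ^ (2 * e) ∣ c.2.2 * ((x.2.2 - x0.2.2) * (x.2.2 + x0.2.2)) := by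
          have := dvd_sub (h x hx) (h x0 hx0)
          simp only [diagForm, h1, h2] at this
          have e : c.2.2 * ((x.2.2 - x0.2.2) * (x.2.2 + x0.2.2)) =
              c.1 * x0.1 ^ 2 + c.2.1 * x0.2.1 ^ 2 + c.2.2 * x.2.2 ^ 2 -
              (c.1 * x0.1 ^ 2 + c.2.1 * x0.2.1 ^ 2 + c.2.2 * x0.2.2 ^ 2) := by ring
          rw [e]; exact this
        have hd2 := ((hp.coprime_iff_not_dvd.2 hc).pow_left).dvd_of_dvd_mul_left hd
        have hb := (supAbs_le_iff.1 (hbox x hx)).2.2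
        have hb0 := (supAbs_le_iff.1 (hbox x0 hx0)).2.2
        have hL' : 2 * (L : ℤ) < (p : ℤ) ^ e := by exact_mod_cast hL
        -- For fixed first two coordinates the squares of the third agree modulo `p^(2e)`, so `p^e`
        -- divides a sum or a difference of size at most `2L < p^e`: the third coordinate is
        -- determined up to sign.
        have hor := hp.pow_dvd_or_of_sep (M := 2 * e) (g := e) hd2 (Or.inl (by omega))
        rw [Finset.mem_insert, Finset.mem_singleton]
        rcases hor with h3 | h3
        · left
          have h4 := Int.eq_zero_of_abs_lt_dvd h3 (by
            have := abs_sub x.2.2 x0.2.2; linarith)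
          exact Prod.ext h1 (Prod.ext h2 (by linarith))
        · right
          have h4 := Int.eq_zero_of_abs_lt_dvd h3 (by
            have := abs_add_le x.2.2 x0.2.2; linarith)
          exact Prod.ext h1 (Prod.ext h2 (by simp only; linarith))
      exact (Finset.card_le_card hsub).trans Finset.card_le_two
    calc _ ≤ ∑ x ∈ S with (x.1, x.2.1) = y,
          1 / ((max y.1.natAbs (max y.2.natAbs 1) : ℕ) : ℝ) := by
          apply Finset.sum_le_sum
          intro x hx
          rw [Finset.mem_filter] at hx
          obtain ⟨hx, rfl⟩ := hx
          have hpos := supAbs_pos_of_primitive (hprim x hx)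
          apply one_div_le_one_div_of_le (by positivity)
          have : max x.1.natAbs (max x.2.1.natAbs 1) ≤ supAbs x := by
            have e : supAbs x = max x.1.natAbs (max x.2.1.natAbs x.2.2.natAbs) := rfl
            omega
          exact_mod_cast this
      _ ≤ _ := by
          rw [Finset.sum_const, nsmul_eq_mul]
          gcongr
          exact_mod_cast hcard
  calc _ ≤ ∑ y ∈ I ×ˢ I, 2 * (1 / ((max y.1.natAbs (max y.2.natAbs 1) : ℕ) : ℝ)) :=
        Finset.sum_le_sum hfib
    _ ≤ 2 * (6 * (2 * L + 1)) := by
        rw [← Finset.mul_sum]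
        have := sum_inv_max_le L
        gcongr
    _ = _ := by ring

theorem card_plane_le_real {p : ℕ} (hp : Prime (p : ℤ)) (hp2 : ¬ (p : ℤ) ∣ 2) {M g : ℕ}
    (hM : 0 < M) {b l : ℤ × ℤ × ℤ} (hb : UnitCoords p b) (hl : Primitive3 l)
    (hg : 2 * g ≤ M + 1 ∨ (g ≤ M ∧ M ≤ 2 * g ∧
      ¬ (p : ℤ) ^ (2 * (M - g)) ∣ diagForm (adjCoeff b) l))
    {K : ℕ} {Y : Finset (ℤ × ℤ × ℤ)} (hunit : ∀ x ∈ Y, UnitCoords p x)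
    (hperp : ∀ x ∈ Y, dot3 x l = 0) (hprim : ∀ x ∈ Y, Primitive3 x)
    (hbox : ∀ x ∈ Y, supAbs x ≤ K) (h : ∀ x ∈ Y, (p : ℤ) ^ M ∣ diagForm b x)
    {P : ℝ} (hP : 0 < P) (hPg : P ≤ (p : ℝ) ^ g) :
    (Y.card : ℝ) ≤ 10 + 40 * ((K : ℝ) ^ 2 / P) * (1 / (supAbs l : ℝ)) := by
  have h1 := card_plane_le hp hp2 hM hb hl hg hunit hperp hprim hbox h
  have hpos := supAbs_pos_of_primitive hl
  have h2 : ((2 * K ^ 2 / (supAbs l * p ^ g) : ℕ) : ℝ) ≤ 2 * (K : ℝ) ^ 2 / (supAbs l * P) := by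
    refine Nat.cast_div_le.trans ?_
    push_cast
    gcongr
  have h3 : (Y.card : ℝ) ≤ 10 * (2 * ((2 * K ^ 2 / (supAbs l * p ^ g) : ℕ) : ℝ) + 1) := by
    exact_mod_cast h1
  have e : 2 * (K : ℝ) ^ 2 / (supAbs l * P) = 2 * ((K : ℝ) ^ 2 / P * (1 / (supAbs l : ℝ))) := by
    field_simp
  rw [e] at h2
  linarith

/-- Projective classes with at most `60 r³` members are affordable because there are `O(pK)` of
them. A fuller class spans a plane. The plane bound with `g = ⌊(M+1)/2⌋` forces the normal to have
norm at most `r^7`; with `g = M - e`, where `p^e` is `r^10` up to a factor `p`, it forces `p^(2e)`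
to divide the adjugate form at the normal. Over such normals the sum of `1/‖l‖` is `O(r^7)`, for a
total of `K² r^(-18) r^7 ≤ K r³`, which balances the small classes. -/
theorem card_primitive_zeros_le_of_large {p : ℕ} (hp : Prime (p : ℤ)) (hp2 : ¬ (p : ℤ) ∣ 2)
    {M K : ℕ} {r : ℝ} (hr : r ^ 36 = (p : ℝ) ^ M) (hrp : 4 * (p : ℝ) < r) (hK0 : 1 ≤ K)
    (hK : (K : ℝ) ≤ r ^ 14) {b : ℤ × ℤ × ℤ} (hb : UnitCoords p b) {X : Finset (ℤ × ℤ × ℤ)}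
    (hprim : ∀ x ∈ X, Primitive3 x) (hunit : ∀ x ∈ X, UnitCoords p x)
    (hbox : ∀ x ∈ X, supAbs x ≤ K) (h : ∀ x ∈ X, (p : ℤ) ^ M ∣ diagForm b x) :
    (X.card : ℝ) ≤ (240 * p + 2880) * K * r ^ 3 := by
  classical
  have hp0 : p ≠ 0 := by rintro rfl; exact absurd hp (by simp)
  have hp1 : 1 < p := (Nat.prime_iff_prime_int.2 hp).one_lt
  have hpR : (1 : ℝ) < p := by exact_mod_cast hp1
  have hr4 : 4 < r := by linarith
  have hr1 : 1 ≤ r := by linarith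
  have hr0 : 0 < r := by linarith
  have hK1 : (1 : ℝ) ≤ K := by exact_mod_cast hK0
  have pow_lt_iff : ∀ {a c : ℕ}, (p : ℝ) ^ a < (p : ℝ) ^ c → a < c :=
    fun h => (pow_lt_pow_iff_right₀ hpR).1 h
  have hM : 0 < M := by
    rcases Nat.eq_zero_or_pos M with rfl | h0
    · have : 1 < r ^ 36 := one_lt_pow₀ (by linarith) (by norm_num)
      rw [hr] at this; simp at this
    · exact h0
  -- the auxiliary exponents
  obtain ⟨e, he⟩ : ∃ e, e = 5 * M / 18 := ⟨_, rfl⟩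
  have he_le : (p : ℝ) ^ e ≤ r ^ 10 := by
    have : ((p : ℝ) ^ e) ^ 18 ≤ (r ^ 10) ^ 18 := by
      rw [← pow_mul, ← pow_mul, show 10 * 18 = 36 * 5 by norm_num, pow_mul r, hr, ← pow_mul]
      exact pow_le_pow_right₀ hpR.le (by omega)
    exact le_of_pow_le_pow_left₀ (by norm_num) (by positivity) this
  have he_ge : r ^ 10 ≤ (p : ℝ) ^ e * p := by
    rw [← pow_succ]
    have : (r ^ 10) ^ 18 ≤ ((p : ℝ) ^ (e + 1)) ^ 18 := by
      rw [← pow_mul, ← pow_mul, show 10 * 18 = 36 * 5 by norm_num, pow_mul r, hr, ← pow_mul]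
      exact pow_le_pow_right₀ hpR.le (by omega)
    exact le_of_pow_le_pow_left₀ (by norm_num) (by positivity) this
  set L := ⌊r ^ 7⌋₊ with hLdef
  have hL_le : (L : ℝ) ≤ r ^ 7 := Nat.floor_le (by positivity)
  have hLe : 2 * L < p ^ e := by
    have h1 : 2 * r ^ 7 * p < (p : ℝ) ^ e * p := by
      calc 2 * r ^ 7 * p < r ^ 7 * r := by nlinarith [pow_pos hr0 7]
        _ = r ^ 8 := by ring
        _ ≤ r ^ 10 := pow_le_pow_right₀ hr1 (by norm_num)
        _ ≤ _ := he_ge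
    have h2 : 2 * r ^ 7 < (p : ℝ) ^ e := lt_of_mul_lt_mul_right h1 (by positivity)
    have h3 : 2 * (L : ℝ) < (p : ℝ) ^ e := by linarith
    exact_mod_cast h3
  obtain ⟨g0, hg0⟩ : ∃ g, g = (M + 1) / 2 := ⟨_, rfl⟩
  have hg0_ge : r ^ 18 ≤ (p : ℝ) ^ g0 := by
    have : (r ^ 18) ^ 2 ≤ ((p : ℝ) ^ g0) ^ 2 := by
      rw [← pow_mul, ← pow_mul, hr]
      exact pow_le_pow_right₀ hpR.le (by omega)
    exact le_of_pow_le_pow_left₀ (by norm_num) (by positivity) this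
  have hg1_ge : r ^ 26 ≤ (p : ℝ) ^ (M - e) := by
    have h1 : (p : ℝ) ^ (M - e) * (p : ℝ) ^ e = r ^ 26 * r ^ 10 := by
      rw [← pow_add, ← pow_add, hr, Nat.sub_add_cancel (by omega)]
    have h2 : r ^ 26 * (p : ℝ) ^ e ≤ (p : ℝ) ^ (M - e) * (p : ℝ) ^ e := by
      rw [h1]; gcongr
    exact le_of_mul_le_mul_right h2 (by positivity)
  -- `p^j` exceeds `2K`, as coplanarity requires, but by a factor of at most `p`, so there are at
  -- most `4pK` classes.
  obtain ⟨j, hj_lt, hj_le⟩ : ∃ j, 2 * K < p ^ j ∧ p ^ j ≤ 2 * K * p := by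
    refine ⟨Nat.log p (2 * K) + 1, Nat.lt_pow_succ_log_self hp1 _, ?_⟩
    rw [pow_succ]
    exact Nat.mul_le_mul_right _ (Nat.pow_log_le_self p (by omega))
  have hj0 : 0 < j := by
    rcases Nat.eq_zero_or_pos j with rfl | h0
    · simp at hj_lt; omega
    · exact h0
  have hj_le' : (p : ℝ) ^ j ≤ 2 * K * p := by exact_mod_cast hj_le
  have hjM : 2 * j ≤ M := by
    apply le_of_lt
    apply pow_lt_iff
    calc (p : ℝ) ^ (2 * j) = ((p : ℝ) ^ j) ^ 2 := by rw [mul_comm, pow_mul]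
      _ ≤ (2 * K * p) ^ 2 := by gcongr
      _ = 4 * (K : ℝ) ^ 2 * (p : ℝ) ^ 2 := by ring
      _ ≤ 4 * (r ^ 14) ^ 2 * (p : ℝ) ^ 2 := by gcongr
      _ < r ^ 28 * r ^ 2 := by
        have : 4 * (p : ℝ) ^ 2 < r ^ 2 := by nlinarith
        have h28 : 0 < r ^ 28 := by positivity
        nlinarith
      _ = r ^ 30 := by ring
      _ ≤ r ^ 36 := pow_le_pow_right₀ hr1 (by norm_num)
      _ = _ := hr
  have h2j : ∀ x ∈ X, (p : ℤ) ^ (2 * j) ∣ diagForm b x :=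
    fun x hx => (pow_dvd_pow _ hjM).trans (h x hx)
  set key := projClass (p ^ j) with hkey
  let fib : ℤ × ℤ × ℤ → Finset (ℤ × ℤ × ℤ) := fun x => X.filter fun y => key y = key x
  set H : ℝ := 60 * r ^ 3 with hH
  have hr3 : 1 ≤ r ^ 3 := one_le_pow₀ hr1
  -- the small classes
  set X1 := X.filter fun x => ((fib x).card : ℝ) ≤ H with hX1
  set X2 := X.filter fun x => ¬ ((fib x).card : ℝ) ≤ H with hX2
  have hcard1 : (X1.card : ℝ) ≤ 240 * p * K * r ^ 3 := by
    have h1 : X1.card ≤ ⌊H⌋₊ * (X.image key).card := by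
      refine Finset.card_le_mul_card_image_of_maps_to (f := key)
        (fun x hx => Finset.mem_image_of_mem _ (Finset.mem_filter.1 hx).1) _ ?_
      intro c _
      rcases (X1.filter fun x => key x = c).eq_empty_or_nonempty with h0 | ⟨x0, hx0⟩
      · rw [h0]; simp
      rw [Finset.mem_filter, hX1, Finset.mem_filter] at hx0
      obtain ⟨⟨hx0, hle⟩, rfl⟩ := hx0
      refine (Finset.card_le_card ?_).trans (Nat.le_floor hle)
      intro x hx
      rw [Finset.mem_filter, Finset.mem_filter] at hx
      exact Finset.mem_filter.2 ⟨hx.1.1, hx.2⟩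
    have h2 := card_image_projClass_le hp hp2 hj0 hb hunit
      (fun x hx => (pow_dvd_pow _ (by omega)).trans (h x hx))
    have h1' : (X1.card : ℝ) ≤ (⌊H⌋₊ : ℝ) * ((X.image key).card : ℝ) := by exact_mod_cast h1
    have h2' : ((X.image key).card : ℝ) ≤ 2 * (p : ℝ) ^ j := by exact_mod_cast h2
    calc (X1.card : ℝ) ≤ (⌊H⌋₊ : ℝ) * ((X.image key).card : ℝ) := h1'
      _ ≤ H * (2 * (2 * K * p)) := by
        gcongr
        · exact Nat.floor_le (by positivity)
        · linarith
      _ = _ := by rw [hH]; ring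
  -- the large classes
  have hplane : ∀ x ∈ X2, ∃ l, Primitive3 l ∧ (∀ y ∈ fib x, dot3 y l = 0) := by
    intro x hx
    rw [hX2, Finset.mem_filter, not_le] at hx
    have hsub : ∀ y ∈ fib x, y ∈ X := fun y hy => (Finset.mem_filter.1 hy).1
    have := card_le_two_or_coplanar hp hj_lt hb (F := fib x) (fun y hy => hprim y (hsub y hy))
      (fun y hy => hbox y (hsub y hy)) (fun y hy => h2j y (hsub y hy)) (by
        intro y hy z hz
        obtain ⟨c, hc, c1, c2, c3⟩ := exists_scalar_of_projClass_eq hp hj0 (hunit y (hsub y hy))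
          (hunit z (hsub z hz))
          ((Finset.mem_filter.1 hy).2.trans (Finset.mem_filter.1 hz).2.symm)
        exact bilin_dvd_of_congr hp hp2 hc (h2j y (hsub y hy)) (h2j z (hsub z hz)) c1 c2 c3)
    refine this.resolve_left ?_
    intro h2
    have h2' : ((fib x).card : ℝ) ≤ 2 := by exact_mod_cast h2
    linarith [hx.2]
  choose! nv hnv1 hnv2 using hplane
  set S := X2.image nv with hS
  let Y : ℤ × ℤ × ℤ → Finset (ℤ × ℤ × ℤ) := fun l => X.filter fun y => dot3 y l = 0
  have hYX : ∀ l, ∀ y ∈ Y l, y ∈ X := fun l y hy => (Finset.mem_filter.1 hy).1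
  have hYl : ∀ l, ∀ y ∈ Y l, dot3 y l = 0 := fun l y hy => (Finset.mem_filter.1 hy).2
  have hSprim : ∀ l ∈ S, Primitive3 l := by
    intro l hl
    obtain ⟨x, hx, rfl⟩ := Finset.mem_image.1 hl
    exact hnv1 x hx
  have hYlarge : ∀ l ∈ S, H < (Y l).card := by
    intro l hl
    obtain ⟨x, hx, rfl⟩ := Finset.mem_image.1 hl
    have hx' := hx
    rw [hX2, Finset.mem_filter, not_le] at hx
    refine hx.2.trans_le ?_
    have : fib x ⊆ Y (nv x) := by
      intro y hy
      exact Finset.mem_filter.2 ⟨(Finset.mem_filter.1 hy).1, hnv2 x hx' y hy⟩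
    exact_mod_cast Finset.card_le_card this
  have hY0 : ∀ l ∈ S, ((Y l).card : ℝ) ≤
      10 + 40 * ((K : ℝ) ^ 2 / r ^ 18) * (1 / (supAbs l : ℝ)) := fun l hl =>
    card_plane_le_real hp hp2 hM hb (hSprim l hl) (g := g0) (Or.inl (by omega))
      (fun y hy => hunit y (hYX l y hy)) (hYl l) (fun y hy => hprim y (hYX l y hy))
      (fun y hy => hbox y (hYX l y hy)) (fun y hy => h y (hYX l y hy)) (by positivity) hg0_ge
  have hSbox : ∀ l ∈ S, supAbs l ≤ L := by
    intro l hl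
    have h1 := hYlarge l hl
    have h2 := hY0 l hl
    have hpos := supAbs_pos_of_primitive (hSprim l hl)
    have hposR : (0 : ℝ) < supAbs l := by exact_mod_cast hpos
    apply Nat.le_floor
    have h3 : r ^ 3 ≤ (K : ℝ) ^ 2 / r ^ 18 * (1 / (supAbs l : ℝ)) := by
      rw [hH] at h1; linarith
    have h4 : (K : ℝ) ^ 2 / r ^ 18 ≤ r ^ 10 := by
      rw [div_le_iff₀ (by positivity)]
      calc (K : ℝ) ^ 2 ≤ (r ^ 14) ^ 2 := by gcongr
        _ = r ^ 10 * r ^ 18 := by ring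
    have h5 : r ^ 3 ≤ r ^ 10 * (1 / (supAbs l : ℝ)) := h3.trans (by gcongr)
    rw [mul_one_div, le_div_iff₀ hposR] at h5
    have h6 : r ^ 3 * (supAbs l : ℝ) ≤ r ^ 3 * r ^ 7 := by
      calc _ ≤ r ^ 10 := h5
        _ = _ := by ring
    exact le_of_mul_le_mul_left h6 (by positivity)
  -- Otherwise the sharper exponent `M - e` is available and the plane holds at most `10 + 40 r² ≤
  -- 50 r³` points, below the threshold.
  have hSdvd : ∀ l ∈ S, (p : ℤ) ^ (2 * e) ∣ diagForm (adjCoeff b) l := by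
    intro l hl
    by_contra hnd
    have h1 := hYlarge l hl
    have hpos := supAbs_pos_of_primitive (hSprim l hl)
    have hposR : (1 : ℝ) ≤ supAbs l := by exact_mod_cast hpos
    have h2 := card_plane_le_real hp hp2 hM hb (hSprim l hl) (g := M - e)
      (Or.inr ⟨by omega, by omega, by
        rw [show M - (M - e) = e by omega]; exact hnd⟩)
      (fun y hy => hunit y (hYX l y hy)) (hYl l) (fun y hy => hprim y (hYX l y hy))
      (fun y hy => hbox y (hYX l y hy)) (fun y hy => h y (hYX l y hy)) (by positivity) hg1_ge
    have h4 : (K : ℝ) ^ 2 / r ^ 26 ≤ r ^ 2 := by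
      rw [div_le_iff₀ (by positivity)]
      calc (K : ℝ) ^ 2 ≤ (r ^ 14) ^ 2 := by gcongr
        _ = r ^ 2 * r ^ 26 := by ring
    have h5 : 1 / (supAbs l : ℝ) ≤ 1 := by
      rw [div_le_one (by linarith)]; exact hposR
    have h6 : (K : ℝ) ^ 2 / r ^ 26 * (1 / (supAbs l : ℝ)) ≤ r ^ 2 * 1 := by gcongr
    have h7 : r ^ 2 ≤ r ^ 3 := pow_le_pow_right₀ hr1 (by norm_num)
    rw [hH] at h1
    linarith
  have hsum := sum_inv_supAbs_le hp hLe (c := adjCoeff b)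
    (by
      intro hd
      rcases hp.dvd_or_dvd hd with h1 | h1
      · exact hb.1 h1
      · exact hb.2.1 h1) hSprim hSbox hSdvd
  have hcard2 : (X2.card : ℝ) ≤ 2880 * K * r ^ 3 := by
    have h1 : X2 ⊆ S.biUnion Y := by
      intro x hx
      rw [Finset.mem_biUnion]
      have hxX : x ∈ X := (Finset.mem_filter.1 hx).1
      exact ⟨nv x, Finset.mem_image_of_mem _ hx, Finset.mem_filter.2 ⟨hxX,
        hnv2 x hx x (Finset.mem_filter.2 ⟨hxX, rfl⟩)⟩⟩
    have h2 : (X2.card : ℝ) ≤ ∑ l ∈ S, ((Y l).card : ℝ) := by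
      exact_mod_cast (Finset.card_le_card h1).trans Finset.card_biUnion_le
    calc (X2.card : ℝ) ≤ ∑ l ∈ S, ((Y l).card : ℝ) := h2
      _ ≤ ∑ l ∈ S, 80 * ((K : ℝ) ^ 2 / r ^ 18) * (1 / (supAbs l : ℝ)) := by
        apply Finset.sum_le_sum
        intro l hl
        -- More than `60 r³` points make the constant 10 no larger than the other term, so 40
        -- becomes 80.
        have a1 := hYlarge l hl
        have a2 := hY0 l hl
        rw [hH] at a1
        linarith
      _ = 80 * ((K : ℝ) ^ 2 / r ^ 18) * ∑ l ∈ S, 1 / (supAbs l : ℝ) := by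
        rw [Finset.mul_sum]
      _ ≤ 80 * ((K : ℝ) * r ^ 14 / r ^ 18) * (12 * (2 * r ^ 7 + r ^ 7)) := by
        -- With `2L + 1 ≤ 3 r^7` and `K² ≤ K r^14` the constant is `80 · 12 · 3 = 2880`.
        have hr7 : 1 ≤ r ^ 7 := one_le_pow₀ hr1
        have hKK : (K : ℝ) ^ 2 ≤ K * r ^ 14 := by rw [sq]; gcongr
        have hs : ∑ l ∈ S, 1 / (supAbs l : ℝ) ≤ 12 * (2 * r ^ 7 + r ^ 7) := by linarith
        have hs0 : 0 ≤ ∑ l ∈ S, 1 / (supAbs l : ℝ) := Finset.sum_nonneg fun l _ => by positivity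
        gcongr
      _ = 2880 * K * r ^ 3 := by field_simp; ring
  have hsplit : X1.card + X2.card = X.card := Finset.card_filter_add_card_filter_not _
  have : (X.card : ℝ) = X1.card + X2.card := by exact_mod_cast hsplit.symm
  rw [this]
  linarith

/-- When `r ≤ 4p` the box itself has at most `27 K³ ≤ 27 (4p)^28 K` points; this is the third
summand of the constant. -/
theorem card_primitive_zeros_le {p : ℕ} (hp : Prime (p : ℤ)) (hp2 : ¬ (p : ℤ) ∣ 2)
    {M K : ℕ} {r : ℝ} (hr0 : 0 < r) (hr : r ^ 36 = (p : ℝ) ^ M) (hK0 : 1 ≤ K)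
    (hK : (K : ℝ) ≤ r ^ 14) {b : ℤ × ℤ × ℤ} (hb : UnitCoords p b) {X : Finset (ℤ × ℤ × ℤ)}
    (hprim : ∀ x ∈ X, Primitive3 x) (hunit : ∀ x ∈ X, UnitCoords p x)
    (hbox : ∀ x ∈ X, supAbs x ≤ K) (h : ∀ x ∈ X, (p : ℤ) ^ M ∣ diagForm b x) :
    (X.card : ℝ) ≤ (240 * p + 2880 + 27 * (4 * p) ^ 28) * K * r ^ 3 := by
  have hp1 : 1 ≤ p := (Nat.prime_iff_prime_int.2 hp).one_lt.le
  have hpR : (1 : ℝ) ≤ p := by exact_mod_cast hp1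
  have hr1 : 1 ≤ r := by
    have : (1 : ℝ) ^ 36 ≤ r ^ 36 := by rw [hr, one_pow]; exact one_le_pow₀ hpR
    exact le_of_pow_le_pow_left₀ (by norm_num) hr0.le this
  have hK1 : (1 : ℝ) ≤ K := by exact_mod_cast hK0
  rcases lt_or_ge (4 * (p : ℝ)) r with hlt | hle
  · have := card_primitive_zeros_le_of_large hp hp2 hr hlt hK0 hK hb hprim hunit hbox h
    refine this.trans ?_
    gcongr ?_ * _ * _
    linarith [show (0 : ℝ) ≤ 27 * (4 * p) ^ 28 by positivity]
  · have h1 : X.card ≤ (2 * K + 1) ^ 3 := by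
      rw [← card_box3]
      exact Finset.card_le_card fun x hx => mem_box3.2 (hbox x hx)
    have h1' : (X.card : ℝ) ≤ (2 * K + 1) ^ 3 := by exact_mod_cast h1
    have hr3 : 1 ≤ r ^ 3 := one_le_pow₀ hr1
    calc (X.card : ℝ) ≤ (2 * K + 1) ^ 3 := h1'
      _ ≤ (3 * K) ^ 3 := by gcongr; linarith
      _ = 27 * (K : ℝ) ^ 2 * K * 1 := by ring
      _ ≤ 27 * ((4 * p) ^ 14) ^ 2 * K * r ^ 3 := by
        gcongr
        exact hK.trans (by gcongr)
      _ ≤ _ := by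
        rw [← pow_mul]
        norm_num only
        gcongr ?_ * _ * _
        linarith

/-- The number of zeros modulo `p ^ M` with coordinates prime to `p` in a short box. -/
theorem card_zeros_le {p : ℕ} (hp : Prime (p : ℤ)) (hp2 : ¬ (p : ℤ) ∣ 2)
    {M K : ℕ} {r : ℝ} (hr0 : 0 < r) (hr : r ^ 36 = (p : ℝ) ^ M) (hK0 : 1 ≤ K)
    (hK : (K : ℝ) ≤ r ^ 14) {b : ℤ × ℤ × ℤ} (hb : UnitCoords p b) {X : Finset (ℤ × ℤ × ℤ)}
    (hunit : ∀ x ∈ X, UnitCoords p x)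
    (hbox : ∀ x ∈ X, supAbs x ≤ K) (h : ∀ x ∈ X, (p : ℤ) ^ M ∣ diagForm b x) :
    (X.card : ℝ) ≤ (240 * p + 2880 + 27 * (4 * p) ^ 28) * K * r ^ 3 * (1 + Real.log K) := by
  classical
  set C : ℝ := 240 * p + 2880 + 27 * (4 * p) ^ 28 with hC
  let Y : ℕ → Finset (ℤ × ℤ × ℤ) := fun d => (box3 (K / d)).filter fun x =>
    Primitive3 x ∧ UnitCoords p x ∧ (p : ℤ) ^ M ∣ diagForm b x
  -- Split by content `d`, which is prime to `p` because the coordinates are. The primitive parts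
  -- are zeros in the box of size `K / d`, and summing `1/d` produces the logarithm.
  have hsub : X ⊆ (Finset.Icc 1 K).biUnion fun d =>
      (Y d).image fun x => ((d : ℤ) * x.1, (d : ℤ) * x.2.1, (d : ℤ) * x.2.2) := by
    intro x hx
    have hu := hunit x hx
    have hx0 : x ≠ 0 := by
      rintro rfl
      exact hu.1 (dvd_zero _)
    obtain ⟨d, y, hd, hy, e⟩ := exists_primitive3_smul hx0
    have hsup : supAbs x = d * supAbs y := by
      rw [e, supAbs_smul, Int.natAbs_natCast]
    have hle := hbox x hx
    rw [hsup] at hle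
    have hypos := supAbs_pos_of_primitive hy
    have hpd : ¬ (p : ℤ) ∣ d := by
      intro hpd
      apply hu.1
      rw [e]
      exact hpd.mul_right _
    rw [Finset.mem_biUnion]
    refine ⟨d, Finset.mem_Icc.2 ⟨hd, (Nat.le_mul_of_pos_right _ hypos).trans hle⟩, ?_⟩
    refine Finset.mem_image.2 ⟨y, Finset.mem_filter.2 ⟨?_, hy, ?_, ?_⟩, e.symm⟩
    · rw [mem_box3, Nat.le_div_iff_mul_le hd, mul_comm]; exact hle
    · rw [e] at hu
      exact ⟨fun h0 => hu.1 (h0.mul_left _), fun h0 => hu.2.1 (h0.mul_left _),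
        fun h0 => hu.2.2 (h0.mul_left _)⟩
    · have h1 := h x hx
      have e2 : diagForm b x = (d : ℤ) ^ 2 * diagForm b y := by
        rw [e]; simp only [diagForm]; ring
      rw [e2] at h1
      exact (((hp.coprime_iff_not_dvd.2 hpd).pow_left).pow_right).dvd_of_dvd_mul_left h1
  have hY : ∀ d ∈ Finset.Icc 1 K, ((Y d).card : ℝ) ≤ C * K * r ^ 3 * (d : ℝ)⁻¹ := by
    intro d hd
    rw [Finset.mem_Icc] at hd
    have hKd : 1 ≤ K / d := (Nat.one_le_div_iff (by omega)).2 hd.2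
    have hKd' : ((K / d : ℕ) : ℝ) ≤ K * (d : ℝ)⁻¹ := by
      rw [← div_eq_mul_inv]; exact Nat.cast_div_le
    have := card_primitive_zeros_le hp hp2 hr0 hr hKd
      (le_trans (by exact_mod_cast Nat.div_le_self K d) hK) hb (X := Y d)
      (fun x hx => (Finset.mem_filter.1 hx).2.1) (fun x hx => (Finset.mem_filter.1 hx).2.2.1)
      (fun x hx => mem_box3.1 (Finset.mem_filter.1 hx).1)
      (fun x hx => (Finset.mem_filter.1 hx).2.2.2)
    calc ((Y d).card : ℝ) ≤ C * ((K / d : ℕ) : ℝ) * r ^ 3 := this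
      _ ≤ C * (K * (d : ℝ)⁻¹) * r ^ 3 := by gcongr
      _ = _ := by ring
  have hcard : (X.card : ℝ) ≤ ∑ d ∈ Finset.Icc 1 K, ((Y d).card : ℝ) := by
    have := (Finset.card_le_card hsub).trans Finset.card_biUnion_le
    have h2 := this.trans (Finset.sum_le_sum fun d _ => Finset.card_image_le)
    exact_mod_cast h2
  calc (X.card : ℝ) ≤ ∑ d ∈ Finset.Icc 1 K, ((Y d).card : ℝ) := hcard
    _ ≤ ∑ d ∈ Finset.Icc 1 K, C * K * r ^ 3 * (d : ℝ)⁻¹ := Finset.sum_le_sum hY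
    _ = C * K * r ^ 3 * ((harmonic K : ℚ) : ℝ) := by
      rw [← Finset.mul_sum, harmonic_eq_sum_Icc]; push_cast; rfl
    _ ≤ _ := by
      gcongr
      exact harmonic_le_one_add_log K

/-! ### The ring of integers modulo a prime power -/

section PrimePowerRing

theorem zmod_prime_pow_self {p n : ℕ} : (p : ZMod (p ^ n)) ^ n = 0 := by
  rw [← Nat.cast_pow]
  exact ZMod.natCast_self _

variable {p : ℕ} [Fact p.Prime] {n : ℕ}

theorem zmod_prime_pow_eq_zero_iff {m : ℕ} : (p : ZMod (p ^ n)) ^ m = 0 ↔ n ≤ m := by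
  have : ((p ^ m : ℕ) : ZMod (p ^ n)) = 0 ↔ n ≤ m := by
    rw [ZMod.natCast_eq_zero_iff]
    exact Nat.pow_dvd_pow_iff_le_right (Fact.out : p.Prime).one_lt
  simpa using this

theorem zmod_prime_pow_mul_unit_eq_zero_iff {m : ℕ} {u : ZMod (p ^ n)} (hu : IsUnit u) :
    (p : ZMod (p ^ n)) ^ m * u = 0 ↔ n ≤ m := by
  rw [hu.mul_left_eq_zero, zmod_prime_pow_eq_zero_iff]

theorem isUnit_natCast_of_not_dvd {m : ℕ} (hm : ¬ p ∣ m) : IsUnit (m : ZMod (p ^ n)) := by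
  have := isUnit_intCast_zmod_pow (Nat.prime_iff_prime_int.1 (Fact.out : p.Prime)) (j := n)
    (a := (m : ℤ)) (by exact_mod_cast hm)
  simpa using this

theorem exists_eq_prime_pow_mul_unit (a : ZMod (p ^ n)) :
    ∃ j ≤ n, ∃ u, IsUnit u ∧ a = (p : ZMod (p ^ n)) ^ j * u := by
  by_cases h0 : a = 0
  · exact ⟨n, le_rfl, 1, isUnit_one, by rw [h0, zmod_prime_pow_self, zero_mul]⟩
  have hv : a.val ≠ 0 := by rwa [Ne, ZMod.val_eq_zero]
  obtain ⟨j, m, hm, e⟩ := Nat.exists_eq_pow_mul_and_not_dvd hv p (Fact.out : p.Prime).ne_one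
  refine ⟨j, ?_, m, isUnit_natCast_of_not_dvd hm, ?_⟩
  · by_contra! hj
    apply h0
    rw [← ZMod.natCast_zmod_val a, e, Nat.cast_mul, Nat.cast_pow,
      zmod_prime_pow_eq_zero_iff.2 hj.le, zero_mul]
  · rw [← ZMod.natCast_zmod_val a, e]; simp

theorem exists_eq_prime_mul_of_not_isUnit {a : ZMod (p ^ n)} (ha : ¬ IsUnit a) :
    ∃ c, a = (p : ZMod (p ^ n)) * c := by
  obtain ⟨j, -, u, hu, e⟩ := exists_eq_prime_pow_mul_unit a
  rcases j with _ | j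
  · rw [pow_zero, one_mul] at e; exact absurd (e ▸ hu) ha
  · exact ⟨(p : ZMod (p ^ n)) ^ j * u, by rw [e]; ring⟩

theorem isUnit_add_prime_mul_iff {p n : ℕ} {a c : ZMod (p ^ n)} :
    IsUnit (a + (p : ZMod (p ^ n)) * c) ↔ IsUnit a := by
  have hnil : ∀ c : ZMod (p ^ n), IsNilpotent ((p : ZMod (p ^ n)) * c) := fun c =>
    ⟨n, by rw [mul_pow, zmod_prime_pow_self, zero_mul]⟩
  constructor
  · intro h
    have := (hnil (-c)).isUnit_add_left_of_commute h (Commute.all _ _)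
    convert this using 1; ring
  · intro h
    exact (hnil c).isUnit_add_left_of_commute h (Commute.all _ _)

theorem isUnit_add_prime_pow_mul_iff {p n : ℕ} {s : ℕ} (hs : 0 < s) {a c : ZMod (p ^ n)} :
    IsUnit (a + (p : ZMod (p ^ n)) ^ s * c) ↔ IsUnit a := by
  obtain ⟨t, rfl⟩ : ∃ t, s = t + 1 := ⟨s - 1, by omega⟩
  rw [pow_succ', mul_assoc, isUnit_add_prime_mul_iff]

/-- The annihilator of `p^k` consists of the multiples of `p^(n-k)`. -/
theorem card_prime_pow_mul_eq_zero {k : ℕ} (hk : k ≤ n) :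
    (Finset.univ.filter fun a : ZMod (p ^ n) => (p : ZMod (p ^ n)) ^ k * a = 0).card = p ^ k := by
  have hp : 0 < p := (Fact.out : p.Prime).pos
  have hn : p ^ n = p ^ (n - k) * p ^ k := by rw [← pow_add, Nat.sub_add_cancel hk]
  rw [← Finset.card_range (p ^ k)]
  symm
  refine Finset.card_bij (fun i _ => ((p ^ (n - k) * i : ℕ) : ZMod (p ^ n))) ?_ ?_ ?_
  · intro i _
    rw [Finset.mem_filter]
    refine ⟨Finset.mem_univ _, ?_⟩
    rw [← Nat.cast_pow, ← Nat.cast_mul, ZMod.natCast_eq_zero_iff, hn]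
    exact ⟨i, by ring⟩
  · intro i hi i' hi' e
    rw [Finset.mem_range] at hi hi'
    rw [ZMod.natCast_eq_natCast_iff'] at e
    have lt : ∀ i, i < p ^ k → p ^ (n - k) * i < p ^ n := by
      intro i hi
      rw [hn]; exact (Nat.mul_lt_mul_left (by positivity)).2 hi
    rw [Nat.mod_eq_of_lt (lt i hi), Nat.mod_eq_of_lt (lt i' hi')] at e
    exact Nat.eq_of_mul_eq_mul_left (by positivity) e
  · intro a ha
    rw [Finset.mem_filter] at ha
    have h1 : ((p ^ k * a.val : ℕ) : ZMod (p ^ n)) = 0 := by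
      push_cast; rw [ZMod.natCast_zmod_val]; exact ha.2
    rw [ZMod.natCast_eq_zero_iff] at h1
    obtain ⟨i, hi⟩ : p ^ (n - k) ∣ a.val := by
      apply Nat.dvd_of_mul_dvd_mul_left (by positivity : 0 < p ^ k)
      refine Dvd.dvd.trans (dvd_of_eq ?_) h1
      rw [hn, mul_comm]
    refine ⟨i, ?_, ?_⟩
    · rw [Finset.mem_range]
      have h2 := (ZMod.val_lt a).trans_eq hn
      rw [hi] at h2
      exact Nat.lt_of_mul_lt_mul_left h2
    · rw [← hi, ZMod.natCast_zmod_val]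

end PrimePowerRing

/-! ### Quadratic exponential sums -/

section QuadraticSums

variable {q : ℕ} [NeZero q]

/-- The quadratic exponential sum `∑ e((c b² + l b) / q)` over the units `b` modulo `q`. -/
noncomputable def unitQuadSum (c l : ZMod q) : ℂ :=
  ∑ b : ZMod q with IsUnit b, ZMod.stdAddChar (c * b ^ 2 + l * b)

/-- The pure quadratic Gauss sum modulo `q`. -/
noncomputable def quadSum (c : ZMod q) : ℂ := ∑ b : ZMod q, ZMod.stdAddChar (c * b ^ 2)

theorem sum_stdAddChar_mul (b : ZMod q) :
    ∑ x : ZMod q, (ZMod.stdAddChar (x * b) : ℂ) = if b = 0 then (q : ℂ) else 0 := by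
  rw [AddChar.sum_mulShift b (ZMod.isPrimitive_stdAddChar q), ZMod.card]
  split_ifs <;> simp

/-- As `c s² = 0`, the translation `b ↦ b + s d` multiplies the summand by a character of `d` with
frequency `2csb + ls`. Averaging over `d` kills every `b`, so a sum without stationary points
vanishes. -/
theorem sum_quad_eq_zero_of_shift {c l s : ZMod q} (U : ZMod q → Prop) [DecidablePred U]
    (hU : ∀ b d, U (b + s * d) ↔ U b) (hs : c * s ^ 2 = 0)
    (h : ∀ b, U b → 2 * c * s * b + l * s ≠ 0) :
    ∑ b : ZMod q with U b, (ZMod.stdAddChar (c * b ^ 2 + l * b) : ℂ) = 0 := by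
  have key : ∀ d : ZMod q, ∑ b : ZMod q with U b, (ZMod.stdAddChar (c * b ^ 2 + l * b) : ℂ) =
      ∑ b : ZMod q with U b, (ZMod.stdAddChar (c * b ^ 2 + l * b) : ℂ) *
        ZMod.stdAddChar (d * (2 * c * s * b + l * s)) := by
    intro d
    symm
    refine Finset.sum_bij (fun b _ => b + s * d) ?_ ?_ ?_ ?_
    · intro b hb
      rw [Finset.mem_filter] at hb ⊢
      exact ⟨Finset.mem_univ _, (hU b d).2 hb.2⟩
    · intro b _ b' _ e
      exact add_right_cancel e
    · intro b hb
      rw [Finset.mem_filter] at hb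
      refine ⟨b - s * d, ?_, by ring⟩
      rw [Finset.mem_filter]
      refine ⟨Finset.mem_univ _, (hU _ d).1 ?_⟩
      rw [sub_add_cancel]; exact hb.2
    · intro b _
      rw [← AddChar.map_add_eq_mul]
      congr 1
      linear_combination (-d ^ 2) * hs
  have h2 : (q : ℂ) * ∑ b : ZMod q with U b, (ZMod.stdAddChar (c * b ^ 2 + l * b) : ℂ) = 0 := by
    have e : (q : ℂ) = ∑ _d : ZMod q, (1 : ℂ) := by simp [ZMod.card]
    rw [e, Finset.sum_mul]
    simp_rw [one_mul]
    rw [Finset.sum_congr rfl fun d _ => key d, Finset.sum_comm]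
    apply Finset.sum_eq_zero
    intro b hb
    rw [Finset.mem_filter] at hb
    rw [← Finset.mul_sum, sum_stdAddChar_mul, if_neg (h b hb.2), mul_zero]
  exact (mul_eq_zero.1 h2).resolve_left (by exact_mod_cast NeZero.ne q)

theorem sum_quad_eq {c l m : ZMod q} (h : 2 * c * m = l) :
    ∑ b : ZMod q, (ZMod.stdAddChar (c * b ^ 2 + l * b) : ℂ) =
      ZMod.stdAddChar (-(c * m ^ 2)) * quadSum c := by
  rw [quadSum, Finset.mul_sum]
  refine Fintype.sum_equiv (Equiv.addRight m) _ _ fun b => ?_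
  rw [← AddChar.map_add_eq_mul, Equiv.coe_addRight]
  congr 1
  linear_combination (-b) * h

/-- Weyl differencing: in `|G|²`, put `x = b + h`; the sum over `b` is a complete linear sum that
detects `2ch = 0`. -/
theorem norm_quadSum_sq_le (c : ZMod q) :
    ‖quadSum c‖ ^ 2 ≤ q * (Finset.univ.filter fun h : ZMod q => 2 * c * h = 0).card := by
  have e : ((‖quadSum c‖ ^ 2 : ℝ) : ℂ) = ∑ h : ZMod q,
      ZMod.stdAddChar (c * h ^ 2) * (if 2 * c * h = 0 then (q : ℂ) else 0) := by
    push_cast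
    rw [← Complex.mul_conj', quadSum, map_sum, Finset.sum_mul_sum, Finset.sum_comm]
    simp_rw [← sum_stdAddChar_mul, Finset.mul_sum]
    conv_rhs => rw [Finset.sum_comm]
    refine Finset.sum_congr rfl fun b _ => ?_
    refine Fintype.sum_equiv (Equiv.subRight b) _ _ fun x => ?_
    rw [← AddChar.map_neg_eq_conj, ← AddChar.map_add_eq_mul, ← AddChar.map_add_eq_mul,
      Equiv.subRight_apply]
    congr 1
    ring
  have h1 : ‖quadSum c‖ ^ 2 = ‖((‖quadSum c‖ ^ 2 : ℝ) : ℂ)‖ := by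
    rw [Complex.norm_real, Real.norm_of_nonneg (by positivity)]
  rw [h1, e]
  refine (norm_sum_le _ _).trans ?_
  simp_rw [norm_mul, AddChar.norm_apply, one_mul]
  have h2 : ∀ h : ZMod q, ‖(if 2 * c * h = 0 then (q : ℂ) else 0)‖ =
      if 2 * c * h = 0 then (q : ℝ) else 0 := by
    intro h; split_ifs <;> simp
  simp_rw [h2]
  rw [← Finset.sum_filter, Finset.sum_const, nsmul_eq_mul, mul_comm]

theorem quadSum_mul_sq {c w : ZMod q} (hw : IsUnit w) : quadSum (c * w ^ 2) = quadSum c := by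
  obtain ⟨w, rfl⟩ := hw
  refine Fintype.sum_equiv (Units.mulLeft w) _ _ fun b => ?_
  rw [Units.mulLeft_apply]
  congr 1
  ring

end QuadraticSums

/-! ### Quadratic sums over units modulo a prime power -/

section PrimePowerSums

variable {p : ℕ} [Fact p.Prime] {n : ℕ}

theorem isUnit_two_zmod_prime_pow (hp2 : p ≠ 2) : IsUnit (2 : ZMod (p ^ n)) := by
  have h : ¬ p ∣ 2 := fun h => hp2 ((Nat.prime_dvd_prime_iff_eq Fact.out Nat.prime_two).1 h)
  have := isUnit_natCast_of_not_dvd (n := n) h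
  simpa using this

/-- Shift by `p^(n-1-min(j,k))`: the frequency becomes `p^(n-1)` times a unit, because the term of
higher valuation dies. The gap `k + 2 ≤ n` keeps the shift divisible by `p`, so it preserves units.
-/
theorem unitQuadSum_eq_zero_of_ne (hp2 : p ≠ 2) {j k : ℕ} (hk : k + 2 ≤ n) (hjk : j ≠ k)
    {u l : ZMod (p ^ n)} (hu : IsUnit u) (hl : IsUnit l) :
    unitQuadSum ((p : ZMod (p ^ n)) ^ j * u) ((p : ZMod (p ^ n)) ^ k * l) = 0 := by
  have h2 := isUnit_two_zmod_prime_pow (n := n) hp2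
  rcases lt_or_gt_of_ne hjk with h | h
  · refine sum_quad_eq_zero_of_shift (s := (p : ZMod (p ^ n)) ^ (n - 1 - j)) _
      (fun b d => isUnit_add_prime_pow_mul_iff (by omega)) ?_ ?_
    · have e : (p : ZMod (p ^ n)) ^ j * u * ((p : ZMod (p ^ n)) ^ (n - 1 - j)) ^ 2 =
          (p : ZMod (p ^ n)) ^ (j + (n - 1 - j) * 2) * u := by ring
      rw [e, zmod_prime_pow_eq_zero_iff.2 (by omega), zero_mul]
    · intro b hb h0
      have e1 : (p : ZMod (p ^ n)) ^ (n - 1 - j + k) = 0 :=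
        zmod_prime_pow_eq_zero_iff.2 (by omega)
      have e2 : (p : ZMod (p ^ n)) ^ (j + (n - 1 - j)) * (2 * u * b) = 0 := by
        linear_combination h0 - l * e1
      rw [zmod_prime_pow_mul_unit_eq_zero_iff ((h2.mul hu).mul hb)] at e2
      omega
  · refine sum_quad_eq_zero_of_shift (s := (p : ZMod (p ^ n)) ^ (n - 1 - k)) _
      (fun b d => isUnit_add_prime_pow_mul_iff (by omega)) ?_ ?_
    · have e : (p : ZMod (p ^ n)) ^ j * u * ((p : ZMod (p ^ n)) ^ (n - 1 - k)) ^ 2 =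
          (p : ZMod (p ^ n)) ^ (j + (n - 1 - k) * 2) * u := by ring
      rw [e, zmod_prime_pow_eq_zero_iff.2 (by omega), zero_mul]
    · intro b _ h0
      have e1 : (p : ZMod (p ^ n)) ^ (n - 1 - k + j) = 0 :=
        zmod_prime_pow_eq_zero_iff.2 (by omega)
      have e2 : (p : ZMod (p ^ n)) ^ (k + (n - 1 - k)) * l = 0 := by
        linear_combination h0 - 2 * u * b * e1
      rw [zmod_prime_pow_mul_unit_eq_zero_iff hl] at e2
      omega

/-- The stationary point `-l/(2u)` modulo `p` is not a unit, so none lies in the range of summation.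
-/
theorem unitQuadSum_eq_zero_of_not_isUnit (hp2 : p ≠ 2) {k : ℕ} (hk : k + 2 ≤ n)
    {u l : ZMod (p ^ n)} (hu : IsUnit u) (hl : ¬ IsUnit l) :
    unitQuadSum ((p : ZMod (p ^ n)) ^ k * u) ((p : ZMod (p ^ n)) ^ k * l) = 0 := by
  have h2 := isUnit_two_zmod_prime_pow (n := n) hp2
  obtain ⟨m, rfl⟩ := exists_eq_prime_mul_of_not_isUnit hl
  refine sum_quad_eq_zero_of_shift (s := (p : ZMod (p ^ n)) ^ (n - 1 - k)) _
      (fun b d => isUnit_add_prime_pow_mul_iff (by omega)) ?_ ?_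
  · have e : (p : ZMod (p ^ n)) ^ k * u * ((p : ZMod (p ^ n)) ^ (n - 1 - k)) ^ 2 =
        (p : ZMod (p ^ n)) ^ (k + (n - 1 - k) * 2) * u := by ring
    rw [e, zmod_prime_pow_eq_zero_iff.2 (by omega), zero_mul]
  · intro b hb h0
    have e1 : (p : ZMod (p ^ n)) ^ (n - 1 - k + k + 1) = 0 :=
      zmod_prime_pow_eq_zero_iff.2 (by omega)
    have e2 : (p : ZMod (p ^ n)) ^ (k + (n - 1 - k)) * (2 * u * b) = 0 := by
      linear_combination h0 - m * e1
    rw [zmod_prime_pow_mul_unit_eq_zero_iff ((h2.mul hu).mul hb)] at e2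
    omega

/-- The stationary point is now a unit, so the non-units added to complete the sum contribute
nothing. -/
theorem unitQuadSum_eq_sum {k : ℕ} (hk : k + 2 ≤ n) {u l : ZMod (p ^ n)} (hl : IsUnit l) :
    unitQuadSum ((p : ZMod (p ^ n)) ^ k * u) ((p : ZMod (p ^ n)) ^ k * l) =
      ∑ b : ZMod (p ^ n), (ZMod.stdAddChar
        ((p : ZMod (p ^ n)) ^ k * u * b ^ 2 + (p : ZMod (p ^ n)) ^ k * l * b) : ℂ) := by
  rw [← Finset.sum_filter_add_sum_filter_not _ (fun b => IsUnit b), unitQuadSum, left_eq_add]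
  refine sum_quad_eq_zero_of_shift (s := (p : ZMod (p ^ n)) ^ (n - 1 - k)) _
      (fun b d => not_congr (isUnit_add_prime_pow_mul_iff (by omega))) ?_ ?_
  · have e : (p : ZMod (p ^ n)) ^ k * u * ((p : ZMod (p ^ n)) ^ (n - 1 - k)) ^ 2 =
        (p : ZMod (p ^ n)) ^ (k + (n - 1 - k) * 2) * u := by ring
    rw [e, zmod_prime_pow_eq_zero_iff.2 (by omega), zero_mul]
  · intro b hb h0
    obtain ⟨m, rfl⟩ := exists_eq_prime_mul_of_not_isUnit hb
    have e1 : (p : ZMod (p ^ n)) ^ (k + (n - 1 - k) + 1) = 0 :=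
      zmod_prime_pow_eq_zero_iff.2 (by omega)
    have e2 : (p : ZMod (p ^ n)) ^ (k + (n - 1 - k)) * l = 0 := by
      linear_combination h0 - 2 * u * m * e1
    rw [zmod_prime_pow_mul_unit_eq_zero_iff hl] at e2
    omega

theorem unitQuadSum_eq_gauss {k : ℕ} (hk : k + 2 ≤ n) {u l m : ZMod (p ^ n)}
    (hl : IsUnit l) (hm : 2 * u * m = l) :
    unitQuadSum ((p : ZMod (p ^ n)) ^ k * u) ((p : ZMod (p ^ n)) ^ k * l) =
      ZMod.stdAddChar (-((p : ZMod (p ^ n)) ^ k * u * m ^ 2)) *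
        quadSum ((p : ZMod (p ^ n)) ^ k * u) := by
  rw [unitQuadSum_eq_sum hk hl, sum_quad_eq]
  rw [← hm]; ring

theorem norm_quadSum_le (hp2 : p ≠ 2) {k : ℕ} (hk : k ≤ n) {u : ZMod (p ^ n)} (hu : IsUnit u) :
    ‖quadSum ((p : ZMod (p ^ n)) ^ k * u)‖ ≤ √((p : ℝ) ^ n * (p : ℝ) ^ k) := by
  apply Real.le_sqrt_of_sq_le
  refine (norm_quadSum_sq_le _).trans_eq ?_
  have h2 := isUnit_two_zmod_prime_pow (n := n) hp2
  have e : (Finset.univ.filter fun h : ZMod (p ^ n) =>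
      2 * ((p : ZMod (p ^ n)) ^ k * u) * h = 0) =
      Finset.univ.filter fun h : ZMod (p ^ n) => (p : ZMod (p ^ n)) ^ k * h = 0 := by
    ext h
    simp only [Finset.mem_filter, Finset.mem_univ, true_and]
    rw [show 2 * ((p : ZMod (p ^ n)) ^ k * u) * h = (2 * u) * ((p : ZMod (p ^ n)) ^ k * h) by ring,
      (h2.mul hu).mul_right_eq_zero]
  rw [e, card_prime_pow_mul_eq_zero hk]
  push_cast
  ring

end PrimePowerSums

/-! ### Exponential sums over the cone -/

section ConeSums

/-- The zeros modulo `q`, with unit coordinates, of a ternary diagonal form. -/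
def unitZeros (q : ℕ) [NeZero q] (a : ℤ × ℤ × ℤ) : Finset (ZMod q × ZMod q × ZMod q) :=
  {b | (IsUnit b.1 ∧ IsUnit b.2.1 ∧ IsUnit b.2.2) ∧
    (a.1 : ZMod q) * b.1 ^ 2 + (a.2.1 : ZMod q) * b.2.1 ^ 2 + (a.2.2 : ZMod q) * b.2.2 ^ 2 = 0}

/-- The exponential sum of a linear form over `unitZeros`. -/
noncomputable def coneSum (q : ℕ) [NeZero q] (a l : ℤ × ℤ × ℤ) : ℂ :=
  ∑ b ∈ unitZeros q a, ZMod.stdAddChar ((l.1 : ZMod q) * b.1 + (l.2.1 : ZMod q) * b.2.1 + (l.2.2 : ZMod q) * b.2.2)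

/-- The product of the three unit quadratic sums attached to the multiplier `t`. -/
noncomputable def prodSum (q : ℕ) [NeZero q] (a l : ℤ × ℤ × ℤ) (t : ZMod q) : ℂ :=
  unitQuadSum (t * (a.1 : ZMod q)) (l.1 : ZMod q) * unitQuadSum (t * (a.2.1 : ZMod q)) (l.2.1 : ZMod q) *
    unitQuadSum (t * (a.2.2 : ZMod q)) (l.2.2 : ZMod q)

theorem prodSum_eq_sum (q : ℕ) [NeZero q] (a l : ℤ × ℤ × ℤ) (t : ZMod q) :
    prodSum q a l t =
      ∑ b : ZMod q × ZMod q × ZMod q with (IsUnit b.1 ∧ IsUnit b.2.1 ∧ IsUnit b.2.2),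
        (ZMod.stdAddChar ((l.1 : ZMod q) * b.1 + (l.2.1 : ZMod q) * b.2.1 + (l.2.2 : ZMod q) * b.2.2) : ℂ) *
        ZMod.stdAddChar (t * ((a.1 : ZMod q) * b.1 ^ 2 + (a.2.1 : ZMod q) * b.2.1 ^ 2 +
          (a.2.2 : ZMod q) * b.2.2 ^ 2)) := by
  have hs : (Finset.univ.filter fun b : ZMod q × ZMod q × ZMod q =>
      (IsUnit b.1 ∧ IsUnit b.2.1 ∧ IsUnit b.2.2)) =
      (Finset.univ.filter fun b : ZMod q => IsUnit b) ×ˢ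
        (Finset.univ.filter fun b : ZMod q => IsUnit b) ×ˢ
        (Finset.univ.filter fun b : ZMod q => IsUnit b) := by
    ext b; simp
  rw [hs, Finset.sum_product, prodSum, mul_assoc, unitQuadSum, Finset.sum_mul]
  refine Finset.sum_congr rfl fun b1 _ => ?_
  rw [Finset.sum_product, unitQuadSum, unitQuadSum, Finset.sum_mul_sum, Finset.mul_sum]
  refine Finset.sum_congr rfl fun b2 _ => ?_
  rw [Finset.mul_sum]
  refine Finset.sum_congr rfl fun b3 _ => ?_
  rw [← AddChar.map_add_eq_mul, ← AddChar.map_add_eq_mul, ← AddChar.map_add_eq_mul]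
  congr 1
  simp only
  ring

/-- The equation of the cone is detected by summing an additive character over the multiplier `t`.
-/
theorem card_mul_coneSum (q : ℕ) [NeZero q] (a l : ℤ × ℤ × ℤ) :
    (q : ℂ) * coneSum q a l = ∑ t : ZMod q, prodSum q a l t := by
  simp_rw [prodSum_eq_sum]
  rw [Finset.sum_comm]
  simp_rw [← Finset.mul_sum, sum_stdAddChar_mul]
  rw [coneSum, unitZeros, ← Finset.filter_filter, Finset.mul_sum, Finset.sum_filter]
  refine Finset.sum_congr rfl fun b _ => ?_
  split_ifs <;> ring

variable {p : ℕ} [Fact p.Prime] {n : ℕ}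

/-- The multipliers contributing to `coneSum` have the same valuation as the frequency. -/
theorem prodSum_ne_zero (hp2 : p ≠ 2) {k : ℕ} (hk : k + 2 ≤ n) {a l : ℤ × ℤ × ℤ}
    (ha : UnitCoords p a)
    (hl : ¬ (p : ℤ) ∣ l.1 ∨ ¬ (p : ℤ) ∣ l.2.1 ∨ ¬ (p : ℤ) ∣ l.2.2) {t : ZMod (p ^ n)}
    (h : prodSum (p ^ n) a ((p : ℤ) ^ k * l.1, (p : ℤ) ^ k * l.2.1, (p : ℤ) ^ k * l.2.2) t ≠ 0) :
    UnitCoords p l ∧ ∃ u, IsUnit u ∧ t = (p : ZMod (p ^ n)) ^ k * u := by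
  have hpr := Nat.prime_iff_prime_int.1 (Fact.out : p.Prime)
  have hn : n ≠ 0 := by omega
  have hcast : ∀ m : ℤ, IsUnit (m : ZMod (p ^ n)) ↔ ¬ (p : ℤ) ∣ m := by
    intro m
    rw [ZMod.coe_int_isUnit_iff_isCoprime]
    push_cast
    rw [IsCoprime.pow_left_iff (by omega), hpr.coprime_iff_not_dvd]
  obtain ⟨j, hj, u, hu, rfl⟩ := exists_eq_prime_pow_mul_unit t
  have u1 := hu.mul ((hcast a.1).2 ha.1)
  have u2 := hu.mul ((hcast a.2.1).2 ha.2.1)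
  have u3 := hu.mul ((hcast a.2.2).2 ha.2.2)
  simp only [prodSum] at h
  push_cast at h
  rw [mul_assoc _ u, mul_assoc _ u, mul_assoc _ u] at h
  obtain ⟨h12, h3⟩ := mul_ne_zero_iff.1 h
  obtain ⟨h1, h2⟩ := mul_ne_zero_iff.1 h12
  have hjk : j = k := by
    by_contra hjk
    rcases hl with hl | hl | hl
    · exact h1 (unitQuadSum_eq_zero_of_ne hp2 hk hjk u1 ((hcast _).2 hl))
    · exact h2 (unitQuadSum_eq_zero_of_ne hp2 hk hjk u2 ((hcast _).2 hl))
    · exact h3 (unitQuadSum_eq_zero_of_ne hp2 hk hjk u3 ((hcast _).2 hl))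
  subst hjk
  refine ⟨⟨?_, ?_, ?_⟩, u, hu, rfl⟩
  · intro hd
    exact h1 (unitQuadSum_eq_zero_of_not_isUnit hp2 hk u1 (by rw [hcast]; exact not_not.2 hd))
  · intro hd
    exact h2 (unitQuadSum_eq_zero_of_not_isUnit hp2 hk u2 (by rw [hcast]; exact not_not.2 hd))
  · intro hd
    exact h3 (unitQuadSum_eq_zero_of_not_isUnit hp2 hk u3 (by rw [hcast]; exact not_not.2 hd))

end ConeSums

section ConeSums

variable {p : ℕ} [Fact p.Prime] {n : ℕ}

theorem isUnit_intCast_iff_not_dvd (hn : n ≠ 0) (m : ℤ) :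
    IsUnit (m : ZMod (p ^ n)) ↔ ¬ (p : ℤ) ∣ m := by
  have hpr := Nat.prime_iff_prime_int.1 (Fact.out : p.Prime)
  rw [ZMod.coe_int_isUnit_iff_isCoprime]
  push_cast
  rw [IsCoprime.pow_left_iff (by omega), hpr.coprime_iff_not_dvd]

/-- Dividing the multiplier by `w²` leaves the Gauss sum unchanged, while the phase from completing
the square is inverse to the coefficient and so is multiplied by `w²`. -/
theorem unitQuadSum_scaled {k : ℕ} (hk : k + 2 ≤ n) {T u U w w' c A : ZMod (p ^ n)}
    (hT : 2 * T = 1) (hU : u * U = 1) (hw : w * w' = 1) (iw' : IsUnit w') (hA : c * A = 1) {m : ℤ}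
    (hm : ¬ (p : ℤ) ∣ m) :
    unitQuadSum ((p : ZMod (p ^ n)) ^ k * u * w' ^ 2 * c) (((p : ℤ) ^ k * m : ℤ) : ZMod (p ^ n))
      = ZMod.stdAddChar ((p : ZMod (p ^ n)) ^ k * -(T ^ 2 * U) * (A * (m : ZMod (p ^ n)) ^ 2) *
          w ^ 2) * quadSum ((p : ZMod (p ^ n)) ^ k * (u * c)) := by
  have hn : n ≠ 0 := by omega
  have e1 : (p : ZMod (p ^ n)) ^ k * u * w' ^ 2 * c =
    (p : ZMod (p ^ n)) ^ k * (u * w' ^ 2 * c) := by ring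
  push_cast
  rw [e1, unitQuadSum_eq_gauss hk ((isUnit_intCast_iff_not_dvd hn m).2 hm)
    (m := T * U * A * w ^ 2 * (m : ZMod (p ^ n)))]
  · congr 1
    · congr 1
      have e2 : u * w' ^ 2 * c * (T * U * A * w ^ 2 * (m : ZMod (p ^ n))) ^ 2 =
          T ^ 2 * U * (A * (m : ZMod (p ^ n)) ^ 2) * w ^ 2 := by
        have : u * w' ^ 2 * c * (T * U * A * w ^ 2 * (m : ZMod (p ^ n))) ^ 2 =
          (u * U) * (w * w') ^ 2 * (c * A) * (T ^ 2 * U * (A * (m : ZMod (p ^ n)) ^ 2) * w ^ 2) :=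
          by ring
        rw [this, hU, hw, hA]; ring
      linear_combination (-(p : ZMod (p ^ n)) ^ k) * e2
    · have e3 : (p : ZMod (p ^ n)) ^ k * (u * w' ^ 2 * c) =
        (p : ZMod (p ^ n)) ^ k * (u * c) * w' ^ 2 := by ring
      rw [e3, quadSum_mul_sq iw']
  · have : 2 * (u * w' ^ 2 * c) * (T * U * A * w ^ 2 * (m : ZMod (p ^ n))) =
      (2 * T) * (u * U) * (c * A) * (w * w') ^ 2 * (m : ZMod (p ^ n)) := by ring
    rw [this, hT, hU, hA, hw]; ring

/-- The common phase of the three Gauss sums. -/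
theorem exists_prodSum_eq (hp2 : p ≠ 2) {k : ℕ} (hk : k + 2 ≤ n) {a l : ℤ × ℤ × ℤ}
    (ha : UnitCoords p a) (hl : UnitCoords p l) {u : ZMod (p ^ n)} (hu : IsUnit u) :
    ∃ v : ZMod (p ^ n), IsUnit v ∧ ∀ w w' : ZMod (p ^ n), w * w' = 1 →
      prodSum (p ^ n) a ((p : ℤ) ^ k * l.1, (p : ℤ) ^ k * l.2.1, (p : ℤ) ^ k * l.2.2)
        ((p : ZMod (p ^ n)) ^ k * u * w' ^ 2) =
      ZMod.stdAddChar ((p : ZMod (p ^ n)) ^ k * v *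
        ((diagForm (adjCoeff a) l : ℤ) : ZMod (p ^ n)) * w ^ 2) *
        (quadSum ((p : ZMod (p ^ n)) ^ k * (u * (a.1 : ZMod (p ^ n)))) *
         quadSum ((p : ZMod (p ^ n)) ^ k * (u * (a.2.1 : ZMod (p ^ n)))) *
         quadSum ((p : ZMod (p ^ n)) ^ k * (u * (a.2.2 : ZMod (p ^ n))))) := by
  have hn : n ≠ 0 := by omega
  have u2 := isUnit_two_zmod_prime_pow (n := n) hp2
  obtain ⟨A1, hA1⟩ := ((isUnit_intCast_iff_not_dvd (p := p) hn _).2 ha.1).exists_right_inv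
  obtain ⟨A2, hA2⟩ := ((isUnit_intCast_iff_not_dvd (p := p) hn _).2 ha.2.1).exists_right_inv
  obtain ⟨A3, hA3⟩ := ((isUnit_intCast_iff_not_dvd (p := p) hn _).2 ha.2.2).exists_right_inv
  obtain ⟨U, hU⟩ := hu.exists_right_inv
  obtain ⟨T, hT⟩ := u2.exists_right_inv
  have iT : IsUnit T := IsUnit.of_mul_eq_one _ ((mul_comm _ _).trans hT)
  have iU : IsUnit U := IsUnit.of_mul_eq_one _ ((mul_comm _ _).trans hU)
  have iA1 : IsUnit A1 := IsUnit.of_mul_eq_one _ ((mul_comm _ _).trans hA1)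
  have iA2 : IsUnit A2 := IsUnit.of_mul_eq_one _ ((mul_comm _ _).trans hA2)
  have iA3 : IsUnit A3 := IsUnit.of_mul_eq_one _ ((mul_comm _ _).trans hA3)
  refine ⟨-(T ^ 2 * U * A1 * A2 * A3), ((((((iT.pow 2).mul iU).mul iA1).mul iA2).mul iA3)).neg,
    ?_⟩
  intro w w' hw
  have iw' : IsUnit w' := IsUnit.of_mul_eq_one _ ((mul_comm _ _).trans hw)
  rw [prodSum, unitQuadSum_scaled hk hT hU hw iw' hA1 hl.1,
    unitQuadSum_scaled hk hT hU hw iw' hA2 hl.2.1, unitQuadSum_scaled hk hT hU hw iw' hA3 hl.2.2]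
  have e4 : ∀ x y z g1 g2 g3 : ℂ, x * g1 * (y * g2) * (z * g3) = x * y * z * (g1 * g2 * g3) := by
    intros; ring
  rw [e4, ← AddChar.map_add_eq_mul, ← AddChar.map_add_eq_mul]
  congr 2
  simp only [diagForm, adjCoeff]
  push_cast
  generalize (a.1 : ZMod (p ^ n)) = a1 at *
  generalize (a.2.1 : ZMod (p ^ n)) = a2 at *
  generalize (a.2.2 : ZMod (p ^ n)) = a3 at *
  generalize (l.1 : ZMod (p ^ n)) = l1 at *
  generalize (l.2.1 : ZMod (p ^ n)) = l2 at *
  generalize (l.2.2 : ZMod (p ^ n)) = l3 at *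
  -- The three phases add up to a unit times `Σ lᵢ²/aᵢ`, which is the adjugate form divided by
  -- `a₁a₂a₃`.
  have f1 : A1 * A2 * A3 * (a2 * a3 * l1 ^ 2 + a1 * a3 * l2 ^ 2 + a1 * a2 * l3 ^ 2) =
      A1 * l1 ^ 2 + A2 * l2 ^ 2 + A3 * l3 ^ 2 := by
    have : A1 * A2 * A3 * (a2 * a3 * l1 ^ 2 + a1 * a3 * l2 ^ 2 + a1 * a2 * l3 ^ 2) =
      (a2 * A2) * (a3 * A3) * (A1 * l1 ^ 2) + (a1 * A1) * (a3 * A3) * (A2 * l2 ^ 2) +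
        (a1 * A1) * (a2 * A2) * (A3 * l3 ^ 2) := by ring
    rw [this, hA1, hA2, hA3]; ring
  linear_combination ((p : ZMod (p ^ n)) ^ k * T ^ 2 * U * w ^ 2) * f1

/-- Only multipliers killed by `p^(n-k)` survive, at most `p^(n-k)` of them, and each contributes
three Gauss sums of size at most `√(p^n p^k)`. -/
theorem norm_coneSum_le (hp2 : p ≠ 2) {k : ℕ} (hk : k + 2 ≤ n) {a l : ℤ × ℤ × ℤ}
    (ha : UnitCoords p a)
    (hl : ¬ (p : ℤ) ∣ l.1 ∨ ¬ (p : ℤ) ∣ l.2.1 ∨ ¬ (p : ℤ) ∣ l.2.2) :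
    (p : ℝ) ^ k *
      ‖coneSum (p ^ n) a ((p : ℤ) ^ k * l.1, (p : ℤ) ^ k * l.2.1, (p : ℤ) ^ k * l.2.2)‖ ≤
      √((p : ℝ) ^ n * (p : ℝ) ^ k) ^ 3 := by
  have hn : n ≠ 0 := by omega
  set L : ℤ × ℤ × ℤ := ((p : ℤ) ^ k * l.1, (p : ℤ) ^ k * l.2.1, (p : ℤ) ^ k * l.2.2) with hL
  set s := √((p : ℝ) ^ n * (p : ℝ) ^ k) with hs
  have hp0 : 0 < p := (Fact.out : p.Prime).pos
  have hterm : ∀ t : ZMod (p ^ n), ‖prodSum (p ^ n) a L t‖ ≤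
      if (p : ZMod (p ^ n)) ^ (n - k) * t = 0 then s ^ 3 else 0 := by
    intro t
    by_cases h0 : prodSum (p ^ n) a L t = 0
    · rw [h0, norm_zero]; split_ifs <;> positivity
    obtain ⟨hu, u, iu, rfl⟩ := prodSum_ne_zero hp2 hk ha hl h0
    rw [if_pos]
    · obtain ⟨v, -, hv⟩ := exists_prodSum_eq hp2 hk ha hu iu
      have := hv 1 1 (one_mul 1)
      rw [one_pow, mul_one, mul_one] at this
      rw [this, norm_mul, AddChar.norm_apply, one_mul, norm_mul, norm_mul, pow_three', hs]
      gcongr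
      · exact norm_quadSum_le hp2 (by omega) (iu.mul ((isUnit_intCast_iff_not_dvd hn _).2 ha.1))
      · exact norm_quadSum_le hp2 (by omega) (iu.mul ((isUnit_intCast_iff_not_dvd hn _).2 ha.2.1))
      · exact norm_quadSum_le hp2 (by omega) (iu.mul ((isUnit_intCast_iff_not_dvd hn _).2 ha.2.2))
    · rw [← mul_assoc, ← pow_add, zmod_prime_pow_eq_zero_iff.2 (by omega), zero_mul]
  have h1 : (p : ℝ) ^ n * ‖coneSum (p ^ n) a L‖ ≤ (p : ℝ) ^ (n - k) * s ^ 3 := by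
    calc (p : ℝ) ^ n * ‖coneSum (p ^ n) a L‖ = ‖((p ^ n : ℕ) : ℂ) * coneSum (p ^ n) a L‖ := by
          rw [norm_mul, Complex.norm_natCast]; push_cast; rfl
      _ ≤ ∑ t : ZMod (p ^ n), if (p : ZMod (p ^ n)) ^ (n - k) * t = 0 then s ^ 3 else 0 := by
          rw [card_mul_coneSum]
          exact (norm_sum_le _ _).trans (Finset.sum_le_sum fun t _ => hterm t)
      _ = _ := by
          rw [← Finset.sum_filter, Finset.sum_const, card_prime_pow_mul_eq_zero (by omega),
            nsmul_eq_mul]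
          push_cast; rfl
  have h2 : (p : ℝ) ^ n = (p : ℝ) ^ (n - k) * (p : ℝ) ^ k := by
    rw [← pow_add, Nat.sub_add_cancel (by omega)]
  rw [h2, mul_assoc] at h1
  exact le_of_mul_le_mul_left h1 (by positivity)

/-- Average over multipliers `t w⁻²` with `w = 1 + p^s d`. The Gauss sums stay fixed and the common
phase becomes a linear character of `d`, nontrivial when the adjugate form has valuation below `n -
1 - k`. -/
theorem unitCoords_and_dvd_of_coneSum_ne_zero (hp2 : p ≠ 2) {k : ℕ} (hk : k + 2 ≤ n)
    {a l : ℤ × ℤ × ℤ} (ha : UnitCoords p a)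
    (hl : ¬ (p : ℤ) ∣ l.1 ∨ ¬ (p : ℤ) ∣ l.2.1 ∨ ¬ (p : ℤ) ∣ l.2.2)
    (h : coneSum (p ^ n) a ((p : ℤ) ^ k * l.1, (p : ℤ) ^ k * l.2.1, (p : ℤ) ^ k * l.2.2) ≠ 0) :
    UnitCoords p l ∧ (p : ℤ) ^ (n - 1 - k) ∣ diagForm (adjCoeff a) l := by
  have hn : n ≠ 0 := by omega
  have hp0 : 0 < p := (Fact.out : p.Prime).pos
  have hpr := Nat.prime_iff_prime_int.1 (Fact.out : p.Prime)
  set L : ℤ × ℤ × ℤ := ((p : ℤ) ^ k * l.1, (p : ℤ) ^ k * l.2.1, (p : ℤ) ^ k * l.2.2) with hL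
  have hq0 : ((p ^ n : ℕ) : ℂ) ≠ 0 := by exact_mod_cast (pow_pos hp0 n).ne'
  have hsum : ∑ t : ZMod (p ^ n), prodSum (p ^ n) a L t ≠ 0 := by
    rw [← card_mul_coneSum]
    exact mul_ne_zero hq0 h
  have hlu : UnitCoords p l := by
    obtain ⟨t, -, ht⟩ := Finset.exists_ne_zero_of_sum_ne_zero hsum
    exact (prodSum_ne_zero hp2 hk ha hl ht).1
  refine ⟨hlu, ?_⟩
  by_contra hnd
  apply hsum
  set D := diagForm (adjCoeff a) l with hD
  obtain ⟨v, D', hD', hvk, e⟩ : ∃ (v : ℕ) (D' : ℤ), ¬ (p : ℤ) ∣ D' ∧ v < n - 1 - k ∧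
      D = (p : ℤ) ^ v * D' := by
    have hfin : FiniteMultiplicity (p : ℤ) D := by
      by_contra hinf
      exact hnd (FiniteMultiplicity.not_iff_forall.1 hinf _)
    obtain ⟨D', h1, h2⟩ := hfin.exists_eq_pow_mul_and_not_dvd
    refine ⟨_, D', h2, ?_, h1⟩
    by_contra! hle
    exact hnd ((pow_dvd_pow _ hle).trans ⟨D', h1⟩)
  -- Chosen so that `k + v + s = n - 1`: the linear term in `d` has frequency `p^(n-1)` times a
  -- unit, and the quadratic term vanishes because `s ≥ 1`.
  set s := n - 1 - k - v with hs
  have hs1 : 0 < s := by omega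
  set P : ZMod (p ^ n) := (p : ZMod (p ^ n)) with hP
  have u2 := isUnit_two_zmod_prime_pow (n := n) hp2
  have hw : ∀ d : ZMod (p ^ n), ∃ w', (1 + P ^ s * d) * w' = 1 := fun d =>
    ((isUnit_add_prime_pow_mul_iff hs1).2 isUnit_one).exists_right_inv
  choose W hW using hw
  have iW : ∀ d, IsUnit (W d) := fun d => IsUnit.of_mul_eq_one _ ((mul_comm _ _).trans (hW d))
  have hshift : ∀ d : ZMod (p ^ n), ∑ t : ZMod (p ^ n), prodSum (p ^ n) a L t =
      ∑ t : ZMod (p ^ n), prodSum (p ^ n) a L (t * W d ^ 2) := by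
    intro d
    symm
    refine Fintype.sum_equiv (Units.mulRight ((iW d).unit ^ 2)) _ _ fun t => ?_
    simp
  have hinner : ∀ t : ZMod (p ^ n),
      ∑ d : ZMod (p ^ n), prodSum (p ^ n) a L (t * W d ^ 2) = 0 := by
    intro t
    by_cases hall : ∀ d, prodSum (p ^ n) a L (t * W d ^ 2) = 0
    · exact Finset.sum_eq_zero fun d _ => hall d
    push Not at hall
    obtain ⟨d0, hd0⟩ := hall
    obtain ⟨-, u, iu, hu⟩ := prodSum_ne_zero hp2 hk ha hl hd0
    have ht : t = P ^ k * (u * (1 + P ^ s * d0) ^ 2) := by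
      have : t = t * W d0 ^ 2 * (1 + P ^ s * d0) ^ 2 := by
        have e2 := hW d0
        have : t * W d0 ^ 2 * (1 + P ^ s * d0) ^ 2 = t * ((1 + P ^ s * d0) * W d0) ^ 2 := by ring
        rw [this, e2]; ring
      rw [this, hu]; ring
    have iu' : IsUnit (u * (1 + P ^ s * d0) ^ 2) :=
      iu.mul (((isUnit_add_prime_pow_mul_iff hs1).2 isUnit_one).pow 2)
    obtain ⟨c, ic, hc⟩ := exists_prodSum_eq hp2 hk ha hlu iu'
    rw [ht]
    refine (Finset.sum_congr rfl fun d _ => hc _ _ (hW d)).trans ?_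
    rw [← Finset.sum_mul]
    convert zero_mul _
    have e3 : ∀ d : ZMod (p ^ n), (ZMod.stdAddChar 
        (P ^ k * c * ((D : ℤ) : ZMod (p ^ n)) * (1 + P ^ s * d) ^ 2) : ℂ) =
        ZMod.stdAddChar (P ^ k * c * ((D : ℤ) : ZMod (p ^ n))) *
          ZMod.stdAddChar (d * (P ^ (n - 1) * (2 * c * ((D' : ℤ) : ZMod (p ^ n))))) := by
      intro d
      rw [← AddChar.map_add_eq_mul]
      congr 1
      have hDc : ((D : ℤ) : ZMod (p ^ n)) = P ^ v * ((D' : ℤ) : ZMod (p ^ n)) := by rw [e]; push_cast; rfl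
      rw [hDc]
      have e4 : P ^ (n - 1) = P ^ (k + v + s) := by congr 1; omega
      have e5 : P ^ (k + v + s * 2) = 0 := zmod_prime_pow_eq_zero_iff.2 (by omega)
      rw [e4]
      linear_combination (c * (D' : ZMod (p ^ n)) * d ^ 2) * e5
    refine (Finset.sum_congr rfl fun d _ => e3 d).trans ?_
    rw [← Finset.mul_sum, sum_stdAddChar_mul, if_neg, mul_zero]
    rw [zmod_prime_pow_mul_unit_eq_zero_iff
      ((u2.mul ic).mul ((isUnit_intCast_iff_not_dvd hn _).2 hD'))]
    omega
  have h2 : ((p ^ n : ℕ) : ℂ) * ∑ t : ZMod (p ^ n), prodSum (p ^ n) a L t = 0 := by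
    have e : ((p ^ n : ℕ) : ℂ) = ∑ _d : ZMod (p ^ n), (1 : ℂ) := by simp [ZMod.card]
    rw [e, Finset.sum_mul]
    simp_rw [one_mul]
    rw [Finset.sum_congr rfl fun d _ => hshift d, Finset.sum_comm]
    exact Finset.sum_eq_zero fun t _ => hinner t
  exact (mul_eq_zero.1 h2).resolve_left hq0

end ConeSums

/-! ### Counting the cone modulo `p` -/

section ConicCount

variable {p : ℕ} [Fact p.Prime]

/-- Expand the product: the linear sums vanish, the Jacobi sum of the quadratic character with
itself is `-χ(-1)`, and the terms at `u = 0, 1` are subtracted. -/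
theorem sum_quadraticChar_conic (hp2 : p ≠ 2) (A B : ℤ) :
    ∑ u : ZMod p with u ≠ 0 ∧ u ≠ 1,
      (1 + A * quadraticChar (ZMod p) u) * (1 + B * quadraticChar (ZMod p) (1 - u)) =
      p - 2 - A - B - A * B * quadraticChar (ZMod p) (-1) := by
  have hchar : ringChar (ZMod p) ≠ 2 := by rwa [ZMod.ringChar_zmod_n]
  have hne := quadraticChar_ne_one hchar
  set χ := quadraticChar (ZMod p) with hχ
  have hJ : ∑ u : ZMod p, χ u * χ (1 - u) = -χ (-1) := by
    have h1 := jacobiSum_nontrivial_inv hne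
    have h2 : χ⁻¹ = χ := (quadraticChar_isQuadratic (ZMod p)).inv
    rw [h2] at h1
    exact h1
  have hs1 : ∑ u : ZMod p, χ u = 0 := quadraticChar_sum_zero hchar
  have hs2 : ∑ u : ZMod p, χ (1 - u) = 0 := by
    rw [← hs1]
    exact Fintype.sum_equiv (Equiv.subLeft 1) _ _ fun u => rfl
  have hsplit : ∑ u : ZMod p with u ≠ 0 ∧ u ≠ 1, (1 + A * χ u) * (1 + B * χ (1 - u)) =
      ∑ u : ZMod p, (1 + A * χ u) * (1 + B * χ (1 - u)) - (1 + B) - (1 + A) := by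
    have h01 : (0 : ZMod p) ≠ 1 := zero_ne_one
    have : ∑ u : ZMod p with ¬ (u ≠ 0 ∧ u ≠ 1), (1 + A * χ u) * (1 + B * χ (1 - u)) =
        (1 + B) + (1 + A) := by
      have e : (Finset.univ.filter fun u : ZMod p => ¬ (u ≠ 0 ∧ u ≠ 1)) = {0, 1} := by
        ext u
        simp only [Finset.mem_filter, Finset.mem_univ, true_and, Finset.mem_insert,
          Finset.mem_singleton]
        tauto
      rw [e, Finset.sum_pair h01]
      have h0 : χ 0 = 0 := quadraticChar_zero
      simp [h0]
    rw [← Finset.sum_filter_add_sum_filter_not Finset.univ (fun u : ZMod p => u ≠ 0 ∧ u ≠ 1)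
      (fun u => (1 + A * χ u) * (1 + B * χ (1 - u))), this]
    ring
  have hexp : ∑ u : ZMod p, (1 + A * χ u) * (1 + B * χ (1 - u)) =
      p + A * ∑ u : ZMod p, χ u + B * ∑ u : ZMod p, χ (1 - u) +
        A * B * ∑ u : ZMod p, χ u * χ (1 - u) := by
    have hc : (p : ℤ) = ∑ _u : ZMod p, 1 := by simp [ZMod.card]
    rw [hc, Finset.mul_sum, Finset.mul_sum, Finset.mul_sum, ← Finset.sum_add_distrib,
      ← Finset.sum_add_distrib, ← Finset.sum_add_distrib]
    exact Finset.sum_congr rfl fun u _ => by ring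
  rw [hsplit, hexp, hs1, hs2, hJ]
  ring

/-- Sort the points by `u = -a x²/c`, so that `-b y²/c = 1 - u`. Each coordinate is then a square
root, counted by `1 + χ`. -/
theorem card_affine_conic (hp2 : p ≠ 2) {a b c : ZMod p} (ha : a ≠ 0) (hb : b ≠ 0) (hc : c ≠ 0) :
    ((Finset.univ.filter fun x : ZMod p × ZMod p =>
      (x.1 ≠ 0 ∧ x.2 ≠ 0) ∧ a * x.1 ^ 2 + b * x.2 ^ 2 + c = 0).card : ℤ) =
      p - (2 + quadraticChar (ZMod p) (-(a * b)) + quadraticChar (ZMod p) (-(a * c)) +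
        quadraticChar (ZMod p) (-(b * c))) := by
  have hchar : ringChar (ZMod p) ≠ 2 := by rwa [ZMod.ringChar_zmod_n]
  set χ := quadraticChar (ZMod p) with hχ
  set T := Finset.univ.filter fun x : ZMod p × ZMod p =>
      (x.1 ≠ 0 ∧ x.2 ≠ 0) ∧ a * x.1 ^ 2 + b * x.2 ^ 2 + c = 0 with hT
  have hsq : ∀ d : ZMod p, d ≠ 0 → χ d * χ d = 1 := by
    intro d hd
    have := quadraticChar_sq_one hd
    rwa [sq] at this
  have hmaps : ∀ x ∈ T, -(a * x.1 ^ 2) / c ∈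
      Finset.univ.filter fun u : ZMod p => u ≠ 0 ∧ u ≠ 1 := by
    intro x hx
    rw [hT, Finset.mem_filter] at hx
    obtain ⟨-, ⟨h1, h2⟩, h3⟩ := hx
    rw [Finset.mem_filter]
    refine ⟨Finset.mem_univ _, ?_, ?_⟩
    · exact div_ne_zero (neg_ne_zero.2 (mul_ne_zero ha (pow_ne_zero _ h1))) hc
    · intro h
      rw [div_eq_one_iff_eq hc] at h
      have : b * x.2 ^ 2 = 0 := by linear_combination h3 + h
      exact mul_ne_zero hb (pow_ne_zero _ h2) this
  have hfib : ∀ u ∈ (Finset.univ.filter fun u : ZMod p => u ≠ 0 ∧ u ≠ 1),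
      ((T.filter fun x => -(a * x.1 ^ 2) / c = u).card : ℤ) =
      (1 + χ (-(a * c)) * χ u) * (1 + χ (-(b * c)) * χ (1 - u)) := by
    intro u hu
    rw [Finset.mem_filter] at hu
    obtain ⟨-, hu0, hu1⟩ := hu
    have hu1' : 1 - u ≠ 0 := sub_ne_zero.2 (Ne.symm hu1)
    have e : (T.filter fun x => -(a * x.1 ^ 2) / c = u) =
        {x : ZMod p | x ^ 2 = -(c * u) / a}.toFinset ×ˢ
          {x : ZMod p | x ^ 2 = -(c * (1 - u)) / b}.toFinset := by
      ext ⟨x, y⟩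
      simp only [hT, Finset.mem_filter, Finset.mem_univ, true_and, Finset.mem_product,
        Set.mem_toFinset, Set.mem_ofPred_eq]
      rw [div_eq_iff hc, eq_div_iff ha, eq_div_iff hb]
      constructor
      · rintro ⟨⟨-, h1⟩, h2⟩
        exact ⟨by linear_combination -h2, by linear_combination h1 + h2⟩
      · rintro ⟨h1, h2⟩
        refine ⟨⟨⟨?_, ?_⟩, by linear_combination h1 + h2⟩, by linear_combination -h1⟩
        · rintro rfl
          apply mul_ne_zero hc hu0
          linear_combination h1
        · rintro rfl
          apply mul_ne_zero hc hu1'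
          linear_combination h2
    have hinv : ∀ d e : ZMod p, d ≠ 0 → χ (-(c * e) / d) = χ (-(d * c)) * χ e := by
      intro d e hd
      have h1 : -(d * c) * e = -(c * e) / d * (d * d) := by
        field_simp
      rw [← map_mul, h1, map_mul, map_mul, hsq d hd, mul_one]
    rw [e, Finset.card_product, Nat.cast_mul, quadraticChar_card_sqrts hchar,
      quadraticChar_card_sqrts hchar, hinv a u ha, hinv b (1 - u) hb]
    ring
  rw [Finset.card_eq_sum_card_fiberwise hmaps, Nat.cast_sum, Finset.sum_congr rfl hfib,
    sum_quadraticChar_conic hp2]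
  have e : χ (-(a * c)) * χ (-(b * c)) * χ (-1) = χ (-(a * b)) := by
    have h1 : -(a * c) * -(b * c) * -1 = -(a * b) * (c * c) := by ring
    rw [← map_mul, ← map_mul, h1, map_mul, map_mul, hsq c hc, mul_one]
  rw [e]
  ring

/-- Dividing by the third coordinate exhibits the cone as `p - 1` copies of the affine conic. -/
theorem card_unitZeros_prime (hp2 : p ≠ 2) {a : ℤ × ℤ × ℤ} (ha : UnitCoords p a) :
    ((unitZeros p a).card : ℤ) = (p - sSym p a.1 a.2.1 a.2.2) * (p - 1) := by
  have hcast : ∀ {m : ℤ}, ¬ (p : ℤ) ∣ m → (m : ZMod p) ≠ 0 := by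
    intro m hm
    rwa [Ne, ZMod.intCast_zmod_eq_zero_iff_dvd]
  have h := card_affine_conic hp2 (hcast ha.1) (hcast ha.2.1) (hcast ha.2.2)
  set T := Finset.univ.filter fun x : ZMod p × ZMod p =>
      (x.1 ≠ 0 ∧ x.2 ≠ 0) ∧ (a.1 : ZMod p) * x.1 ^ 2 + a.2.1 * x.2 ^ 2 + a.2.2 = 0 with hT
  have hcard : (unitZeros p a).card =
      ((Finset.univ.filter fun z : ZMod p => z ≠ 0) ×ˢ T).card := by
    symm
    refine Finset.card_bij (fun x _ => (x.1 * x.2.1, x.1 * x.2.2, x.1)) ?_ ?_ ?_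
    · rintro ⟨z, x, y⟩ h
      simp only [hT, Finset.mem_product, Finset.mem_filter, Finset.mem_univ, true_and] at h
      obtain ⟨hz, ⟨hx, hy⟩, e⟩ := h
      simp only [unitZeros, Finset.mem_filter, Finset.mem_univ, true_and, isUnit_iff_ne_zero]
      exact ⟨⟨mul_ne_zero hz hx, mul_ne_zero hz hy, hz⟩, by linear_combination z ^ 2 * e⟩
    · rintro ⟨z, x, y⟩ h ⟨z', x', y'⟩ h' e
      simp only [Finset.mem_product, Finset.mem_filter, Finset.mem_univ, true_and] at h
      simp only [Prod.mk.injEq] at e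
      obtain ⟨e1, e2, rfl⟩ := e
      rw [mul_left_cancel₀ h.1 e1, mul_left_cancel₀ h.1 e2]
    · rintro ⟨x, y, z⟩ h
      simp only [unitZeros, Finset.mem_filter, Finset.mem_univ, true_and,
        isUnit_iff_ne_zero] at h
      obtain ⟨⟨hx, hy, hz⟩, e⟩ := h
      refine ⟨(z, x / z, y / z), ?_, ?_⟩
      · simp only [hT, Finset.mem_product, Finset.mem_filter, Finset.mem_univ, true_and]
        refine ⟨hz, ⟨div_ne_zero hx hz, div_ne_zero hy hz⟩, ?_⟩
        field_simp
        linear_combination e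
      · simp only [Prod.mk.injEq, and_true]
        exact ⟨mul_div_cancel₀ _ hz, mul_div_cancel₀ _ hz⟩
  have hu : ((Finset.univ.filter fun z : ZMod p => z ≠ 0).card : ℤ) = p - 1 := by
    rw [Finset.filter_ne', Finset.card_erase_of_mem (Finset.mem_univ _), Finset.card_univ,
      ZMod.card, Nat.cast_sub (Fact.out : p.Prime).one_le, Nat.cast_one]
  rw [hcard, Finset.card_product, Nat.cast_mul, hu, h, sSym, legendreSym, legendreSym,
    legendreSym]
  push_cast
  ring

end ConicCount

/-! ### The zero frequency -/

/-- All fibres of a surjective homomorphism have the size of its kernel. -/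
theorem card_filter_comp_mul_card {G M : Type*} [AddGroup G] [Fintype G] [AddGroup M] [Fintype M]
    [DecidableEq M] (f : G →+ M) (hf : Function.Surjective f) (T : Finset M) :
    (Finset.univ.filter fun x => f x ∈ T).card * Fintype.card M = T.card * Fintype.card G := by
  classical
  have key : ∀ S : Finset M, (Finset.univ.filter fun x => f x ∈ S).card =
      S.card * (Finset.univ.filter fun x => f x = 0).card := by
    intro S
    rw [Finset.card_eq_sum_card_fiberwise (s := Finset.univ.filter fun x => f x ∈ S) (f := f)
      (t := S) (fun x hx => (Finset.mem_filter.1 hx).2)]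
    rw [Finset.sum_congr rfl (g := fun _ => (Finset.univ.filter fun x => f x = 0).card),
      Finset.sum_const, smul_eq_mul]
    intro y hy
    rw [← AddMonoidHom.card_fiber_eq_of_mem_range f (hf y) (hf 0)]
    congr 1
    ext x
    simp only [Finset.mem_filter, Finset.mem_univ, true_and]
    constructor
    · exact fun h => h.2
    · intro h; exact ⟨h ▸ hy, h⟩
  have h1 := key T
  have h2 := key Finset.univ
  have h3 : (Finset.univ.filter fun x => f x ∈ (Finset.univ : Finset M)) =
      (Finset.univ : Finset G) := by
    ext x; simp
  rw [h3, Finset.card_univ, Finset.card_univ] at h2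
  rw [h1, h2]
  ring

section ZeroFrequency

variable {p : ℕ} [Fact p.Prime] {n : ℕ}

theorem sum_stdAddChar_torsion (hn : n ≠ 0) (y : ZMod (p ^ n)) :
    ∑ t : ZMod (p ^ n) with (p : ZMod (p ^ n)) * t = 0, (ZMod.stdAddChar (t * y) : ℂ) =
      if IsUnit y then 0 else (p : ℂ) := by
  split_ifs with hy
  · set S := ∑ t : ZMod (p ^ n) with (p : ZMod (p ^ n)) * t = 0, (ZMod.stdAddChar (t * y) : ℂ)
      with hS
    set t0 : ZMod (p ^ n) := (p : ZMod (p ^ n)) ^ (n - 1) with ht0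
    have hpt0 : (p : ZMod (p ^ n)) * t0 = 0 := by
      rw [ht0, ← pow_succ', zmod_prime_pow_eq_zero_iff]; omega
    have h1 : S = ZMod.stdAddChar (t0 * y) * S := by
      conv_lhs => rw [hS]
      rw [hS, Finset.mul_sum]
      refine Finset.sum_bij (fun t _ => t - t0) ?_ ?_ ?_ ?_
      · intro t ht
        rw [Finset.mem_filter] at ht ⊢
        exact ⟨Finset.mem_univ _, by rw [mul_sub, ht.2, hpt0, sub_zero]⟩
      · intro t _ t' _ e
        exact sub_left_injective e
      · intro t ht
        rw [Finset.mem_filter] at ht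
        exact ⟨t + t0, Finset.mem_filter.2 ⟨Finset.mem_univ _, by
          rw [mul_add, ht.2, hpt0, add_zero]⟩, by ring⟩
      · intro t _
        rw [← AddChar.map_add_eq_mul]
        congr 1; ring
    have h2 : (ZMod.stdAddChar (t0 * y) : ℂ) ≠ 1 := by
      rw [← AddChar.map_zero_eq_one (ZMod.stdAddChar (N := p ^ n))]
      intro h
      have := ZMod.injective_stdAddChar h
      rw [ht0, zmod_prime_pow_mul_unit_eq_zero_iff hy] at this
      omega
    have h3 : (1 - (ZMod.stdAddChar (t0 * y) : ℂ)) * S = 0 := by linear_combination h1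
    exact (mul_eq_zero.1 h3).resolve_left (sub_ne_zero.2 h2.symm)
  · obtain ⟨c, rfl⟩ := exists_eq_prime_mul_of_not_isUnit hy
    rw [Finset.sum_congr rfl (g := fun _ => (1 : ℂ))]
    · have := card_prime_pow_mul_eq_zero (p := p) (n := n) (k := 1) (by omega)
      rw [pow_one, pow_one] at this
      rw [Finset.sum_const, this, nsmul_eq_mul, mul_one]
    · intro t ht
      rw [Finset.mem_filter] at ht
      have : t * ((p : ZMod (p ^ n)) * c) = 0 := by linear_combination c * ht.2
      rw [this, AddChar.map_zero_eq_one]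

/-- At frequency zero the unit sums vanish unless `p t = 0`. Summing over these `p` multipliers only
detects the equation modulo `p`, so the count is pulled back from `ZMod p`, with no lifting of
solutions. -/
theorem card_unitZeros_prime_pow (hp2 : p ≠ 2) (hn : n ≠ 0) {a : ℤ × ℤ × ℤ}
    (ha : UnitCoords p a) :
    (unitZeros (p ^ n) a).card * p ^ 2 = p ^ (2 * n) * (unitZeros p a).card := by
  have hp0 : 0 < p := (Fact.out : p.Prime).pos
  set V := Finset.univ.filter fun b : ZMod (p ^ n) × ZMod (p ^ n) × ZMod (p ^ n) =>
    (IsUnit b.1 ∧ IsUnit b.2.1 ∧ IsUnit b.2.2) ∧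
      ¬ IsUnit ((a.1 : ZMod (p ^ n)) * b.1 ^ 2 + a.2.1 * b.2.1 ^ 2 + a.2.2 * b.2.2 ^ 2) with hV
  have h1 : p ^ n * (unitZeros (p ^ n) a).card = p * V.card := by
    have hz : coneSum (p ^ n) a (0, 0, 0) = (unitZeros (p ^ n) a).card := by
      simp [coneSum]
    have h0 := card_mul_coneSum (p ^ n) a (0, 0, 0)
    rw [hz] at h0
    have hvan : ∀ t : ZMod (p ^ n), ¬ (p : ZMod (p ^ n)) * t = 0 →
        prodSum (p ^ n) a (0, 0, 0) t = 0 := by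
      intro t ht
      obtain ⟨j, hj, u, hu, rfl⟩ := exists_eq_prime_pow_mul_unit t
      have hj2 : j + 2 ≤ n := by
        by_contra hc
        apply ht
        rw [← mul_assoc, ← pow_succ', zmod_prime_pow_eq_zero_iff.2 (by omega), zero_mul]
      have hnt : Nontrivial (ZMod (p ^ n)) := by
        have : Fact (1 < p ^ n) := ⟨Nat.one_lt_pow hn (Fact.out : p.Prime).one_lt⟩
        infer_instance
      have := unitQuadSum_eq_zero_of_not_isUnit hp2 hj2
        (hu.mul ((isUnit_intCast_iff_not_dvd hn _).2 ha.1)) (l := 0) not_isUnit_zero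
      rw [mul_zero, ← mul_assoc] at this
      simp only [prodSum, Int.cast_zero]
      rw [this, zero_mul, zero_mul]
    have h2 : ∑ t : ZMod (p ^ n), prodSum (p ^ n) a (0, 0, 0) t =
        ∑ t : ZMod (p ^ n) with (p : ZMod (p ^ n)) * t = 0, prodSum (p ^ n) a (0, 0, 0) t := by
      rw [Finset.sum_filter]
      refine Finset.sum_congr rfl fun t _ => ?_
      split_ifs with h
      · rfl
      · exact hvan t h
    have h3 : ∀ t : ZMod (p ^ n), prodSum (p ^ n) a (0, 0, 0) t =
        ∑ b : ZMod (p ^ n) × ZMod (p ^ n) × ZMod (p ^ n) with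
          (IsUnit b.1 ∧ IsUnit b.2.1 ∧ IsUnit b.2.2), (ZMod.stdAddChar (t *
          ((a.1 : ZMod (p ^ n)) * b.1 ^ 2 + (a.2.1 : ZMod (p ^ n)) * b.2.1 ^ 2 +
            (a.2.2 : ZMod (p ^ n)) * b.2.2 ^ 2)) : ℂ) := by
      intro t
      rw [prodSum_eq_sum]
      simp
    have h4 : (p ^ n : ℂ) * (unitZeros (p ^ n) a).card = p * V.card := by
      push_cast at h0
      rw [h0, h2]
      simp_rw [h3]
      rw [Finset.sum_comm]
      simp_rw [sum_stdAddChar_torsion hn]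
      rw [hV, ← Finset.filter_filter (fun b : ZMod (p ^ n) × ZMod (p ^ n) × ZMod (p ^ n) =>
        IsUnit b.1 ∧ IsUnit b.2.1 ∧ IsUnit b.2.2), Finset.card_filter]
      push_cast
      rw [Finset.mul_sum]
      refine Finset.sum_congr rfl fun b _ => ?_
      split_ifs <;> simp_all
    exact_mod_cast h4
  have h2 : V.card * p ^ 3 = (unitZeros p a).card * (p ^ n) ^ 3 := by
    let φ : ZMod (p ^ n) →+* ZMod p := ZMod.castHom (dvd_pow_self p hn) (ZMod p)
    have hφ : Function.Surjective φ := ZMod.castHom_surjective _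
    have hunit : ∀ b : ZMod (p ^ n), IsUnit b ↔ IsUnit (φ b) := by
      intro b
      obtain ⟨m, rfl⟩ := ZMod.intCast_surjective b
      rw [isUnit_intCast_iff_not_dvd hn, map_intCast, isUnit_iff_ne_zero, Ne,
        ZMod.intCast_zmod_eq_zero_iff_dvd]
    let f := (φ : ZMod (p ^ n) →+ ZMod p).prodMap
      ((φ : ZMod (p ^ n) →+ ZMod p).prodMap (φ : ZMod (p ^ n) →+ ZMod p))
    have hf : Function.Surjective f := by
      rintro ⟨x, y, z⟩
      obtain ⟨x', rfl⟩ := hφ x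
      obtain ⟨y', rfl⟩ := hφ y
      obtain ⟨z', rfl⟩ := hφ z
      exact ⟨(x', y', z'), rfl⟩
    have h := card_filter_comp_mul_card f hf (unitZeros p a)
    have e : (Finset.univ.filter fun b => f b ∈ unitZeros p a) = V := by
      ext ⟨x, y, z⟩
      simp only [hV, unitZeros, Finset.mem_filter, Finset.mem_univ, true_and]
      rw [hunit x, hunit y, hunit z, hunit (_ + _), isUnit_iff_ne_zero (a := φ (_ + _)), not_not]
      simp only [map_add, map_mul, map_pow, map_intCast]
      rfl
    rw [e] at h
    simp only [Fintype.card_prod, ZMod.card] at h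
    calc V.card * p ^ 3 = V.card * (p * (p * p)) := by ring
      _ = _ := by rw [h]; ring
  have h3 : p ^ n * p * ((unitZeros (p ^ n) a).card * p ^ 2) =
      p ^ n * p * (p ^ (2 * n) * (unitZeros p a).card) := by
    calc _ = p ^ n * (unitZeros (p ^ n) a).card * p ^ 3 := by ring
      _ = p * (V.card * p ^ 3) := by rw [h1]; ring
      _ = _ := by rw [h2]; ring
  exact Nat.eq_of_mul_eq_mul_left (by positivity) h3

theorem card_unitZeros_eq (hp2 : p ≠ 2) (hn : n ≠ 0) {a : ℤ × ℤ × ℤ} (ha : UnitCoords p a) :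
    ((unitZeros (p ^ n) a).card : ℝ) = cConst p a.1 a.2.1 a.2.2 * ((p : ℝ) ^ n) ^ 2 := by
  have h1 := card_unitZeros_prime_pow hp2 hn ha
  have h2 := card_unitZeros_prime hp2 ha
  have hp0 : (p : ℝ) ≠ 0 := by exact_mod_cast (Fact.out : p.Prime).ne_zero
  have h1' : ((unitZeros (p ^ n) a).card : ℝ) * (p : ℝ) ^ 2 =
      (p : ℝ) ^ (2 * n) * (unitZeros p a).card := by exact_mod_cast h1
  have h2' : ((unitZeros p a).card : ℝ) = (p - (sSym p a.1 a.2.1 a.2.2 : ℝ)) * (p - 1) := by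
    exact_mod_cast h2
  rw [cConst, ← pow_mul, mul_comm n 2]
  rw [h2'] at h1'
  field_simp
  linear_combination h1'

end ZeroFrequency

/-! ### Schwartz functions and Poisson summation -/

/-- A real Schwartz function viewed as a complex one. -/
noncomputable def SchwartzMap.complexify (Φ : 𝓢(ℝ, ℝ)) : 𝓢(ℝ, ℂ) where
  toFun x := (Φ x : ℂ)
  smooth' := Complex.ofRealCLM.contDiff.comp (Φ.smooth _)
  decay' k n := by
    obtain ⟨C, -, hC⟩ := Φ.decay k n
    refine ⟨C, fun x => (le_of_eq ?_).trans (hC x)⟩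
    congr 1
    exact Complex.ofRealLI.norm_iteratedFDeriv_comp_left (Φ.smooth _).contDiffAt le_rfl

theorem SchwartzMap.complexify_apply (Φ : 𝓢(ℝ, ℝ)) (x : ℝ) : Φ.complexify x = (Φ x : ℂ) := rfl

theorem phiHat_eq_fourier_complexify (Φ : 𝓢(ℝ, ℝ)) : phiHat Φ = (𝓕 Φ.complexify : 𝓢(ℝ, ℂ)) := rfl

theorem SchwartzMap.exists_le_inv_one_add_pow (F : 𝓢(ℝ, ℂ)) (A : ℕ) :
    ∃ C : ℝ, 0 < C ∧ ∀ x, ‖F x‖ ≤ C * ((1 + |x|) ^ A)⁻¹ := by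
  have h := fun x => F.one_add_le_sup_seminorm_apply (𝕜 := ℝ) (m := (A, 0)) le_rfl le_rfl x
  simp only [norm_iteratedFDeriv_zero] at h
  obtain ⟨B, hB⟩ : ∃ B, ∀ x, (1 + ‖x‖) ^ A * ‖F x‖ ≤ B := ⟨_, h⟩
  refine ⟨max 1 B, lt_of_lt_of_le one_pos (le_max_left 1 _), fun x => ?_⟩
  rw [← div_eq_mul_inv, le_div_iff₀ (by positivity), mul_comm]
  exact (hB x).trans (le_max_right _ _)

theorem summable_inv_one_add_abs_sq : Summable fun l : ℤ => ((1 + |(l : ℝ)|) ^ 2)⁻¹ := by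
  have h := Real.summable_abs_int_rpow (b := 2) (by norm_num)
  have h1 : Summable fun l : ℤ => |(l : ℝ)| ^ (-2 : ℝ) + if l = 0 then (1 : ℝ) else 0 :=
    h.add (summable_of_hasFiniteSupport ((Set.finite_singleton 0).subset (by
      intro l hl
      by_contra hne
      exact hl (if_neg hne))))
  refine Summable.of_nonneg_of_le (fun l => by positivity) (fun l => ?_) h1
  by_cases hl : l = 0
  · subst hl
    simp
  · have hl' : 0 < |(l : ℝ)| := by positivity
    rw [if_neg hl, add_zero, Real.rpow_neg hl'.le, Real.rpow_two]
    gcongr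
    linarith

theorem inv_one_add_abs_mul_sq_le {c : ℝ} (hc : 0 < c) (l : ℝ) :
    ((1 + |l * c|) ^ 2)⁻¹ ≤ (min 1 c ^ 2)⁻¹ * ((1 + |l|) ^ 2)⁻¹ := by
  rw [← mul_inv, ← mul_pow]
  have hm : 0 < min 1 c := lt_min one_pos hc
  gcongr
  rw [abs_mul, abs_of_pos hc, mul_add, mul_one, mul_comm]
  have h1 := min_le_left 1 c
  have h2 := min_le_right 1 c
  have h3 := abs_nonneg l
  nlinarith

theorem SchwartzMap.summable_norm_int_mul (F : 𝓢(ℝ, ℂ)) {c : ℝ} (hc : 0 < c) :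
    Summable fun l : ℤ => ‖F (l * c)‖ := by
  obtain ⟨C, hC, h⟩ := F.exists_le_inv_one_add_pow 2
  refine Summable.of_nonneg_of_le (fun l => norm_nonneg _) (fun l => ?_)
    (summable_inv_one_add_abs_sq.mul_left (C * (min 1 c ^ 2)⁻¹))
  rw [mul_assoc]
  exact (h _).trans (mul_le_mul_of_nonneg_left (inv_one_add_abs_mul_sq_le hc l) hC.le)

theorem fourier_comp_mul_right (F : ℝ → ℂ) {c : ℝ} (hc : 0 < c) (y : ℝ) :
    𝓕 (fun x => F (x * c)) y = (c⁻¹ : ℝ) * 𝓕 F (y * c⁻¹) := by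
  rw [Real.fourier_real_eq, Real.fourier_real_eq]
  have h := MeasureTheory.Measure.integral_comp_mul_right
    (fun v => Real.fourierChar (-(v * (y * c⁻¹))) • F v) c
  rw [abs_of_pos (inv_pos.2 hc), Complex.real_smul] at h
  rw [← h]
  congr 1
  ext v
  congr 3
  field_simp

/-- Poisson summation over a residue class. -/
theorem SchwartzMap.tsum_residue_class (F : 𝓢(ℝ, ℂ)) {N : ℝ} (hN : 0 < N) (q : ℕ) [NeZero q]
    (b : ZMod q) :
    ∑' x : ℤ, (if (x : ZMod q) = b then F (x / N) else 0) =
      ((N / q : ℝ) : ℂ) * ∑' l : ℤ, (𝓕 F : 𝓢(ℝ, ℂ)) (l * (N / q)) *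
        ZMod.stdAddChar ((l : ZMod q) * b) := by
  have hq : (0 : ℝ) < q := by exact_mod_cast NeZero.pos q
  have hqz : (q : ℤ) ≠ 0 := by exact_mod_cast NeZero.ne q
  have hc : 0 < (q : ℝ) / N := by positivity
  -- The dilation `F(x q/N)` carries the class `b + qℤ` to the translate `b/q + ℤ`.
  let h0 : 𝓢(ℝ, ℂ) := SchwartzMap.compCLMOfContinuousLinearEquiv ℂ
    (ContinuousLinearEquiv.unitsEquivAut ℝ (Units.mk0 ((q : ℝ) / N) hc.ne')) F
  have hh0 : ∀ x, h0 x = F (x * (q / N)) := fun x => rfl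
  have h1 := h0.tsum_eq_tsum_fourier ((b.val : ℝ) / q)
  have hinj : Function.Injective fun n : ℤ => (b.val : ℤ) + q * n := by
    intro n n' e
    exact mul_left_cancel₀ hqz (add_left_cancel e)
  have h2 : ∑' x : ℤ, (if (x : ZMod q) = b then F (x / N) else 0) =
      ∑' n : ℤ, h0 ((b.val : ℝ) / q + n) := by
    rw [← hinj.tsum_eq]
    · refine tsum_congr fun n => ?_
      rw [if_pos (by push_cast; simp), hh0]
      congr 1
      push_cast
      field_simp
    · intro x hx
      have hx' : (x : ZMod q) = b := by
        by_contra hne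
        exact hx (if_neg hne)
      have : ((x - b.val : ℤ) : ZMod q) = 0 := by
        push_cast; rw [hx', ZMod.natCast_zmod_val, sub_self]
      rw [ZMod.intCast_zmod_eq_zero_iff_dvd] at this
      obtain ⟨n, hn⟩ := this
      exact ⟨n, by simp only; linarith⟩
  rw [h2, h1, ← tsum_mul_left]
  refine tsum_congr fun l => ?_
  have h3 : (𝓕 h0 : 𝓢(ℝ, ℂ)) l = ((N / q : ℝ) : ℂ) * (𝓕 F : 𝓢(ℝ, ℂ)) (l * (N / q)) := by
    rw [SchwartzMap.fourier_coe, SchwartzMap.fourier_coe]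
    have := fourier_comp_mul_right F hc (l : ℝ)
    rw [inv_div] at this
    exact this
  rw [h3, mul_assoc]
  congr 2
  rw [fourier_coe_apply]
  have e : (l : ZMod q) * b = ((l * b.val : ℤ) : ZMod q) := by push_cast; simp
  rw [e, ZMod.stdAddChar_coe]
  congr 1
  push_cast
  ring

theorem summable_norm_triple {f g h : ℤ → ℂ} (hf : Summable fun x => ‖f x‖)
    (hg : Summable fun x => ‖g x‖) (hh : Summable fun x => ‖h x‖) :
    Summable fun x : ℤ × ℤ × ℤ => ‖f x.1 * (g x.2.1 * h x.2.2)‖ := by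
  have h1 : Summable fun x : ℤ × ℤ => ‖g x.1 * h x.2‖ := Summable.mul_norm hg hh
  exact Summable.mul_norm (g := fun y : ℤ × ℤ => g y.1 * h y.2) hf h1

theorem tsum_triple {f g h : ℤ → ℂ} (hf : Summable fun x => ‖f x‖)
    (hg : Summable fun x => ‖g x‖) (hh : Summable fun x => ‖h x‖) :
    ∑' x : ℤ × ℤ × ℤ, f x.1 * (g x.2.1 * h x.2.2) = (∑' x, f x) * ((∑' x, g x) * ∑' x, h x) := by
  have h1 : Summable fun x : ℤ × ℤ => ‖g x.1 * h x.2‖ := Summable.mul_norm hg hh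
  rw [tsum_mul_tsum_of_summable_norm hg hh, tsum_mul_tsum_of_summable_norm hf h1]

theorem tsum_sum_triple {ι : Type*} (s : Finset (ι × ι × ι)) {f : ι → ℤ → ℂ}
    (hf : ∀ b, Summable fun x => ‖f b x‖) :
    ∑' x : ℤ × ℤ × ℤ, ∑ b ∈ s, f b.1 x.1 * (f b.2.1 x.2.1 * f b.2.2 x.2.2) =
      ∑ b ∈ s, ∑' x : ℤ × ℤ × ℤ, f b.1 x.1 * (f b.2.1 x.2.1 * f b.2.2 x.2.2) := by
  have h : ∀ b ∈ s, Summable fun x : ℤ × ℤ × ℤ =>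
      f b.1 x.1 * (f b.2.1 x.2.1 * f b.2.2 x.2.2) := fun b _ =>
    (summable_norm_triple (f := f b.1) (g := f b.2.1) (h := f b.2.2) (hf _) (hf _) (hf _)).of_norm
  exact Summable.tsum_finsetSum h

/-- The product weight of a complex Schwartz function at the scaled integer point `l * c`. -/
noncomputable def scaledWeight (F : 𝓢(ℝ, ℂ)) (c : ℝ) (l : ℤ × ℤ × ℤ) : ℂ :=
  F (l.1 * c) * (F (l.2.1 * c) * F (l.2.2 * c))

theorem summable_norm_scaledWeight (F : 𝓢(ℝ, ℂ)) {c : ℝ} (hc : 0 < c) :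
    Summable fun l => ‖scaledWeight F c l‖ := by
  let f : ℤ → ℂ := fun l => F (l * c)
  have hf : Summable fun l => ‖f l‖ := F.summable_norm_int_mul hc
  exact summable_norm_triple (f := f) (g := f) (h := f) hf hf hf

theorem ofReal_tripleWeight (Φ : 𝓢(ℝ, ℝ)) (N : ℝ) (x : ℤ × ℤ × ℤ) :
    (tripleWeight Φ N x : ℂ) = scaledWeight Φ.complexify N⁻¹ x := by
  simp only [tripleWeight, scaledWeight, SchwartzMap.complexify_apply, div_eq_mul_inv]
  push_cast
  ring

theorem summable_tripleWeight (Φ : 𝓢(ℝ, ℝ)) {N : ℝ} (hN : 0 < N) :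
    Summable (tripleWeight Φ N) := by
  have h := summable_norm_scaledWeight Φ.complexify (inv_pos.2 hN)
  simp only [← ofReal_tripleWeight, Complex.norm_real] at h
  exact h.of_norm

/-- The case `n = 0` is excluded because modulo 1 every integer is a unit. -/
theorem mem_solSet_iff {p : ℕ} [Fact p.Prime] {n : ℕ} (hn : n ≠ 0) (a x : ℤ × ℤ × ℤ) :
    x ∈ solSet p (p ^ n) a.1 a.2.1 a.2.2 ↔
      ((x.1 : ZMod (p ^ n)), (x.2.1 : ZMod (p ^ n)), (x.2.2 : ZMod (p ^ n))) ∈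
        unitZeros (p ^ n) a := by
  have hp : Prime (p : ℤ) := Nat.prime_iff_prime_int.1 Fact.out
  simp only [solSet, unitZeros, Set.mem_ofPred_eq, Finset.mem_filter, Finset.mem_univ, true_and,
    isUnit_intCast_iff_not_dvd hn, IsCoprime.mul_left_iff]
  have hu : ∀ m : ℤ, IsCoprime m (p : ℤ) ↔ ¬ (p : ℤ) ∣ m := fun m => by
    rw [isCoprime_comm, hp.irreducible.coprime_iff_not_dvd]
  rw [hu, hu, hu, ← ZMod.intCast_eq_intCast_iff]
  push_cast
  tauto

/-- Poisson summation over the points of `ℤ³` whose residues lie on a cone modulo `q`. -/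
theorem tsum_eq_tsum_coneSum {q : ℕ} [NeZero q] (Φ : 𝓢(ℝ, ℝ)) {N : ℝ} (hN : 0 < N)
    {a : ℤ × ℤ × ℤ} {S : Set (ℤ × ℤ × ℤ)}
    (hS : ∀ x : ℤ × ℤ × ℤ, x ∈ S ↔
      ((x.1 : ZMod q), (x.2.1 : ZMod q), (x.2.2 : ZMod q)) ∈ unitZeros q a) :
    ((∑' x : S, tripleWeight Φ N x : ℝ) : ℂ) =
      ((N / q : ℝ) : ℂ) ^ 3 * ∑' l : ℤ × ℤ × ℤ,
        scaledWeight (𝓕 Φ.complexify) (N / q) l * coneSum q a l := by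
  classical
  set F := Φ.complexify with hF
  have hq0 : (0 : ℝ) < q := by exact_mod_cast NeZero.pos q
  have hc : 0 < N / q := by positivity
  let f : ZMod q → ℤ → ℂ := fun b x => if (x : ZMod q) = b then F (x / N) else 0
  let g : ZMod q → ℤ → ℂ := fun b l =>
    (𝓕 F : 𝓢(ℝ, ℂ)) (l * (N / q)) * ZMod.stdAddChar ((l : ZMod q) * b)
  have hf : ∀ b, Summable fun x => ‖f b x‖ := fun b => by
    refine Summable.of_nonneg_of_le (fun x => norm_nonneg _) (fun x => ?_)
      (F.summable_norm_int_mul (inv_pos.2 hN))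
    by_cases h : (x : ZMod q) = b
    · simp [f, h, div_eq_mul_inv]
    · simp [f, h]
  have hg : ∀ b, Summable fun x => ‖g b x‖ := fun b => by
    refine ((𝓕 F : 𝓢(ℝ, ℂ)).summable_norm_int_mul hc).congr fun x => ?_
    simp only [g, norm_mul, AddChar.norm_apply, mul_one]
  have hfg : ∀ b, ∑' x, f b x = ((N / q : ℝ) : ℂ) * ∑' l, g b l := fun b =>
    F.tsum_residue_class hN q b
  rw [Complex.ofReal_tsum, tsum_subtype S
    (fun x => (tripleWeight Φ N x : ℂ))]
  -- Splitting by the residue `b` on the cone makes each piece a product of three one-dimensional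
  -- sums, to which Poisson summation applies separately.
  have e1 : ∀ x, S.indicator (fun x => (tripleWeight Φ N x : ℂ)) x =
      ∑ b ∈ unitZeros q a, f b.1 x.1 * (f b.2.1 x.2.1 * f b.2.2 x.2.2) := by
    intro x
    have e2 : ∀ b : ZMod q × ZMod q × ZMod q, f b.1 x.1 * (f b.2.1 x.2.1 * f b.2.2 x.2.2) =
        if ((x.1 : ZMod q), (x.2.1 : ZMod q), (x.2.2 : ZMod q)) = b then
          (tripleWeight Φ N x : ℂ) else 0 := by
      rintro ⟨b1, b2, b3⟩
      rw [ofReal_tripleWeight]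
      simp only [f, scaledWeight, Prod.mk.injEq, ← div_eq_mul_inv]
      split_ifs <;> simp_all [F]
    rw [Finset.sum_congr rfl fun b _ => e2 b, Finset.sum_ite_eq, Set.indicator_apply]
    simp only [hS x]
  rw [tsum_congr e1, tsum_sum_triple _ hf]
  have e3 : ∀ b ∈ unitZeros q a, ∑' x : ℤ × ℤ × ℤ, f b.1 x.1 * (f b.2.1 x.2.1 * f b.2.2 x.2.2) =
      ((N / q : ℝ) : ℂ) ^ 3 * ∑' l : ℤ × ℤ × ℤ, g b.1 l.1 * (g b.2.1 l.2.1 * g b.2.2 l.2.2) := by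
    intro b _
    rw [tsum_triple (f := f b.1) (g := f b.2.1) (h := f b.2.2) (hf _) (hf _) (hf _),
      tsum_triple (f := g b.1) (g := g b.2.1) (h := g b.2.2) (hg _) (hg _) (hg _), hfg, hfg, hfg]
    ring
  rw [Finset.sum_congr rfl e3, ← Finset.mul_sum, ← tsum_sum_triple _ hg]
  congr 1
  refine tsum_congr fun l => ?_
  rw [coneSum, Finset.mul_sum]
  refine Finset.sum_congr rfl fun b _ => ?_
  simp only [g, scaledWeight, AddChar.map_add_eq_mul]
  ring

/-! ### Decay of the weight away from a box -/

theorem inv_one_add_pow_le {T x : ℝ} (hT : 0 < T) (hx : T ≤ |x|) (B : ℕ) :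
    ((1 + |x|) ^ (B + 2))⁻¹ ≤ (T ^ B)⁻¹ * ((1 + |x|) ^ 2)⁻¹ := by
  rw [pow_add, mul_inv]
  gcongr
  linarith

theorem inv_one_add_pow_le_sq (x : ℝ) (B : ℕ) :
    ((1 + |x|) ^ (B + 2))⁻¹ ≤ ((1 + |x|) ^ 2)⁻¹ := by
  have h : (1 : ℝ) ≤ 1 + |x| := by linarith [abs_nonneg x]
  gcongr
  omega

/-- The convergent weight `∏ (1 + |lᵢ|)⁻²` on `ℤ³`. -/
noncomputable def decayWeight (l : ℤ × ℤ × ℤ) : ℝ :=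
  ((1 + |(l.1 : ℝ)|) ^ 2)⁻¹ * (((1 + |(l.2.1 : ℝ)|) ^ 2)⁻¹ * ((1 + |(l.2.2 : ℝ)|) ^ 2)⁻¹)

theorem decayWeight_nonneg (l : ℤ × ℤ × ℤ) : 0 ≤ decayWeight l := by
  unfold decayWeight; positivity

theorem summable_decayWeight : Summable decayWeight := by
  obtain ⟨d, hd⟩ : ∃ d : ℤ → ℝ, d = fun l : ℤ => ((1 + |(l : ℝ)|) ^ 2)⁻¹ := ⟨_, rfl⟩
  have h : Summable d := hd ▸ summable_inv_one_add_abs_sq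
  have hd0 : 0 ≤ d := fun l => by rw [hd]; positivity
  have h1 : Summable fun x : ℤ × ℤ => d x.1 * d x.2 := h.mul_of_nonneg h hd0 hd0
  have h2 : Summable fun x : ℤ × ℤ × ℤ => d x.1 * (d x.2.1 * d x.2.2) :=
    h.mul_of_nonneg (g := fun x : ℤ × ℤ => d x.1 * d x.2) h1 hd0
      fun x => mul_nonneg (hd0 x.1) (hd0 x.2)
  refine h2.congr fun l => ?_
  rw [hd, decayWeight]

theorem exists_norm_scaledWeight_le (G : 𝓢(ℝ, ℂ)) :
    ∃ C : ℝ, 0 < C ∧ ∀ c l, ‖scaledWeight G c l‖ ≤ C := by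
  obtain ⟨C, hC, h⟩ := G.exists_le_inv_one_add_pow 0
  simp only [pow_zero, inv_one, mul_one] at h
  refine ⟨C * (C * C), by positivity, fun c l => ?_⟩
  rw [scaledWeight, norm_mul, norm_mul]
  gcongr <;> exact h _

/-- Rapid decay of the product weight away from a large box. -/
theorem exists_norm_scaledWeight_le_of_lt_supAbs (G : 𝓢(ℝ, ℂ)) (B : ℕ) :
    ∃ C : ℝ, 0 < C ∧ ∀ (c T : ℝ) (K : ℕ) (l : ℤ × ℤ × ℤ), 0 < c → 1 ≤ T → T ≤ (K + 1) * c →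
      K < supAbs l →
      ‖scaledWeight G c l‖ ≤ C * (T ^ B)⁻¹ * (min 1 c ^ 6)⁻¹ * decayWeight l := by
  obtain ⟨C, hC, h⟩ := G.exists_le_inv_one_add_pow (B + 2)
  refine ⟨C ^ 3, by positivity, fun c T K l hc hT hK hl => ?_⟩
  set m := (min 1 c ^ 2)⁻¹ with hm
  have hm0 : 0 ≤ m := by positivity
  set t := (T ^ B)⁻¹ with ht
  have hT0 : 0 < T := by linarith
  have ht0 : 0 ≤ t := by positivity
  let d : ℤ → ℝ := fun x => ((1 + |(x : ℝ)|) ^ 2)⁻¹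
  have hd0 : ∀ x, 0 ≤ d x := fun x => by positivity
  have hgen : ∀ x : ℤ, ‖G (x * c)‖ ≤ C * (m * d x) := fun x =>
    (h _).trans (mul_le_mul_of_nonneg_left ((inv_one_add_pow_le_sq _ B).trans
      (inv_one_add_abs_mul_sq_le hc x)) hC.le)
  have hbig : ∀ x : ℤ, (K : ℤ) < |x| → ‖G (x * c)‖ ≤ t * (C * (m * d x)) := fun x hx => by
    have hx' : (K + 1 : ℝ) ≤ |(x : ℝ)| := by
      rw [← Int.cast_abs]; exact_mod_cast hx
    have h1 : T ≤ |x * c| := by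
      rw [abs_mul, abs_of_pos hc]
      exact hK.trans (mul_le_mul_of_nonneg_right hx' hc.le)
    calc ‖G (x * c)‖ ≤ C * (t * ((1 + |x * c|) ^ 2)⁻¹) :=
          (h _).trans (mul_le_mul_of_nonneg_left (inv_one_add_pow_le hT0 h1 B) hC.le)
      _ ≤ C * (t * (m * d x)) := by
          gcongr
          exact inv_one_add_abs_mul_sq_le hc x
      _ = _ := by ring
  have e : C ^ 3 * t * (min 1 c ^ 6)⁻¹ * decayWeight l =
      t * ((C * (m * d l.1)) * ((C * (m * d l.2.1)) * (C * (m * d l.2.2)))) := by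
    have : (min 1 c ^ 6)⁻¹ = m ^ 3 := by rw [hm, inv_pow, ← pow_mul]
    rw [this, decayWeight]
    ring
  rw [e, scaledWeight, norm_mul, norm_mul]
  -- One long coordinate supplies `T^(-B)`; all three supply a summable factor, each losing at most
  -- `(min 1 c)^(-2)`.
  have hor : (K : ℤ) < |l.1| ∨ (K : ℤ) < |l.2.1| ∨ (K : ℤ) < |l.2.2| := by
    by_contra hcon
    push Not at hcon
    exact absurd (supAbs_le_iff.2 hcon) (by omega)
  rcases hor with h1 | h1 | h1
  · calc _ ≤ (t * (C * (m * d l.1))) * ((C * (m * d l.2.1)) * (C * (m * d l.2.2))) := by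
          gcongr
          exacts [hbig _ h1, hgen _, hgen _]
      _ = _ := by ring
  · calc _ ≤ (C * (m * d l.1)) * ((t * (C * (m * d l.2.1))) * (C * (m * d l.2.2))) := by
          gcongr
          exacts [hgen _, hbig _ h1, hgen _]
      _ = _ := by ring
  · calc _ ≤ (C * (m * d l.1)) * ((C * (m * d l.2.1)) * (t * (C * (m * d l.2.2)))) := by
          gcongr
          exacts [hgen _, hgen _, hbig _ h1]
      _ = _ := by ring

theorem sum_biUnion_le_sum_sum {ι α : Type*} [DecidableEq α] (I : Finset ι) (t : ι → Finset α)
    {f : α → ℝ} (hf : ∀ x, 0 ≤ f x) : ∑ x ∈ I.biUnion t, f x ≤ ∑ i ∈ I, ∑ x ∈ t i, f x := by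
  classical
  induction I using Finset.induction_on with
  | empty => simp
  | insert i I hi ih =>
    rw [Finset.biUnion_insert, Finset.sum_insert hi]
    have h1 := Finset.sum_union_inter (s₁ := t i) (s₂ := I.biUnion t) (f := f)
    have h2 : 0 ≤ ∑ x ∈ t i ∩ I.biUnion t, f x := Finset.sum_nonneg fun x _ => hf x
    linarith

/-- A nonzero vector is a power of `p` times a vector not divisible by `p`. -/
theorem exists_eq_pow_mul_of_ne_zero {p : ℕ} (hp : 1 < p) {v : ℤ × ℤ × ℤ} (hv : 0 < supAbs v) :
    ∃ (k : ℕ) (w : ℤ × ℤ × ℤ),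
      v = ((p : ℤ) ^ k * w.1, (p : ℤ) ^ k * w.2.1, (p : ℤ) ^ k * w.2.2) ∧
      (¬ (p : ℤ) ∣ w.1 ∨ ¬ (p : ℤ) ∣ w.2.1 ∨ ¬ (p : ℤ) ∣ w.2.2) := by
  induction hm : supAbs v using Nat.strong_induction_on generalizing v with
  | _ m ih =>
    by_cases h : ¬ (p : ℤ) ∣ v.1 ∨ ¬ (p : ℤ) ∣ v.2.1 ∨ ¬ (p : ℤ) ∣ v.2.2
    · exact ⟨0, v, by simp, h⟩
    · push Not at h
      obtain ⟨⟨x, hx⟩, ⟨y, hy⟩, ⟨z, hz⟩⟩ := h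
      have e : v = ((p : ℤ) * x, (p : ℤ) * y, (p : ℤ) * z) := by
        rw [← hx, ← hy, ← hz]
      have e1 : supAbs v = p * supAbs (x, y, z) := by
        rw [e]
        exact supAbs_smul (p : ℤ) (x, y, z)
      have h0 : 0 < supAbs (x, y, z) := Nat.pos_of_ne_zero fun h => by simp [e1, h] at hv
      obtain ⟨k, w, hw, hw'⟩ := ih (supAbs (x, y, z)) (by nlinarith) h0 rfl
      refine ⟨k + 1, w, ?_, hw'⟩
      obtain ⟨hx', hy', hz'⟩ : x = _ ∧ y = _ ∧ z = _ := by simpa using hw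
      rw [e, hx', hy', hz']
      simp only [Prod.mk.injEq]
      refine ⟨?_, ?_, ?_⟩ <;> ring

/-! ### Frequencies inside the box -/

section NearFrequencies

variable {p : ℕ} [Fact p.Prime] {n : ℕ}

/-- The frequencies of exact `p`-divisibility `p ^ k` in a box. -/
theorem sum_norm_coneSum_valuation_le (hp2 : p ≠ 2) {k K : ℕ} (hk : k + 2 ≤ n) (hK0 : 1 ≤ K)
    (hkK : p ^ k ≤ K) (hK : (K : ℝ) ^ 18 ≤ (p : ℝ) ^ (7 * (n - 1))) {a : ℤ × ℤ × ℤ}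
    (ha : UnitCoords p a) :
    ∑ l ∈ box3 (K / p ^ k) with
        (¬ (p : ℤ) ∣ l.1 ∨ ¬ (p : ℤ) ∣ l.2.1 ∨ ¬ (p : ℤ) ∣ l.2.2),
      ‖coneSum (p ^ n) a ((p : ℤ) ^ k * l.1, (p : ℤ) ^ k * l.2.1, (p : ℤ) ^ k * l.2.2)‖ ≤
      (240 * p + 2880 + 27 * (4 * p) ^ 28) * (1 + Real.log K) *
        (p : ℝ) ^ ((2 - 11 / 648 : ℝ) * n) := by
  classical
  have hpr : p.Prime := Fact.out
  have hp : Prime (p : ℤ) := Nat.prime_iff_prime_int.1 hpr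
  have hp1 : (1 : ℝ) < p := by exact_mod_cast hpr.one_lt
  have hp0 : (0 : ℝ) < p := by linarith
  set f : ℤ × ℤ × ℤ → ℝ := fun l =>
    ‖coneSum (p ^ n) a ((p : ℤ) ^ k * l.1, (p : ℤ) ^ k * l.2.1, (p : ℤ) ^ k * l.2.2)‖ with hf
  set S : Finset (ℤ × ℤ × ℤ) := (box3 (K / p ^ k)).filter
    fun l => (¬ (p : ℤ) ∣ l.1 ∨ ¬ (p : ℤ) ∣ l.2.1 ∨ ¬ (p : ℤ) ∣ l.2.2) with hS
  set X := S.filter fun l => f l ≠ 0 with hX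
  set r : ℝ := (p : ℝ) ^ (((n - 1 - k : ℕ) : ℝ) / 36) with hr
  have hr0 : 0 < r := Real.rpow_pos_of_pos hp0 _
  have hr36 : r ^ 36 = (p : ℝ) ^ (n - 1 - k) := by
    rw [hr, ← Real.rpow_natCast, ← Real.rpow_mul hp0.le, ← Real.rpow_natCast]
    congr 1
    push_cast
    ring
  have hKk1 : 1 ≤ K / p ^ k := (Nat.one_le_div_iff (pow_pos hpr.pos k)).2 hkK
  have hKk : ((K / p ^ k : ℕ) : ℝ) ≤ K / p ^ k := by exact_mod_cast Nat.cast_div_le (α := ℝ)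
  -- Dividing out `p^k` shrinks the box by more than it shrinks `r^14`, since `36k ≥ 14k`.
  have hKr : ((K / p ^ k : ℕ) : ℝ) ≤ r ^ 14 := by
    refine le_of_pow_le_pow_left₀ (n := 36) (by norm_num) (by positivity) ?_
    have h1 : (r ^ 14) ^ 36 = (p : ℝ) ^ (14 * (n - 1 - k)) := by
      rw [← pow_mul, mul_comm, pow_mul, hr36, ← pow_mul, mul_comm]
    rw [h1]
    have h2 : (K : ℝ) ^ 36 ≤ (p : ℝ) ^ (14 * (n - 1)) := by
      calc (K : ℝ) ^ 36 = ((K : ℝ) ^ 18) ^ 2 := by ring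
        _ ≤ ((p : ℝ) ^ (7 * (n - 1))) ^ 2 := by gcongr
        _ = _ := by rw [← pow_mul]; congr 1; ring
    calc ((K / p ^ k : ℕ) : ℝ) ^ 36 ≤ (K / p ^ k : ℝ) ^ 36 := by gcongr
      _ = (K : ℝ) ^ 36 / (p : ℝ) ^ (36 * k) := by rw [div_pow, ← pow_mul, mul_comm k]
      _ ≤ (p : ℝ) ^ (14 * (n - 1)) / (p : ℝ) ^ (14 * k) := by
          gcongr
          · exact hp1.le
          · omega
      _ = (p : ℝ) ^ (14 * (n - 1 - k)) := by
          rw [div_eq_iff (by positivity), ← pow_add]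
          congr 1
          omega
  have hdata : ∀ l ∈ X, UnitCoords p l ∧ (p : ℤ) ^ (n - 1 - k) ∣ diagForm (adjCoeff a) l := by
    intro l hl
    rw [hX, Finset.mem_filter, hS, Finset.mem_filter] at hl
    exact unitCoords_and_dvd_of_coneSum_ne_zero hp2 hk ha hl.1.2 (norm_ne_zero_iff.1 hl.2)
  have hadj : UnitCoords p (adjCoeff a) := by
    refine ⟨?_, ?_, ?_⟩ <;> simp only [adjCoeff] <;> intro h <;>
      rcases hp.dvd_or_dvd h with h | h
    exacts [ha.2.1 h, ha.2.2 h, ha.1 h, ha.2.2 h, ha.1 h, ha.2.1 h]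
  have hp2' : ¬ (p : ℤ) ∣ 2 := fun h => hp2
    ((Nat.prime_dvd_prime_iff_eq hpr Nat.prime_two).1 (by exact_mod_cast h))
  have hcard := card_zeros_le hp hp2' hr0 hr36 hKk1 hKr hadj (fun l hl => (hdata l hl).1)
    (fun l hl => mem_box3.1 (Finset.mem_filter.1 (Finset.mem_filter.1 hl).1).1)
    (fun l hl => (hdata l hl).2)
  set D : ℝ := 240 * p + 2880 + 27 * (4 * p) ^ 28 with hD
  have hD0 : 0 < D := by positivity
  have hlog0 : 0 ≤ Real.log K := Real.log_natCast_nonneg K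
  have hlog : Real.log ((K / p ^ k : ℕ) : ℝ) ≤ Real.log K := by
    apply Real.log_le_log
    · exact_mod_cast hKk1
    · exact_mod_cast Nat.div_le_self _ _
  have hcard' : (X.card : ℝ) ≤ D * r ^ 17 * (1 + Real.log K) := by
    refine hcard.trans ?_
    have : D * r ^ 17 * (1 + Real.log K) = D * r ^ 14 * r ^ 3 * (1 + Real.log K) := by ring
    rw [this]
    have : 0 ≤ Real.log ((K / p ^ k : ℕ) : ℝ) := Real.log_natCast_nonneg _
    gcongr
  set E : ℝ := (p : ℝ) ^ ((3 * n + k : ℝ) / 2) with hE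
  have hterm : ∀ l ∈ X, f l ≤ E := by
    intro l hl
    rw [hX, Finset.mem_filter, hS, Finset.mem_filter] at hl
    have h1 := norm_coneSum_le hp2 hk ha hl.1.2
    have h2 : √((p : ℝ) ^ n * (p : ℝ) ^ k) ^ 3 = (p : ℝ) ^ k * E := by
      rw [hE, ← Real.rpow_natCast (p : ℝ) n, ← Real.rpow_natCast (p : ℝ) k, ← Real.rpow_add hp0,
        Real.sqrt_eq_rpow, ← Real.rpow_mul hp0.le, ← Real.rpow_natCast, ← Real.rpow_mul hp0.le,
        ← Real.rpow_add hp0]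
      congr 1
      push_cast
      ring
    rw [h2] at h1
    exact le_of_mul_le_mul_left h1 (by positivity)
  have hkn : 18 * k ≤ 7 * n := by
    have h1 : (p : ℝ) ^ (18 * k) ≤ (p : ℝ) ^ (7 * (n - 1)) := by
      refine le_trans ?_ hK
      rw [mul_comm, pow_mul]
      gcongr
      exact_mod_cast hkK
    have := (pow_le_pow_iff_right₀ hp1).1 h1
    omega
  calc ∑ l ∈ S, f l = ∑ l ∈ X, f l := (Finset.sum_filter_ne_zero S).symm
    _ ≤ X.card • E := Finset.sum_le_card_nsmul _ _ _ hterm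
    _ = X.card * E := nsmul_eq_mul _ _
    _ ≤ (D * r ^ 17 * (1 + Real.log K)) * E := by gcongr
    _ = D * (1 + Real.log K) * (r ^ 17 * E) := by ring
    _ ≤ D * (1 + Real.log K) * (p : ℝ) ^ ((2 - 11 / 648 : ℝ) * n) := by
      -- The exponent is at most `17(n-k)/36 + (3n+k)/2 = 71n/36 + k/36`, and `k ≤ 7n/18` makes it
      -- `(2 - 11/648) n`.
      have : r ^ 17 * E ≤ (p : ℝ) ^ ((2 - 11 / 648 : ℝ) * n) := by
        rw [hr, hE, ← Real.rpow_natCast, ← Real.rpow_mul hp0.le, ← Real.rpow_add hp0]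
        apply Real.rpow_le_rpow_of_exponent_le hp1.le
        have h1 : ((n - 1 - k : ℕ) : ℝ) ≤ n - k := by
          have : ((n - 1 - k + k : ℕ) : ℝ) ≤ n := by exact_mod_cast (by omega)
          push_cast at this
          linarith
        have h2 : (18 * k : ℝ) ≤ 7 * n := by exact_mod_cast hkn
        push_cast
        linarith
      gcongr

/-- The nonzero frequencies in a box. -/
theorem sum_norm_coneSum_box_le (hp2 : p ≠ 2) {K : ℕ} (hn : 3 ≤ n) (hK0 : 1 ≤ K)
    (hK : (K : ℝ) ^ 18 ≤ (p : ℝ) ^ (7 * (n - 1))) {a : ℤ × ℤ × ℤ} (ha : UnitCoords p a) :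
    ∑ l ∈ box3 K with 0 < supAbs l, ‖coneSum (p ^ n) a l‖ ≤
      n * ((240 * p + 2880 + 27 * (4 * p) ^ 28) * (1 + Real.log K) *
        (p : ℝ) ^ ((2 - 11 / 648 : ℝ) * n)) := by
  classical
  have hpr : p.Prime := Fact.out
  have hp1 : (1 : ℝ) < p := by exact_mod_cast hpr.one_lt
  let T : ℕ → Finset (ℤ × ℤ × ℤ) := fun k => (box3 (K / p ^ k)).filter
    fun l => (¬ (p : ℤ) ∣ l.1 ∨ ¬ (p : ℤ) ∣ l.2.1 ∨ ¬ (p : ℤ) ∣ l.2.2)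
  let g : ℕ → ℤ × ℤ × ℤ → ℤ × ℤ × ℤ := fun k l =>
    ((p : ℤ) ^ k * l.1, (p : ℤ) ^ k * l.2.1, (p : ℤ) ^ k * l.2.2)
  let I := (Finset.range n).filter fun k => p ^ k ≤ K
  have hkn : ∀ k, p ^ k ≤ K → k + 2 ≤ n := by
    intro k hk
    have h1 : (p : ℝ) ^ (18 * k) ≤ (p : ℝ) ^ (7 * (n - 1)) := by
      refine le_trans ?_ hK
      rw [mul_comm, pow_mul]
      gcongr
      exact_mod_cast hk
    have := (pow_le_pow_iff_right₀ hp1).1 h1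
    omega
  -- Sort the frequencies by the power of `p` they contain; at most `n` powers fit in the box.
  have hsub : (box3 K).filter (fun l => 0 < supAbs l) ⊆ I.biUnion fun k => (T k).image (g k) := by
    intro l hl
    rw [Finset.mem_filter, mem_box3] at hl
    obtain ⟨k, w, hw, hw'⟩ := exists_eq_pow_mul_of_ne_zero hpr.one_lt hl.2
    have e1 : supAbs l = p ^ k * supAbs w := by
      rw [hw, supAbs_smul, Int.natAbs_pow, Int.natAbs_natCast]
    have h0 : 0 < supAbs w := Nat.pos_of_ne_zero fun h => by simp [e1, h] at hl
    have hk : p ^ k ≤ K := by nlinarith [hl.1]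
    rw [Finset.mem_biUnion]
    refine ⟨k, Finset.mem_filter.2 ⟨Finset.mem_range.2 (by have := hkn k hk; omega), hk⟩,
      Finset.mem_image.2 ⟨w, Finset.mem_filter.2 ⟨mem_box3.2 ?_, hw'⟩, hw.symm⟩⟩
    rw [Nat.le_div_iff_mul_le (pow_pos hpr.pos k), mul_comm, ← e1]
    exact hl.1
  set Y : ℝ := (240 * p + 2880 + 27 * (4 * p) ^ 28) * (1 + Real.log K) *
    (p : ℝ) ^ ((2 - 11 / 648 : ℝ) * n) with hY
  have hlog0 : 0 ≤ Real.log K := Real.log_natCast_nonneg K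
  have hY0 : 0 ≤ Y := by positivity
  have hinj : ∀ k, Function.Injective (g k) := by
    intro k x y hxy
    have hne : (p : ℤ) ^ k ≠ 0 := pow_ne_zero _ (by exact_mod_cast hpr.ne_zero)
    simp only [g, Prod.mk.injEq, mul_right_inj' hne] at hxy
    exact Prod.ext hxy.1 (Prod.ext hxy.2.1 hxy.2.2)
  calc _ ≤ ∑ l ∈ I.biUnion fun k => (T k).image (g k), ‖coneSum (p ^ n) a l‖ :=
        Finset.sum_le_sum_of_subset_of_nonneg hsub fun _ _ _ => norm_nonneg _
    _ ≤ ∑ k ∈ I, ∑ l ∈ (T k).image (g k), ‖coneSum (p ^ n) a l‖ :=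
        sum_biUnion_le_sum_sum _ _ fun _ => norm_nonneg _
    _ = ∑ k ∈ I, ∑ l ∈ T k, ‖coneSum (p ^ n) a (g k l)‖ :=
        Finset.sum_congr rfl fun k _ => Finset.sum_image (hinj k).injOn
    _ ≤ ∑ k ∈ I, Y := Finset.sum_le_sum fun k hk => by
        have hk' := (Finset.mem_filter.1 hk).2
        exact sum_norm_coneSum_valuation_le hp2 (hkn k hk') hK0 hk' hK ha
    _ = I.card * Y := by rw [Finset.sum_const, nsmul_eq_mul]
    _ ≤ n * Y := by
        have : I.card ≤ n := (Finset.card_filter_le _ _).trans (Finset.card_range n).le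
        gcongr

end NearFrequencies

/-! ### The error term -/

theorem norm_coneSum_le_cube (q : ℕ) [NeZero q] (a l : ℤ × ℤ × ℤ) :
    ‖coneSum q a l‖ ≤ (q : ℝ) ^ 3 := by
  have h1 : (unitZeros q a).card ≤ q ^ 3 := by
    refine (Finset.card_le_univ _).trans (le_of_eq ?_)
    rw [Fintype.card_prod, Fintype.card_prod, ZMod.card]
    ring
  calc ‖coneSum q a l‖ ≤ ∑ b ∈ unitZeros q a, (1 : ℝ) := by
        refine norm_sum_le_of_le _ fun b _ => ?_
        rw [AddChar.norm_apply]
    _ = (unitZeros q a).card := by simp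
    _ ≤ (q : ℝ) ^ 3 := by exact_mod_cast h1

/-- The bound for the relative contribution of the nonzero frequencies. -/
theorem tendsto_error_bound {p : ℕ} (hp : 1 < p) (A B L : ℝ) :
    Filter.Tendsto (fun n : ℕ => A * (n * (1 + L * n)) * ((p : ℝ) ^ (-(11 / 648 : ℝ))) ^ n +
      B * ((p : ℝ)⁻¹) ^ n) Filter.atTop (nhds 0) := by
  have hp1 : (1 : ℝ) < p := by exact_mod_cast hp
  set x := (p : ℝ) ^ (-(11 / 648 : ℝ)) with hx
  have hx0 : 0 < x := Real.rpow_pos_of_pos (by linarith) _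
  have hx1 : |x| < 1 := by
    rw [abs_of_pos hx0]
    exact Real.rpow_lt_one_of_one_lt_of_neg hp1 (by norm_num)
  have hy1 : |(p : ℝ)⁻¹| < 1 := by
    rw [abs_of_pos (by positivity)]
    exact inv_lt_one_of_one_lt₀ hp1
  have h1 := tendsto_pow_const_mul_const_pow_of_abs_lt_one 1 hx1
  have h2 := tendsto_pow_const_mul_const_pow_of_abs_lt_one 2 hx1
  have h3 := tendsto_pow_const_mul_const_pow_of_abs_lt_one 0 hy1
  have h := ((h1.const_mul A).add (h2.const_mul (A * L))).add (h3.const_mul B)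
  simp only [mul_zero, add_zero] at h
  refine h.congr fun n => ?_
  ring

/-- The cutoff is at most `q^(7/18 - ε/2)`, with 18th power at most `p^((7 - 9ε)n)`; the saving `9εn
≥ 7` pays for replacing `n` by `n - 1`. -/
theorem floor_pow_le {p : ℕ} {ε N : ℝ} {n : ℕ} (hn : 7 ≤ 9 * ε * n) (hp : 1 < p)
    (hN : ((p ^ n : ℕ) : ℝ) ^ ((11 : ℝ) / 18 + ε) ≤ N) (hn1 : 1 ≤ n) :
    ((⌊((p ^ n : ℕ) : ℝ) ^ (ε / 2) / (N / (p ^ n : ℕ))⌋₊ : ℕ) : ℝ) ^ 18 ≤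
      (p : ℝ) ^ (7 * (n - 1)) := by
  have hp1 : (1 : ℝ) < p := by exact_mod_cast hp
  set q : ℝ := ((p ^ n : ℕ) : ℝ) with hq
  have hqp : q = (p : ℝ) ^ n := by rw [hq]; push_cast; rfl
  have hq0 : 0 < q := by rw [hqp]; positivity
  have hM : 0 < q ^ ((11 : ℝ) / 18 + ε) := Real.rpow_pos_of_pos hq0 _
  have hN0 : 0 < N := hM.trans_le hN
  have h1 : ((⌊q ^ (ε / 2) / (N / q)⌋₊ : ℕ) : ℝ) ≤ q ^ (7 / 18 - ε / 2) := by
    refine (Nat.floor_le (by positivity)).trans ?_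
    calc q ^ (ε / 2) / (N / q) ≤ q ^ (ε / 2) / (q ^ ((11 : ℝ) / 18 + ε) / q) := by gcongr
      _ = q ^ (ε / 2) / (q ^ ((11 : ℝ) / 18 + ε) / q ^ (1 : ℝ)) := by rw [Real.rpow_one]
      _ = q ^ (7 / 18 - ε / 2) := by
          rw [← Real.rpow_sub hq0, ← Real.rpow_sub hq0]
          congr 1
          ring
  calc _ ≤ (q ^ (7 / 18 - ε / 2)) ^ 18 := by gcongr
    _ = (p : ℝ) ^ ((n : ℝ) * ((7 / 18 - ε / 2) * 18)) := by
        rw [← Real.rpow_natCast, ← Real.rpow_mul hq0.le, hqp, ← Real.rpow_natCast,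
          ← Real.rpow_mul (by positivity)]
        norm_num
    _ ≤ (p : ℝ) ^ ((7 * (n - 1) : ℕ) : ℝ) := by
        apply Real.rpow_le_rpow_of_exponent_le hp1.le
        push_cast [Nat.cast_sub hn1]
        linarith
    _ = _ := Real.rpow_natCast _ _

theorem log_le_of_pow_le {p K n : ℕ} (hK0 : 0 < K)
    (hK : (K : ℝ) ^ 18 ≤ (p : ℝ) ^ (7 * (n - 1))) : Real.log K ≤ 7 * Real.log p * n := by
  have h0 : (0 : ℝ) < K := by exact_mod_cast hK0
  have h2 := Real.log_le_log (pow_pos h0 18) hK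
  rw [Real.log_pow, Real.log_pow] at h2
  have h3 : ((7 * (n - 1) : ℕ) : ℝ) ≤ 7 * n := by exact_mod_cast (by omega)
  have h4 := mul_le_mul_of_nonneg_right h3 (Real.log_natCast_nonneg p)
  have h5 := Real.log_natCast_nonneg K
  have h6 : ((18 : ℕ) : ℝ) * Real.log K ≤ 7 * n * Real.log p := h2.trans h4
  rw [Nat.cast_ofNat] at h6
  linarith

theorem sum_norm_coneSum_box_le_log {p : ℕ} [Fact p.Prime] {n K : ℕ} (hp2 : p ≠ 2) (hn : 3 ≤ n)
    (hK : (K : ℝ) ^ 18 ≤ (p : ℝ) ^ (7 * (n - 1))) {a : ℤ × ℤ × ℤ} (ha : UnitCoords p a) :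
    ∑ l ∈ box3 K with 0 < supAbs l, ‖coneSum (p ^ n) a l‖ ≤
      n * ((240 * p + 2880 + 27 * (4 * p) ^ 28) * (1 + 7 * Real.log p * n) *
        (p : ℝ) ^ ((2 - 11 / 648 : ℝ) * n)) := by
  have hlogp : 0 ≤ Real.log p := Real.log_natCast_nonneg p
  obtain ⟨D, hD⟩ : ∃ D : ℝ, D = 240 * p + 2880 + 27 * (4 * p) ^ 28 := ⟨_, rfl⟩
  have hD0 : 0 < D := by rw [hD]; positivity
  rw [← hD]
  -- For large `N` the cutoff is 0 and the box holds no nonzero frequency.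
  rcases Nat.eq_zero_or_pos K with hK0 | hK0
  · rw [Finset.filter_eq_empty_iff.2, Finset.sum_empty]
    · positivity
    · intro l hl
      rw [mem_box3, hK0] at hl
      omega
  · refine (sum_norm_coneSum_box_le hp2 hn hK0 hK ha).trans ?_
    rw [← hD]
    have := log_le_of_pow_le hK0 hK
    gcongr

/-- The nonzero frequencies contribute `o(q²)`. -/
theorem exists_error_bound {p : ℕ} [Fact p.Prime] {ε : ℝ} (hε : 0 < ε) (hp2 : p ≠ 2) (G : 𝓢(ℝ, ℂ)) :
    ∃ η : ℕ → ℝ, Filter.Tendsto η Filter.atTop (nhds 0) ∧ ∀ᶠ n : ℕ in Filter.atTop,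
      ∀ (a : ℤ × ℤ × ℤ) (N : ℝ), UnitCoords p a →
        ((p ^ n : ℕ) : ℝ) ^ ((11 : ℝ) / 18 + ε) ≤ N →
        ‖∑' l, scaledWeight G (N / (p ^ n : ℕ)) l * coneSum (p ^ n) a l -
          scaledWeight G (N / (p ^ n : ℕ)) 0 * coneSum (p ^ n) a 0‖ ≤ η n * ((p : ℝ) ^ n) ^ 2 := by
  classical
  have hpr : p.Prime := Fact.out
  have hp1 : (1 : ℝ) < p := by exact_mod_cast hpr.one_lt
  -- `T^B ≥ q^8` absorbs `q^6` from `(min 1 c)^(-6)` and the trivial bound `q^3` for the cone sum,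
  -- leaving `q = o(q²)`.
  obtain ⟨B, hB⟩ := exists_nat_ge (8 / (ε / 2))
  have hB' : 8 ≤ ε / 2 * B := by
    rw [div_le_iff₀ (by positivity)] at hB
    linarith
  obtain ⟨C₁, hC₁, hW₁⟩ := exists_norm_scaledWeight_le G
  obtain ⟨C₂, hC₂, hW₂⟩ := exists_norm_scaledWeight_le_of_lt_supAbs G B
  obtain ⟨D, hD⟩ : ∃ D : ℝ, D = 240 * p + 2880 + 27 * (4 * p) ^ 28 := ⟨_, rfl⟩
  have hD0 : 0 < D := by rw [hD]; positivity
  set s : ℝ := ∑' l, decayWeight l with hs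
  have hs0 : 0 ≤ s := tsum_nonneg decayWeight_nonneg
  refine ⟨_, tendsto_error_bound hpr.one_lt (C₁ * D) (C₂ * s) (7 * Real.log p), ?_⟩
  obtain ⟨n₀, hn₀⟩ := exists_nat_ge (7 / (9 * ε))
  filter_upwards [Filter.eventually_ge_atTop (max 3 n₀)] with n hn a N ha hN
  have hn3 : 3 ≤ n := (le_max_left _ _).trans hn
  have hn9 : 7 ≤ 9 * ε * n := by
    have h1 : (n₀ : ℝ) ≤ n := by exact_mod_cast (le_max_right _ _).trans hn
    have h2 := hn₀.trans h1
    rw [div_le_iff₀ (by positivity)] at h2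
    linarith
  have hfloor := floor_pow_le hn9 hpr.one_lt hN (by omega)
  set K : ℕ := ⌊((p ^ n : ℕ) : ℝ) ^ (ε / 2) / (N / (p ^ n : ℕ))⌋₊ with hK
  set q : ℝ := ((p ^ n : ℕ) : ℝ) with hq
  have hqp : q = (p : ℝ) ^ n := by rw [hq]; push_cast; rfl
  have hq1 : 1 ≤ q := by rw [hqp]; exact one_le_pow₀ hp1.le
  have hq0 : 0 < q := by linarith
  have hN1 : 1 ≤ N := le_trans (Real.one_le_rpow hq1 (by positivity)) hN
  set T : ℝ := q ^ (ε / 2) with hT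
  have hT1 : 1 ≤ T := Real.one_le_rpow hq1 (by positivity)
  set c : ℝ := N / q with hc
  have hc0 : 0 < c := by positivity
  have hTK : T ≤ (K + 1) * c := by
    have := (Nat.lt_floor_add_one (T / c)).le
    rwa [div_le_iff₀ hc0] at this
  have hmin : (min 1 c ^ 6)⁻¹ ≤ q ^ 6 := by
    have h1 : q⁻¹ ≤ min 1 c := by
      refine le_min (inv_le_one_of_one_le₀ hq1) ?_
      rw [hc, div_eq_mul_inv]
      exact le_mul_of_one_le_left (by positivity) hN1
    rw [← inv_pow]
    gcongr
    exact inv_le_of_inv_le₀ hq0 h1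
  have hTB : (T ^ B)⁻¹ ≤ (q ^ 8)⁻¹ := by
    gcongr
    rw [hT, ← Real.rpow_natCast (q ^ (ε / 2)), ← Real.rpow_mul hq0.le, ← Real.rpow_natCast q 8]
    exact Real.rpow_le_rpow_of_exponent_le hq1 (by exact_mod_cast hB')
  set f : ℤ × ℤ × ℤ → ℂ := fun l => scaledWeight G c l * coneSum (p ^ n) a l with hf
  have hfle : ∀ l, ‖f l‖ ≤ ‖scaledWeight G c l‖ * q ^ 3 := fun l => by
    rw [hf, norm_mul]
    gcongr
    exact norm_coneSum_le_cube (p ^ n) a l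
  have hsum : Summable f := (Summable.of_nonneg_of_le (fun l => norm_nonneg _) hfle
    ((summable_norm_scaledWeight G hc0).mul_right _)).of_norm
  set S := (box3 K).filter fun l => 0 < supAbs l with hS
  set Y : ℝ := ∑ l ∈ S, ‖coneSum (p ^ n) a l‖ with hY
  set u : ℤ × ℤ × ℤ → ℝ := fun l => if l ∈ S then C₁ * ‖coneSum (p ^ n) a l‖ else 0 with hu
  have hu' : HasSum u (C₁ * Y) := by
    have h1 : HasSum u (∑ l ∈ S, u l) := hasSum_sum_of_ne_finset_zero fun l hl => if_neg hl
    have h2 : ∑ l ∈ S, u l = C₁ * Y := by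
      rw [hY, Finset.mul_sum]
      exact Finset.sum_congr rfl fun l hl => if_pos hl
    rwa [h2] at h1
  have hv' : HasSum (fun l => C₂ * q * decayWeight l) (C₂ * q * s) :=
    summable_decayWeight.hasSum.mul_left _
  have hpoint : ∀ l, ‖(if l = 0 then 0 else f l : ℂ)‖ ≤ u l + C₂ * q * decayWeight l := by
    intro l
    have hu0 : 0 ≤ u l := by
      rw [hu]; dsimp only; split_ifs <;> positivity
    have hd0 : 0 ≤ C₂ * q * decayWeight l := mul_nonneg (by positivity) (decayWeight_nonneg l)
    by_cases h0 : l = 0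
    · rw [if_pos h0, norm_zero]
      positivity
    rw [if_neg h0]
    by_cases hl : supAbs l ≤ K
    · have hlS : l ∈ S := by
        refine Finset.mem_filter.2 ⟨mem_box3.2 hl, Nat.pos_of_ne_zero fun h => h0 ?_⟩
        have := supAbs_le_iff.1 h.le
        simp only [Nat.cast_zero, abs_nonpos_iff] at this
        exact Prod.ext this.1 (Prod.ext this.2.1 this.2.2)
      have : ‖f l‖ ≤ u l := by
        rw [hu, hf]
        dsimp only
        rw [if_pos hlS, norm_mul]
        gcongr
        exact hW₁ c l
      linarith
    · have : ‖f l‖ ≤ C₂ * q * decayWeight l := by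
        calc ‖f l‖ ≤ ‖scaledWeight G c l‖ * q ^ 3 := hfle l
          _ ≤ (C₂ * (T ^ B)⁻¹ * (min 1 c ^ 6)⁻¹ * decayWeight l) * q ^ 3 := by
              gcongr
              exact hW₂ c T K l hc0 hT1 hTK (not_le.1 hl)
          _ ≤ (C₂ * (q ^ 8)⁻¹ * q ^ 6 * decayWeight l) * q ^ 3 := by
              have := decayWeight_nonneg l
              gcongr
          _ = C₂ * q * decayWeight l := by
              field_simp
      linarith
  have hYle : Y ≤ n * (D * (1 + 7 * Real.log p * n) * (p : ℝ) ^ ((2 - 11 / 648 : ℝ) * n)) := by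
    rw [hD]
    exact sum_norm_coneSum_box_le_log hp2 hn3 hfloor ha
  rw [hsum.tsum_eq_add_tsum_ite 0, add_sub_cancel_left]
  refine (tsum_of_norm_bounded (hu'.add hv') hpoint).trans ?_
  have e1 : (p : ℝ) ^ ((2 - 11 / 648 : ℝ) * n) = ((p : ℝ) ^ (-(11 / 648 : ℝ))) ^ n * q ^ 2 := by
    rw [hqp, ← pow_mul, mul_comm n 2, pow_mul, ← mul_pow, Real.rpow_mul_natCast (by positivity)]
    congr 1
    rw [sub_eq_neg_add, Real.rpow_add (by positivity), Real.rpow_two]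
  have e2 : q = ((p : ℝ)⁻¹) ^ n * q ^ 2 := by
    rw [inv_pow, ← hqp]
    field_simp
  rw [← hqp]
  calc C₁ * Y + C₂ * q * s ≤ C₁ * (n * (D * (1 + 7 * Real.log p * n) *
        (p : ℝ) ^ ((2 - 11 / 648 : ℝ) * n))) + C₂ * q * s := by gcongr
    _ = C₁ * (n * (D * (1 + 7 * Real.log p * n) *
        (((p : ℝ) ^ (-(11 / 648 : ℝ))) ^ n * q ^ 2))) + C₂ * (((p : ℝ)⁻¹) ^ n * q ^ 2) * s := by
        rw [e1, ← e2]
    _ = _ := by ring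

/-! ### Conclusion -/

/-- `phiHat Φ 0` is the integral of a nonnegative continuous function. In this degenerate case both
sides of the asymptotic are identically zero. -/
theorem eq_zero_of_phiHat_zero {Φ : 𝓢(ℝ, ℝ)} (hΦ : ∀ x, 0 ≤ Φ x) (h : phiHat Φ 0 = 0) (x : ℝ) :
    Φ x = 0 := by
  have h1 : phiHat Φ 0 = ((∫ x, Φ x : ℝ) : ℂ) := by
    rw [phiHat, Real.fourier_real_eq, ← integral_complex_ofReal]
    simp
  rw [h1, Complex.ofReal_eq_zero, MeasureTheory.integral_eq_zero_iff_of_nonneg hΦ Φ.integrable] at h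
  exact congr_fun ((Φ.continuous.ae_eq_iff_eq _ continuous_zero).1 h) x

/-- `p - s_p` is a positive integer, hence at least 1. The bound is independent of the coefficients,
which may vary with `n`. -/
theorem le_cConst {p : ℕ} [Fact p.Prime] {a₁ a₂ a₃ : ℤ} (h : sSym p a₁ a₂ a₃ < (p : ℤ)) :
    ((p : ℝ) - 1) / (p : ℝ) ^ 2 ≤ cConst p a₁ a₂ a₃ := by
  have hp1 : (1 : ℝ) < p := by exact_mod_cast (Fact.out : p.Prime).one_lt
  have h1 : ((sSym p a₁ a₂ a₃ + 1 : ℤ) : ℝ) ≤ p := by exact_mod_cast h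
  push_cast at h1
  rw [cConst]
  gcongr
  exact le_mul_of_one_le_left (by linarith) (by linarith)

theorem unitCoords_of_isCoprime {p : ℕ} [Fact p.Prime] {a₁ a₂ a₃ : ℤ} (h₁ : IsCoprime a₁ (p : ℤ))
    (h₂ : IsCoprime a₂ (p : ℤ)) (h₃ : IsCoprime a₃ (p : ℤ)) : UnitCoords p (a₁, a₂, a₃) := by
  have hp : Prime (p : ℤ) := Nat.prime_iff_prime_int.1 Fact.out
  rw [isCoprime_comm, hp.coprime_iff_not_dvd] at h₁ h₂ h₃
  exact ⟨h₁, h₂, h₃⟩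

theorem theorem2 (ε : ℝ) (hε : 0 < ε) (p : ℕ) [Fact p.Prime] (hp : 2 < p)
    (Φ : 𝓢(ℝ, ℝ)) (hΦ : ∀ x, 0 ≤ Φ x)
    (α₁ α₂ α₃ : ℕ → ℤ)
    (hα₁ : ∀ n, IsCoprime (α₁ n) (p : ℤ))
    (hα₂ : ∀ n, IsCoprime (α₂ n) (p : ℤ))
    (hα₃ : ∀ n, IsCoprime (α₃ n) (p : ℤ))
    (hs : ∀ n, sSym p (α₁ n) (α₂ n) (α₃ n) < (p : ℤ))
    (N : ℕ → ℝ)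
    (hN : ∀ n, ((p ^ n : ℕ) : ℝ) ^ ((11 : ℝ) / 18 + ε) ≤ N n) :
    (∀ n, Summable fun x : solSet p (p ^ n) (α₁ n) (α₂ n) (α₃ n) =>
      tripleWeight Φ (N n) x) ∧
    Asymptotics.IsEquivalent Filter.atTop
      (fun n : ℕ =>
        ((∑' x : solSet p (p ^ n) (α₁ n) (α₂ n) (α₃ n), tripleWeight Φ (N n) x : ℝ) : ℂ))
      (fun n : ℕ =>
        phiHat Φ 0 ^ 3 *
          ((cConst p (α₁ n) (α₂ n) (α₃ n) * (N n ^ 3 / ((p ^ n : ℕ) : ℝ)) : ℝ) : ℂ)) := by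
  have hp0 : (0 : ℝ) < p := by positivity
  have hp1 : (1 : ℝ) < p := by exact_mod_cast (by omega : 1 < p)
  have hN0 : ∀ n, 0 < N n := fun n =>
    (Real.rpow_pos_of_pos (by push_cast; positivity) _).trans_le (hN n)
  refine ⟨fun n => (summable_tripleWeight Φ (hN0 n)).subtype _, ?_⟩
  by_cases hzero : phiHat Φ 0 = 0
  · have hΦ0 := eq_zero_of_phiHat_zero hΦ hzero
    simp [hzero, tripleWeight, hΦ0, Asymptotics.IsEquivalent.refl]
  obtain ⟨η, hη, hbound⟩ := exists_error_bound (p := p) hε (by omega) (𝓕 Φ.complexify)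
  -- A lower bound, uniform in `n`, for the norm of the main term divided by `N³/q`; the error is
  -- beaten once `η n < c * κ`.
  set κ : ℝ := ‖phiHat Φ 0‖ ^ 3 * (((p : ℝ) - 1) / (p : ℝ) ^ 2) with hκ
  have hκ0 : 0 < κ := by
    have h1 : 0 < (p : ℝ) - 1 := by linarith
    have h2 : 0 < ‖phiHat Φ 0‖ := norm_pos_iff.2 hzero
    positivity
  rw [Asymptotics.IsEquivalent, Asymptotics.isLittleO_iff]
  intro c hc
  filter_upwards [hbound, hη.eventually (gt_mem_nhds (mul_pos hc hκ0)),
    Filter.eventually_ne_atTop 0] with n hn hηn hn0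
  have ha := unitCoords_of_isCoprime (hα₁ n) (hα₂ n) (hα₃ n)
  have h1 := hn (α₁ n, α₂ n, α₃ n) (N n) ha (hN n)
  have h2 := tsum_eq_tsum_coneSum Φ (hN0 n) (mem_solSet_iff (p := p) hn0 (α₁ n, α₂ n, α₃ n))
  dsimp only at h2
  rw [Pi.sub_apply, h2]
  set q : ℝ := ((p ^ n : ℕ) : ℝ) with hq
  have hqp : q = (p : ℝ) ^ n := by rw [hq]; push_cast; rfl
  have hq0 : 0 < q := by rw [hqp]; positivity
  rw [← hqp] at h1
  set C := cConst p (α₁ n) (α₂ n) (α₃ n) with hC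
  have hCle : ((p : ℝ) - 1) / (p : ℝ) ^ 2 ≤ C := le_cConst (hs n)
  have hC0 : 0 ≤ C := le_trans (div_nonneg (by linarith) (by positivity)) hCle
  have hcone : coneSum (p ^ n) (α₁ n, α₂ n, α₃ n) 0 = ((C * q ^ 2 : ℝ) : ℂ) := by
    have h3 := card_unitZeros_eq (p := p) (n := n) (by omega) hn0 ha
    rw [← hqp] at h3
    rw [hC, ← h3]
    simp [coneSum]
  have hweight : scaledWeight (𝓕 Φ.complexify) (N n / q) 0 = phiHat Φ 0 ^ 3 := by
    rw [phiHat_eq_fourier_complexify]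
    simp only [scaledWeight, Prod.fst_zero, Prod.snd_zero, Int.cast_zero, zero_mul]
    ring
  have hmain : phiHat Φ 0 ^ 3 * ((C * (N n ^ 3 / q) : ℝ) : ℂ) =
      ((N n / q : ℝ) : ℂ) ^ 3 * (scaledWeight (𝓕 Φ.complexify) (N n / q) 0 *
        coneSum (p ^ n) (α₁ n, α₂ n, α₃ n) 0) := by
    rw [hcone, hweight]
    have : (q : ℂ) ≠ 0 := by exact_mod_cast hq0.ne'
    push_cast
    field_simp
  have hnorm : ‖phiHat Φ 0 ^ 3 * ((C * (N n ^ 3 / q) : ℝ) : ℂ)‖ =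
      ‖phiHat Φ 0‖ ^ 3 * (C * (N n ^ 3 / q)) := by
    have := hN0 n
    rw [norm_mul, norm_pow, Complex.norm_real, Real.norm_of_nonneg (by positivity)]
  rw [hnorm, hmain, ← mul_sub, norm_mul, norm_pow, Complex.norm_real,
    Real.norm_of_nonneg (by have := hN0 n; positivity)]
  have hN0' := hN0 n
  calc (N n / q) ^ 3 * _ ≤ (N n / q) ^ 3 * (η n * q ^ 2) := by gcongr
    _ ≤ (N n / q) ^ 3 * (c * κ * q ^ 2) := by gcongr
    _ = c * (‖phiHat Φ 0‖ ^ 3 * (((p : ℝ) - 1) / (p : ℝ) ^ 2 * (N n ^ 3 / q))) := by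
        rw [hκ]
        field_simp
    _ ≤ c * (‖phiHat Φ 0‖ ^ 3 * (C * (N n ^ 3 / q))) := by gcongr
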